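/- **Setting.** Let $\omega=\frac{-1+\sqrt{-3}}2$, let $N$ be the norm of $\mathbb Z[\omega]$, and let $\mathcal A$ be the set of square-free $\alpha\in\mathbb Z[\omega]$ with $\alpha\equiv 1 \pmod 3$, with no rational prime divisor, and with $N(\alpha)>1$. For $\alpha\in\mathcal A$ let $\chi_\alpha(n)=\left(\frac n\alpha\right)_3$ (cubic residue symbol), a primitive cubic Dirichlet character of conductor $q=N(\alpha)$. Fix an even, nonnegative Schwartz function $w$ on $\mathbb R$ that is not identically zero, and for $X>2\pi e$ put $$W^*(X)=\sum_{\alpha\in\mathcal A} w\!\left(\tfrac{N(\alpha)}X\right),\qquad L=\log\frac{X}{2\pi e},\qquad a(p)=\begin{cases}\frac p{p+2}& p\equiv1 \pmod 3,\\ 1&\text{otherwise}\end{cases}\quad(p\text{ prime}).$$ For an even Schwartz function $\phi:\mathbb R\to\mathbb C$ whose Fourier transform $\hat\phi(x)=\int_{\mathbb R}\phi(\tau)e^{-2\pi i x\tau}\,d\tau$ has compact support, extended to an entire function by $\phi(z)=\int_{\mathbb R}\hat\phi(x)e^{2\pi i xz}\,dx$, the one-level density of the family is $$\mathcal D^*(\phi;X)=\frac1{W^*(X)}\sum_{\alpha\in\mathcal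 A}w\!\left(\tfrac{N(\alpha)}X\right)\sum_{\gamma}\phi\!\left(\gamma\frac L{2\pi}\right),$$ where $\gamma=-i(\rho-\frac12)$ and $\rho$ runs, with multiplicity, over the zeros of $L(\chi_\alpha,s)$ with $0<\operatorname{Re}s<1$. **Ratios Conjecture (for $w$).** For all fixed $\delta,\varepsilon>0$ there is a constant $C$ such that, for all sufficiently large $X$ and all $\nu',\nu\in\mathbb C$ with $\operatorname{Re}\nu'\ge\delta$, $\operatorname{Re}\nu\ge\delta$ and $|\operatorname{Im}\nu'|,|\operatorname{Im}\nu|\le X^{1-\varepsilon}$: the quotients below are defined, that is, $L(\chi_\alpha,\frac12+\nu)\ne0$ whenever $\alpha\in\mathcal A$ and $w(N(\alpha)/X)\neq 0$, and $$\left|\sum_{\alpha\in\mathcal A}w\!\left(\tfrac{N(\alpha)}X\right)\frac{L(\chi_\alpha,\frac12+\nu')}{L(\chi_\alpha,\frac12+\nu)}-W^*(X)\,\frac{\zeta(\frac32+3\nu')}{\zeta(\frac32+2\nu'+\nu)}A(\nu';\nu)\right|\le C X^{1/2+\varepsilon},$$ where $$A(\nu';\nu)=\frac{\zeta(\frac32+2\nu'+\nu)}{\zeta(\frac32+3\nu')}\prod_p\left(1+a(p)\frac{1-p^{\nu'-\nu}}{p^{3/2+3\nu'}-1}\right).$$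 **Theorem.** Assume the Ratios Conjecture for $w$, and let $\phi$ be an even Schwartz function whose Fourier transform has compact support. Then for every $\varepsilon>0$, as $X\to\infty$, $$\begin{aligned}\mathcal D^*(\phi;X)={}&\frac{\hat\phi(0)}{L\,W^*(X)}\sum_{\alpha\in\mathcal A}w\!\left(\tfrac{N(\alpha)}X\right)\log N(\alpha)-\frac{\hat\phi(0)\log\pi}{L}\\&-\frac2L\int_{-\infty}^\infty\phi(\tau)\sum_{\ell\ge1}\sum_p\frac{a(p)\log p}{p^{3\ell/2+6\pi i\tau\ell/L}}\,d\tau\\&+\frac1{2L}\int_{-\infty}^\infty\phi(\tau)\left(\Psi\!\left(\tfrac14-\tfrac{\pi i\tau}L\right)+\Psi\!\left(\tfrac14+\tfrac{\pi i\tau}L\right)\right)d\tau+O\!\left(X^{-1/2+\varepsilon}\right),\end{aligned}$$ where $\Psi=\Gamma'/\Gamma$ is the digamma function and the implied constant may depend on $w$, $\phi$ and $\varepsilon$. -/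

import Mathlib

open scoped SchwartzMap FourierTransform NumberField

namespace CubicRatios

noncomputable section

/-! ### The Eisenstein integers and the cubic residue symbol -/

/-- The field `ℚ(ω)`, realised as the third cyclotomic field. -/
abbrev EisField : Type := CyclotomicField 3 ℚ

instance instCyclotomicEisField : IsCyclotomicExtension {3} ℚ EisField :=
  CyclotomicField.isCyclotomicExtension 3 ℚ

/-- The ring `ℤ[ω]` of Eisenstein integers. -/
abbrev EisInt : Type := 𝓞 EisField

/-- The element `ω` of `ℤ[ω]`, a primitive cube root of unity. -/
def omega : EisInt := (IsCyclotomicExtension.zeta_spec 3 ℚ EisField).toInteger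

/-- The complex number `ω = (-1 + √-3) / 2`. -/
def omegaC : ℂ := (-1 + (Real.sqrt 3 : ℂ) * Complex.I) / 2

/-- The norm `N(α)` of an Eisenstein integer (which is always nonnegative), as a natural number. -/
def nrm (α : EisInt) : ℕ := (Algebra.norm ℤ α).natAbs

open scoped Classical in
/-- The cubic residue symbol `(x / P)₃` for a nonzero prime ideal `P` of `ℤ[ω]` not containing `3`:
it is `0` if `x ∈ P`, and otherwise it is the complex cube root of unity `ω ^ k` determined by
`x ^ ((N(P) - 1) / 3) ≡ ω ^ k mod P` (exactly one of `k = 0, 1, 2` satisfies this congruence). -/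
def primeSymbol (P : Ideal EisInt) (x : EisInt) : ℂ :=
  if x ∈ P then 0
  else if x ^ ((Ideal.absNorm P - 1) / 3) - 1 ∈ P then 1
  else if x ^ ((Ideal.absNorm P - 1) / 3) - omega ∈ P then omegaC
  else omegaC ^ 2

open scoped Classical in
/-- The cubic residue symbol `(x / α)₃`, extended multiplicatively in the denominator: the product
of the symbols `(x / P)₃` over the prime ideal factors `P` of `(α)`, with multiplicity. -/
def cubicSymbol (α x : EisInt) : ℂ :=
  ((UniqueFactorizationMonoid.normalizedFactors (Ideal.span {α})).map
    fun P => primeSymbol P x).prod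

/-- The parameter set of the family: `α ∈ ℤ[ω]` with `α ≡ 1 mod 3`, square-free, without rational
prime divisor, and with `N(α) > 1`. -/
def family : Set EisInt :=
  {α | (3 : EisInt) ∣ α - 1 ∧ Squarefree α ∧ (∀ p : ℕ, p.Prime → ¬ (p : EisInt) ∣ α) ∧ 1 < nrm α}

lemma omegaC_cube : omegaC ^ 3 = 1 := by
  have h : ((Real.sqrt 3 : ℝ) : ℂ) ^ 2 = 3 := by
    rw [← Complex.ofReal_pow, Real.sq_sqrt (by norm_num)]; norm_num
  have hI : Complex.I ^ 2 = -1 := Complex.I_sq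
  unfold omegaC
  generalize ((Real.sqrt 3 : ℝ) : ℂ) = s at h ⊢
  generalize Complex.I = i at hI ⊢
  linear_combination (-3 / 8 + i * s / 8) * i ^ 2 * h + (-9 / 8 + 3 * i * s / 8) * hI

lemma omegaC_ne_zero : omegaC ≠ 0 := by
  intro h
  have := omegaC_cube
  rw [h] at this
  norm_num at this

lemma omega_cube : omega ^ 3 = 1 :=
  (IsCyclotomicExtension.zeta_spec 3 ℚ EisField).toInteger_isPrimitiveRoot.pow_eq_one

lemma omega_quad : omega ^ 2 + omega + 1 = 0 := by
  have h1 : omega ≠ 1 :=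
    (IsCyclotomicExtension.zeta_spec 3 ℚ EisField).toInteger_isPrimitiveRoot.ne_one (by norm_num)
  have h2 : (omega - 1) * (omega ^ 2 + omega + 1) = 0 := by
    linear_combination omega_cube
  exact (mul_eq_zero.1 h2).resolve_left (sub_ne_zero.2 h1)

lemma omega_sub_one_notMem {P : Ideal EisInt} (h3 : (3 : EisInt) ∉ P) : omega - 1 ∉ P := by
  intro h
  apply h3
  have : (3 : EisInt) = -(omega + 2) * (omega - 1) := by
    linear_combination omega_quad
  rw [this]
  exact P.mul_mem_left _ h

lemma omega_pow_mod (k : ℕ) : omega ^ k = omega ^ (k % 3) := by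
  conv_lhs => rw [← Nat.div_add_mod k 3, pow_add, pow_mul, omega_cube, one_pow, one_mul]

lemma omegaC_pow_mod (k : ℕ) : omegaC ^ k = omegaC ^ (k % 3) := by
  conv_lhs => rw [← Nat.div_add_mod k 3, pow_add, pow_mul, omegaC_cube, one_pow, one_mul]

/-- Every value of the symbol outside `P` is given by the congruence that defines it. -/
lemma primeSymbol_eq {P : Ideal EisInt} [hP : P.IsPrime] (h3 : (3 : EisInt) ∉ P) {x : EisInt}
    (hx : x ∉ P) {k : ℕ} (hk : x ^ ((Ideal.absNorm P - 1) / 3) - omega ^ k ∈ P) :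
    primeSymbol P x = omegaC ^ k := by
  have hw : omega ∉ P := fun h => hP.ne_top ((Ideal.eq_top_iff_one P).2 (by
    rw [← omega_cube]; exact Ideal.pow_mem_of_mem P h 3 (by norm_num)))
  have hw1 := omega_sub_one_notMem h3
  rw [omega_pow_mod] at hk
  rw [omegaC_pow_mod]
  have hk3 : k % 3 < 3 := Nat.mod_lt _ (by norm_num)
  generalize k % 3 = j at hk hk3 ⊢
  unfold primeSymbol
  rw [if_neg hx]
  generalize x ^ ((Ideal.absNorm P - 1) / 3) = y at hk ⊢
  interval_cases j
  · rw [if_pos (by simpa using hk)]; simp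
  · rw [if_neg, if_pos (by simpa using hk)]
    · simp
    · intro h
      apply hw1
      have := P.sub_mem h hk
      have e : y - 1 - (y - omega ^ 1) = omega - 1 := by ring
      rwa [e] at this
  · rw [if_neg, if_neg]
    · intro h
      have := P.sub_mem h hk
      have e : y - omega - (y - omega ^ 2) = omega * (omega - 1) := by ring
      rw [e] at this
      exact (hP.mem_or_mem this).elim hw hw1
    · intro h
      have := P.sub_mem h hk
      have e : y - 1 - (y - omega ^ 2) = (omega - 1) * (-omega ^ 2) := by
        linear_combination omega_cube
      rw [e] at this
      refine (hP.mem_or_mem this).elim hw1 fun h' => hw ?_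
      exact hP.mem_of_pow_mem 2 (by simpa using h')

/-- For `x ∉ P` the defining congruence is solvable. -/
lemma exists_congr {P : Ideal EisInt} [hP : P.IsPrime] (h0 : P ≠ ⊥) (h3 : (3 : EisInt) ∉ P)
    {x : EisInt} (hx : x ∉ P) :
    ∃ k : ℕ, x ^ ((Ideal.absNorm P - 1) / 3) - omega ^ k ∈ P := by
  have hmax : P.IsMaximal := hP.isMaximal h0
  let F := EisInt ⧸ P
  let _ : Field F := Ideal.Quotient.field P
  have : Finite F := Ideal.finiteQuotientOfFreeOfNeBot P h0
  let _ : Fintype F := Fintype.ofFinite F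
  have hcard : Fintype.card F = Ideal.absNorm P := by
    rw [← Nat.card_eq_fintype_card]; rfl
  let f : EisInt →+* F := Ideal.Quotient.mk P
  have hf : ∀ z, f z = 0 ↔ z ∈ P := fun z => Ideal.Quotient.eq_zero_iff_mem
  have hw : f omega ≠ 1 := fun h => omega_sub_one_notMem h3 ((hf _).1 (by simp [h]))
  have hord : orderOf (f omega) = 3 := by
    refine orderOf_eq_prime ?_ hw
    rw [← map_pow, omega_cube, map_one]
  have hw0 : f omega ≠ 0 := by
    intro h
    have := congrArg f omega_cube
    rw [map_pow, h, map_one] at this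
    norm_num at this
  have hdvd : 3 ∣ Ideal.absNorm P - 1 := by
    have h := orderOf_dvd_of_pow_eq_one (FiniteField.pow_card_sub_one_eq_one _ hw0)
    rwa [hord, hcard] at h
  have hx0 : f x ≠ 0 := fun h => hx ((hf _).1 h)
  set m := (Ideal.absNorm P - 1) / 3 with hm
  have hcube : (f x ^ m) ^ 3 = 1 := by
    rw [← pow_mul, hm, Nat.div_mul_cancel hdvd, ← hcard]
    exact FiniteField.pow_card_sub_one_eq_one _ hx0
  have hq : f omega ^ 2 + f omega + 1 = 0 := by
    rw [← map_pow, ← map_add, ← map_one f, ← map_add, omega_quad, map_zero]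
  have hprod : (f x ^ m - 1) * ((f x ^ m - f omega) * (f x ^ m - f omega ^ 2)) = 0 := by
    generalize f x ^ m = y at hcube
    generalize f omega = v at hq
    linear_combination hcube + (y - 1) * (v - 1 - y) * hq
  have key : ∀ k, f x ^ m - f omega ^ k = 0 → x ^ m - omega ^ k ∈ P := by
    intro k h
    rw [← hf, map_sub, map_pow, map_pow, h]
  rcases mul_eq_zero.1 hprod with h | h
  · exact ⟨0, key 0 (by simpa using h)⟩
  · rcases mul_eq_zero.1 h with h | h
    · exact ⟨1, key 1 (by simpa using h)⟩
    · exact ⟨2, key 2 h⟩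

lemma primeSymbol_mul {P : Ideal EisInt} [hP : P.IsPrime] (h0 : P ≠ ⊥) (h3 : (3 : EisInt) ∉ P)
    (x y : EisInt) : primeSymbol P (x * y) = primeSymbol P x * primeSymbol P y := by
  by_cases hx : x ∈ P
  · simp [primeSymbol, hx, P.mul_mem_right y hx]
  by_cases hy : y ∈ P
  · simp [primeSymbol, hy, P.mul_mem_left x hy]
  obtain ⟨j, hj⟩ := exists_congr h0 h3 hx
  obtain ⟨k, hk⟩ := exists_congr h0 h3 hy
  have hxy : x * y ∉ P := fun h => (hP.mem_or_mem h).elim hx hy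
  rw [primeSymbol_eq h3 hx hj, primeSymbol_eq h3 hy hk, ← pow_add]
  apply primeSymbol_eq h3 hxy
  generalize (Ideal.absNorm P - 1) / 3 = m at hj hk
  have e : (x * y) ^ m - omega ^ (j + k)
      = (x ^ m - omega ^ j) * y ^ m + omega ^ j * (y ^ m - omega ^ k) := by ring
  rw [e]
  exact P.add_mem (P.mul_mem_right _ hj) (P.mul_mem_left _ hk)

lemma primeSymbol_one {P : Ideal EisInt} [hP : P.IsPrime] : primeSymbol P 1 = 1 := by
  have : (1 : EisInt) ∉ P := fun h => hP.ne_top ((Ideal.eq_top_iff_one P).2 h)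
  simp [primeSymbol, this]

/-- The symbol depends only on the residue class modulo `P`. -/
lemma primeSymbol_congr {P : Ideal EisInt} {x y : EisInt} (h : x - y ∈ P) :
    primeSymbol P x = primeSymbol P y := by
  have h1 : x ∈ P ↔ y ∈ P :=
    ⟨fun hx => by simpa using P.sub_mem hx h, fun hy => by simpa using P.add_mem h hy⟩
  have h2 : ∀ (m : ℕ) (c : EisInt), x ^ m - c ∈ P ↔ y ^ m - c ∈ P := by
    intro m c
    have hd : x ^ m - y ^ m ∈ P := Ideal.mem_of_dvd P (sub_dvd_pow_sub_pow x y m) h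
    constructor
    · intro hx
      have := P.sub_mem hx hd
      rwa [show x ^ m - c - (x ^ m - y ^ m) = y ^ m - c by ring] at this
    · intro hy
      have := P.add_mem hd hy
      rwa [show x ^ m - y ^ m + (y ^ m - c) = x ^ m - c by ring] at this
  unfold primeSymbol
  classical
  exact if_congr h1 rfl (if_congr (h2 _ _) rfl (if_congr (h2 _ _) rfl rfl))

lemma family_ne_zero {α : EisInt} (hα : α ∈ family) : α ≠ 0 := by
  rintro rfl
  have := hα.2.2.2
  simp [nrm] at this

open scoped Classical in
/-- The prime factors of `(α)`, for `α` in the family, are nonzero primes not containing `3`. -/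
lemma factor_spec {α : EisInt} (hα : α ∈ family) {P : Ideal EisInt}
    (hP : P ∈ UniqueFactorizationMonoid.normalizedFactors (Ideal.span {α})) :
    P.IsPrime ∧ P ≠ ⊥ ∧ (3 : EisInt) ∉ P ∧ α ∈ P := by
  have hp := UniqueFactorizationMonoid.prime_of_normalized_factor P hP
  have hle : Ideal.span {α} ≤ P :=
    Ideal.dvd_iff_le.1 (UniqueFactorizationMonoid.dvd_of_mem_normalizedFactors hP)
  have hmem : α ∈ P := hle (Ideal.mem_span_singleton_self α)
  have hprime : P.IsPrime := Ideal.isPrime_of_prime hp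
  refine ⟨hprime, hp.ne_zero, fun h3 => hprime.ne_top ((Ideal.eq_top_iff_one P).2 ?_), hmem⟩
  have := P.sub_mem hmem (Ideal.mem_of_dvd P hα.1 h3)
  simpa using this

lemma nrm_mem {α : EisInt} {P : Ideal EisInt} (h : α ∈ P) : ((nrm α : ℕ) : EisInt) ∈ P := by
  have h1 := Ideal.absNorm_mem (Ideal.span {α})
  rw [Ideal.absNorm_span_singleton] at h1
  exact (Ideal.span_singleton_le_iff_mem P).2 h h1

/-- If a rational prime divides the norm of a prime ideal then it lies in the ideal. -/
lemma prime_mem_of_dvd_absNorm {P : Ideal EisInt} [hP : P.IsPrime] (h0 : P ≠ ⊥) {p : ℕ}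
    (hp : p.Prime) (h : p ∣ Ideal.absNorm P) : (p : EisInt) ∈ P := by
  have : Fact p.Prime := ⟨hp⟩
  have : Finite (EisInt ⧸ P) := Ideal.finiteQuotientOfFreeOfNeBot P h0
  have h' : p ∣ Nat.card (EisInt ⧸ P) := h
  obtain ⟨z, hz⟩ := exists_prime_addOrderOf_dvd_card' p h'
  have hz0 : z ≠ 0 := by
    rintro rfl
    rw [addOrderOf_zero] at hz
    exact hp.one_lt.ne hz
  have hpz : (p : EisInt ⧸ P) * z = 0 := by
    rw [← nsmul_eq_mul, ← hz]; exact addOrderOf_nsmul_eq_zero z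
  have := (mul_eq_zero.1 hpz).resolve_right hz0
  rw [← Ideal.Quotient.eq_zero_iff_mem]
  simpa using this

lemma cubicSymbol_mul {α : EisInt} (hα : α ∈ family) (x y : EisInt) :
    cubicSymbol α (x * y) = cubicSymbol α x * cubicSymbol α y := by
  unfold cubicSymbol
  rw [← Multiset.prod_map_mul]
  congr 1
  refine Multiset.map_congr rfl fun P hP => ?_
  obtain ⟨h1, h2, h3, -⟩ := factor_spec hα hP
  exact primeSymbol_mul h2 h3 x y

lemma cubicSymbol_one {α : EisInt} (hα : α ∈ family) : cubicSymbol α 1 = 1 := by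
  unfold cubicSymbol
  refine Multiset.prod_eq_one fun z hz => ?_
  obtain ⟨P, hP, rfl⟩ := Multiset.mem_map.1 hz
  have := (factor_spec hα hP).1
  exact primeSymbol_one

lemma cubicSymbol_congr {α : EisInt} (hα : α ∈ family) {m n : ℕ} (h : m ≡ n [MOD nrm α]) :
    cubicSymbol α m = cubicSymbol α n := by
  unfold cubicSymbol
  congr 1
  refine Multiset.map_congr rfl fun P hP => primeSymbol_congr ?_
  obtain ⟨c, hc⟩ := (Nat.modEq_iff_dvd.1 h.symm)
  have hc' : (m : EisInt) - n = (nrm α : EisInt) * (c : EisInt) := by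
    exact_mod_cast congrArg (fun z : ℤ => (z : EisInt)) hc
  rw [hc']
  exact P.mul_mem_right _ (nrm_mem (factor_spec hα hP).2.2.2)

lemma cubicSymbol_eq_zero {α : EisInt} (hα : α ∈ family) {n : ℕ} (h : ¬ n.Coprime (nrm α)) :
    cubicSymbol α n = 0 := by
  classical
  obtain ⟨p, hp, hpn, hpα⟩ := Nat.Prime.not_coprime_iff_dvd.1 h
  have h0 : Ideal.span {α} ≠ ⊥ := by simpa using family_ne_zero hα
  have hprod : nrm α = ((UniqueFactorizationMonoid.normalizedFactors (Ideal.span {α})).map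
      Ideal.absNorm).prod := by
    rw [← map_multiset_prod, Ideal.prod_normalizedFactors_eq_self h0, Ideal.absNorm_span_singleton,
      nrm]
  rw [hprod] at hpα
  obtain ⟨P, hP, hpa⟩ := hp.prime.exists_mem_multiset_map_dvd hpα
  obtain ⟨h1, h2, -, -⟩ := factor_spec hα hP
  have hmem : (n : EisInt) ∈ P := by
    obtain ⟨c, rfl⟩ := hpn
    rw [Nat.cast_mul]
    exact P.mul_mem_right _ (prime_mem_of_dvd_absNorm h2 hp hpa)
  unfold cubicSymbol
  refine Multiset.prod_eq_zero (Multiset.mem_map.2 ⟨P, hP, ?_⟩)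
  simp [primeSymbol, hmem]

instance instNeZeroNrm (α : family) : NeZero (nrm α.1) :=
  ⟨(lt_trans Nat.zero_lt_one α.2.2.2.2).ne'⟩

/-- The primitive cubic Dirichlet character `χ_α : n ↦ (n / α)₃` of conductor `q = N(α)`. -/
def cubicChar (α : family) : DirichletCharacter ℂ (nrm α.1) where
  toFun n := cubicSymbol α.1 (n.val : EisInt)
  map_one' := by
    rw [← cubicSymbol_one α.2, ← Nat.cast_one (R := EisInt)]
    apply cubicSymbol_congr α.2
    rw [← ZMod.natCast_eq_natCast_iff]
    simp
  map_mul' a b := by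
    rw [← cubicSymbol_mul α.2, ← Nat.cast_mul]
    apply cubicSymbol_congr α.2
    rw [← ZMod.natCast_eq_natCast_iff]
    simp
  map_nonunit' a ha := by
    apply cubicSymbol_eq_zero α.2
    intro h
    apply ha
    have := (ZMod.isUnit_iff_coprime a.val (nrm α.1)).2 h
    simpa using this

/-- `χ_α(n) = (n / α)₃` for every natural number `n`. -/
lemma cubicChar_natCast (α : family) (n : ℕ) :
    cubicChar α (n : ZMod (nrm α.1)) = cubicSymbol α.1 (n : EisInt) := by
  change cubicSymbol α.1 (((n : ZMod (nrm α.1)).val : ℕ) : EisInt) = _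
  apply cubicSymbol_congr α.2
  rw [← ZMod.natCast_eq_natCast_iff]
  simp

/-! ### The one-level density -/

/-- The total weight `W*(X)`. -/
def totalWeight (w : 𝓢(ℝ, ℝ)) (X : ℝ) : ℝ :=
  ∑' α : family, w ((nrm α.1 : ℝ) / X)

/-- `L = log (X / (2 π e))`. -/
def scaleL (X : ℝ) : ℝ := Real.log (X / (2 * Real.pi * Real.exp 1))

/-- The entire extension `z ↦ ∫ φ̂(x) e^{2πixz} dx` of a Schwartz function `φ` whose Fourier
transform `φ̂(x) = ∫ φ(τ) e^{-2πixτ} dτ` has compact support; it equals `φ` on the real line. -/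
def entireExt (φ : 𝓢(ℝ, ℂ)) (z : ℂ) : ℂ :=
  ∫ x : ℝ, 𝓕 (φ : ℝ → ℂ) x * Complex.exp (2 * Real.pi * Complex.I * x * z)

/-- The zeros of `L(χ_α, s)` in the open critical strip, as a set. -/
def nontrivialZeros (α : family) : Set ℂ :=
  {ρ | 0 < ρ.re ∧ ρ.re < 1 ∧ (cubicChar α).LFunction ρ = 0}

/-- `D_X(χ_α; φ) = ∑_γ φ(γ L / 2π)` with `γ = -i (ρ - 1/2)`, where `ρ` runs over the nontrivial
zeros of `L(χ_α, s)`, counted with multiplicity. -/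
def zeroSum (φ : 𝓢(ℝ, ℂ)) (X : ℝ) (α : family) : ℂ :=
  ∑' ρ : nontrivialZeros α, (analyticOrderNatAt (cubicChar α).LFunction ρ.1 : ℂ) *
    entireExt φ (-Complex.I * (ρ.1 - 1 / 2) * (scaleL X / (2 * Real.pi)))

/-- The one-level density `𝒟*(φ; X)` of the family. -/
def oneLevelDensity (w : 𝓢(ℝ, ℝ)) (φ : 𝓢(ℝ, ℂ)) (X : ℝ) : ℂ :=
  (1 / (totalWeight w X : ℂ)) *
    ∑' α : family, (w ((nrm α.1 : ℝ) / X) : ℂ) * zeroSum φ X α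

/-! ### The Ratios Conjecture -/

/-- `a(p) = p / (p + 2)` if `p ≡ 1 mod 3`, and `a(p) = 1` otherwise. -/
def aCoeff (p : ℕ) : ℝ := if p % 3 = 1 then (p : ℝ) / (p + 2) else 1

/-- `R_w(ν'; ν) = ∑_α w(N(α) / X) L(χ_α, 1/2 + ν') / L(χ_α, 1/2 + ν)`. -/
def ratioSum (w : 𝓢(ℝ, ℝ)) (X : ℝ) (ν' ν : ℂ) : ℂ :=
  ∑' α : family, (w ((nrm α.1 : ℝ) / X) : ℂ) *
    ((cubicChar α).LFunction (1 / 2 + ν') / (cubicChar α).LFunction (1 / 2 + ν))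

/-- The arithmetic factor `A(ν'; ν)`; the Euler product converges absolutely for `Re ν' > 0` and
`Re ν > 0`. -/
def eulerA (ν' ν : ℂ) : ℂ :=
  riemannZeta (3 / 2 + 2 * ν' + ν) / riemannZeta (3 / 2 + 3 * ν') *
    ∏' p : Nat.Primes, (1 + (aCoeff p : ℂ) *
      ((1 - ((p : ℕ) : ℂ) ^ (ν' - ν)) / (((p : ℕ) : ℂ) ^ (3 / 2 + 3 * ν') - 1)))

/-- The Ratios Conjecture for cubic Dirichlet `L`-functions, with weight `w`: for each fixed
`δ, ε > 0`, and uniformly for `Re ν', Re ν ≥ δ` and `|Im ν'|, |Im ν| ≤ X ^ (1 - ε)`, the quotients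
in `R_w(ν'; ν)` are defined and
`R_w(ν'; ν) = W*(X) ζ(3/2 + 3ν') / ζ(3/2 + 2ν' + ν) A(ν'; ν) + O(X ^ (1/2 + ε))`. -/
def RatiosConjecture (w : 𝓢(ℝ, ℝ)) : Prop :=
  ∀ δ : ℝ, 0 < δ → ∀ ε : ℝ, 0 < ε → ∃ C : ℝ, ∀ᶠ X : ℝ in Filter.atTop, ∀ ν' ν : ℂ,
    δ ≤ ν'.re → δ ≤ ν.re → |ν'.im| ≤ X ^ (1 - ε) → |ν.im| ≤ X ^ (1 - ε) →
      (∀ α : family, w ((nrm α.1 : ℝ) / X) ≠ 0 → (cubicChar α).LFunction (1 / 2 + ν) ≠ 0) ∧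
      ‖ratioSum w X ν' ν - (totalWeight w X : ℂ) *
          (riemannZeta (3 / 2 + 3 * ν') / riemannZeta (3 / 2 + 2 * ν' + ν) * eulerA ν' ν)‖
        ≤ C * X ^ (1 / 2 + ε)

/-! ### The predicted main term -/

/-- The main term of the prediction for `𝒟*(φ; X)`. -/
def mainTerm (w : 𝓢(ℝ, ℝ)) (φ : 𝓢(ℝ, ℂ)) (X : ℝ) : ℂ :=
  𝓕 (φ : ℝ → ℂ) 0 / ((scaleL X : ℂ) * (totalWeight w X : ℂ)) *
      ((∑' α : family, w ((nrm α.1 : ℝ) / X) * Real.log (nrm α.1) : ℝ) : ℂ)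
    - 𝓕 (φ : ℝ → ℂ) 0 * (Real.log Real.pi : ℂ) / (scaleL X : ℂ)
    - 2 / (scaleL X : ℂ) * (∫ τ : ℝ, φ τ * ∑' (ℓ : ℕ+) (p : Nat.Primes),
        ((aCoeff p * Real.log p : ℝ) : ℂ) /
          ((p : ℕ) : ℂ) ^ (3 * ((ℓ : ℕ) : ℂ) / 2
            + 6 * Real.pi * Complex.I * τ * ((ℓ : ℕ) : ℂ) / (scaleL X : ℂ)))
    + 1 / (2 * (scaleL X : ℂ)) * (∫ τ : ℝ, φ τ *
        (Complex.digamma (1 / 4 - Real.pi * Complex.I * τ / (scaleL X : ℂ))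
          + Complex.digamma (1 / 4 + Real.pi * Complex.I * τ / (scaleL X : ℂ))))

end

end CubicRatios

/-!
The explicit formula expresses the sum of `φ (γ L / 2π)` over the zeros of `L(s, χ_α)` through the
conductor, a digamma integral on the central line, and the integrals of `L'/L(s, χ_α)` and
`L'/L(s, χ_α⁻¹)` against `φ` on the line `Re s = 3/2` (`hasSum_explicit_formula`, `zeroSum_eq`). The
first two contributions are those in the main term, so the theorem is a statement about the average
over the family of the third, the prime side. No symmetry of the family is used, because
`L(s, χ⁻¹)` is the conjugate of `L(s̄, χ)`: the two integrals are treated alike.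

Write `s = 1/2 + r`. The Ratios Conjecture, differentiated in `ν'` at `ν' = ν = r` by Cauchy's
estimate on a small circle, says that the weighted sum of `L'/L(1/2 + r, χ_α)` is
`W*(X) · primeSum r + O(X ^ (1/2 + ε))` for `Re r ≥ 2δ` and `|Im r| ≤ X ^ (1 - 2ε)`
(`RatiosConjecture.logDerivSum_approx`). Here `primeSum r = -∑ a(p) log p / (p ^ (3/2 + 3r) - 1)` is the
derivative of the Euler product on the diagonal, where all factors equal `1` (`eulerProd_deriv`), and
it is holomorphic slightly to the left of `Re r = 0`. The difference of the two sides, integrated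
against the test function, starts on the line `Re r = 1`. Since `φ̂` has compact support, the test
function is entire of exponential type, hence of size `X ^ (σ Re r)`, and decays faster than any power
of `Im r`. So the part of the line up to height almost `X` can be moved to `Re r = 3δ`, where the
conjecture gives `O(X ^ (1/2 + ε))`, while the horizontal segments and the tails are negligible
(`exists_primeSide_approx`). The predicted term is moved all the way to `Re r = 0`, where expanding a
geometric series turns it into the double sum of the main term (`integral_primeSum_eq`). Dividing by
`W*(X)`, which is at least a constant times `X` (`exists_mul_le_totalWeight`), gives
`O(X ^ (-1/2 + ε))`.

Four ingredients are needed besides.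

* The sum over zeros converges absolutely and is a limit of contour integrals
  (`StripFunction.hasSum_zeros`). This follows from a Jensen-type bound for the number of zeros in a
  disc and the resulting approximation to the logarithmic derivative (`local_zeros`), once the
  completed `L`-function is known to be bounded in vertical strips.
* `χ_α` is even, primitive and nontrivial (`cubicChar_isPrimitive`), because `α` is a product of
  distinct primes of degree one lying over distinct rational primes.
* A positive proportion of a thin annulus of Eisenstein integers lies in the family
  (`exists_card_family_ge`). In the class of `1` modulo `3 · P!` no small `π²` or rational prime can
  divide, and large ones divide too rarely.
* The conjecture concerns sums over an infinite family, and differentiating them termwise requires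
  bounds for `1/L` and `L'/L` that are polynomial in the conductor. These come from the nonvanishing in
  the conjecture, by Borel–Carathéodory (`exists_inv_logDeriv_bound`).
-/


namespace CubicRatios

/-! ### Contour integrals over rectangles -/

section

open Complex Set Filter Topology MeasureTheory Metric

/-- The integral of `f` over the positively oriented boundary of `[a, b] × [c, d]`. -/
noncomputable def rectIntegral (f : ℂ → ℂ) (a b c d : ℝ) : ℂ :=
  (∫ x : ℝ in a..b, f (x + c * I)) - (∫ x : ℝ in a..b, f (x + d * I)) +
    I * (∫ y : ℝ in c..d, f (b + y * I)) - I * (∫ y : ℝ in c..d, f (a + y * I))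

lemma rectIntegral_eq_zero {f : ℂ → ℂ} {a b c d : ℝ} (hab : a ≤ b) (hcd : c ≤ d)
    (hf : DifferentiableOn ℂ f (Icc a b ×ℂ Icc c d)) : rectIntegral f a b c d = 0 := by
  have h := Complex.integral_boundary_rect_eq_zero_of_differentiableOn f (a + c * I) (b + d * I)
    (by simpa [uIcc_of_le hab, uIcc_of_le hcd] using hf)
  simpa [rectIntegral, smul_eq_mul] using h

lemma log_I_mul_of_re_pos {z : ℂ} (hz : 0 < z.re) : log (I * z) = log z + Real.pi / 2 * I := by
  have hz0 : z ≠ 0 := fun h => by simp [h] at hz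
  have h := abs_lt.1 (Complex.abs_arg_lt_pi_div_two_iff.2 (Or.inl hz))
  have := Real.pi_pos
  rw [Complex.log_mul_eq_add_log_iff I_ne_zero hz0 |>.2, Complex.log_I, add_comm]
  rw [Complex.arg_I]
  constructor <;> linarith [h.1, h.2]

/-- The integral of `1 / z` along a segment whose rotation by `u` lies in the right half-plane, so that
`z ↦ log (u z)` is a primitive near the segment. -/
lemma integral_inv_eq_log_sub_log {u a b : ℂ} {s t : ℝ} (hu : u ≠ 0)
    (h : ∀ x ∈ uIcc s t, 0 < (u * (a + x * b)).re) :
    b * ∫ x : ℝ in s..t, (a + x * b)⁻¹ = log (u * (a + t * b)) - log (u * (a + s * b)) := by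
  rw [← intervalIntegral.integral_const_mul]
  have hne : ∀ x ∈ uIcc s t, a + (x : ℂ) * b ≠ 0 := by
    intro x hx h0
    have := h x hx
    simp [h0] at this
  apply intervalIntegral.integral_eq_sub_of_hasDerivAt (f := fun x : ℝ => log (u * (a + x * b)))
  · intro x hx
    have h1 : HasDerivAt (fun x : ℝ => u * (a + x * b)) (u * (1 * b)) x :=
      (((Complex.ofRealCLM.hasDerivAt (x := x)).mul_const b).const_add a).const_mul u
    have h2 := h1.clog_real (Or.inl (h x hx))
    have e : b * (a + x * b)⁻¹ = u * (1 * b) / (u * (a + x * b)) := by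
      rw [mul_div_mul_left _ _ hu, one_mul, div_eq_mul_inv]
    rw [e]
    exact h2
  · apply ContinuousOn.intervalIntegrable
    apply ContinuousOn.mul continuousOn_const
    apply ContinuousOn.inv₀ (by fun_prop) hne

lemma rectIntegral_inv {w : ℂ} {a b c d : ℝ} (ha : a < w.re) (hb : w.re < b) (hc : c < w.im)
    (hd : w.im < d) : rectIntegral (fun z => (z - w)⁻¹) a b c d = 2 * Real.pi * I := by
  have hab := ha.trans hb
  have hcd := hc.trans hd
  -- each side is integrated with the branch of the logarithm that is holomorphic near it
  have h1 := integral_inv_eq_log_sub_log (u := I) (a := c * I - w) (b := 1) (s := a)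
    (t := b) I_ne_zero (by intro x _; simp; linarith)
  have h2 := integral_inv_eq_log_sub_log (u := -I) (a := d * I - w) (b := 1) (s := a)
    (t := b) (by simp) (by intro x _; simp; linarith)
  have h3 := integral_inv_eq_log_sub_log (u := 1) (a := b - w) (b := I) (s := c)
    (t := d) (by simp) (by intro x _; simp; linarith)
  have h4 := integral_inv_eq_log_sub_log (u := -1) (a := a - w) (b := I) (s := c)
    (t := d) (by simp) (by intro x _; simp; linarith)
  have e1 : ∀ (y : ℝ), (fun x : ℝ => ((x : ℂ) + y * I - w)⁻¹) = fun x : ℝ =>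
      ((y * I - w) + x * 1)⁻¹ := fun y => by funext x; congr 1; ring
  have e2 : ∀ (x : ℝ), (fun y : ℝ => ((x : ℂ) + y * I - w)⁻¹) = fun y : ℝ =>
      ((x - w) + y * I)⁻¹ := fun y => by funext x; congr 1; ring
  unfold rectIntegral
  simp only [e1, e2]
  rw [one_mul] at h1 h2
  rw [h1, h2, h3, h4]
  have g1 := log_I_mul_of_re_pos (z := 1 * (b - w + c * I)) (by simp; linarith)
  have g2 := log_I_mul_of_re_pos (z := -I * (d * I - w + b * 1)) (by simp; linarith)
  have g3 := log_I_mul_of_re_pos (z := -1 * (a - w + d * I)) (by simp; linarith)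
  have g4 := log_I_mul_of_re_pos (z := I * (c * I - w + a * 1)) (by simp; linarith)
  have k1 : I * (1 * (b - w + c * I)) = I * (c * I - w + b * 1) := by ring
  have k2 : I * (-I * (d * I - w + b * 1)) = 1 * (b - w + d * I) := by
    linear_combination (-(d * I - w + b * 1)) * I_sq
  have k3 : I * (-1 * (a - w + d * I)) = -I * (d * I - w + a * 1) := by ring
  have k4 : I * (I * (c * I - w + a * 1)) = -1 * (a - w + c * I) := by
    linear_combination ((c * I - w + a * 1)) * I_sq
  rw [k1] at g1; rw [k2] at g2; rw [k3] at g3; rw [k4] at g4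
  rw [g1, g2, g3, g4]; ring

/-- `f` is continuous on the boundary of the rectangle. -/
def ContBoundary (f : ℂ → ℂ) (a b c d : ℝ) : Prop :=
  ContinuousOn f ((Icc a b ×ℂ {c}) ∪ (Icc a b ×ℂ {d}) ∪ ({a} ×ℂ Icc c d) ∪ ({b} ×ℂ Icc c d))

lemma ContBoundary.intervalIntegrable {f : ℂ → ℂ} {a b c d : ℝ} (hab : a ≤ b) (hcd : c ≤ d)
    (hf : ContBoundary f a b c d) :
    IntervalIntegrable (fun x : ℝ => f (x + c * I)) volume a b ∧
    IntervalIntegrable (fun x : ℝ => f (x + d * I)) volume a b ∧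
    IntervalIntegrable (fun y : ℝ => f (a + y * I)) volume c d ∧
    IntervalIntegrable (fun y : ℝ => f (b + y * I)) volume c d := by
  refine ⟨?_, ?_, ?_, ?_⟩ <;>
  · apply ContinuousOn.intervalIntegrable
    refine ContinuousOn.comp hf (by fun_prop) ?_
    intro x hx
    rw [uIcc_of_le (by assumption)] at hx
    simp [mem_reProdIm, hx.1, hx.2]

lemma rectIntegral_add {f g : ℂ → ℂ} {a b c d : ℝ} (hab : a ≤ b) (hcd : c ≤ d)
    (hf : ContBoundary f a b c d) (hg : ContBoundary g a b c d) :
    rectIntegral (fun z => f z + g z) a b c d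
      = rectIntegral f a b c d + rectIntegral g a b c d := by
  obtain ⟨f1, f2, f3, f4⟩ := hf.intervalIntegrable hab hcd
  obtain ⟨g1, g2, g3, g4⟩ := hg.intervalIntegrable hab hcd
  unfold rectIntegral
  rw [intervalIntegral.integral_add f1 g1, intervalIntegral.integral_add f2 g2,
    intervalIntegral.integral_add f3 g3, intervalIntegral.integral_add f4 g4]
  ring

lemma rectIntegral_const_mul {f : ℂ → ℂ} (k : ℂ) {a b c d : ℝ} :
    rectIntegral (fun z => k * f z) a b c d = k * rectIntegral f a b c d := by
  unfold rectIntegral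
  simp only [intervalIntegral.integral_const_mul]
  ring

lemma rectIntegral_congr {f g : ℂ → ℂ} {a b c d : ℝ} (hab : a ≤ b) (hcd : c ≤ d)
    (h : EqOn f g ((Icc a b ×ℂ {c}) ∪ (Icc a b ×ℂ {d}) ∪ ({a} ×ℂ Icc c d) ∪ ({b} ×ℂ Icc c d))) :
    rectIntegral f a b c d = rectIntegral g a b c d := by
  unfold rectIntegral
  congr 1; congr 1; congr 1
  · apply intervalIntegral.integral_congr
    intro x hx; rw [uIcc_of_le hab] at hx; apply h; simp [mem_reProdIm, hx.1, hx.2]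
  · apply intervalIntegral.integral_congr
    intro x hx; rw [uIcc_of_le hab] at hx; apply h; simp [mem_reProdIm, hx.1, hx.2]
  · congr 1; apply intervalIntegral.integral_congr
    intro x hx; rw [uIcc_of_le hcd] at hx; apply h; simp [mem_reProdIm, hx.1, hx.2]
  · congr 1; apply intervalIntegral.integral_congr
    intro x hx; rw [uIcc_of_le hcd] at hx; apply h; simp [mem_reProdIm, hx.1, hx.2]

/-- Cauchy's integral formula for the boundary of a rectangle. -/
lemma rectIntegral_div_sub {h : ℂ → ℂ} (hh : Differentiable ℂ h) {w : ℂ} {a b c d : ℝ}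
    (ha : a < w.re) (hb : w.re < b) (hc : c < w.im) (hd : w.im < d) :
    rectIntegral (fun z => h z / (z - w)) a b c d = 2 * Real.pi * I * h w := by
  have hab := (ha.trans hb).le
  have hcd := (hc.trans hd).le
  have hne : ∀ z ∈ ((Icc a b ×ℂ {c}) ∪ (Icc a b ×ℂ {d}) ∪ ({a} ×ℂ Icc c d) ∪ ({b} ×ℂ Icc c d)),
      z - w ≠ 0 := by
    rintro z hz h0
    rw [sub_eq_zero] at h0
    subst h0
    simp only [mem_union, mem_reProdIm, mem_singleton_iff] at hz
    rcases hz with ((hz | hz) | hz) | hz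
    · linarith [hz.2]
    · linarith [hz.2]
    · linarith [hz.1]
    · linarith [hz.1]
  have h1 : rectIntegral (fun z => h z / (z - w)) a b c d
      = rectIntegral (fun z => dslope h w z + h w * (z - w)⁻¹) a b c d := by
    apply rectIntegral_congr hab hcd
    intro z hz
    have := hne z hz
    simp only
    rw [dslope_of_ne _ (sub_ne_zero.1 this), slope_def_field]
    field_simp; ring
  have hds : Differentiable ℂ (dslope h w) := by
    rw [← differentiableOn_univ] at hh ⊢
    exact (Complex.differentiableOn_dslope univ_mem).2 hh
  have hc2 : ContBoundary (fun z => h w * (z - w)⁻¹) a b c d :=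
    continuousOn_const.mul ((continuousOn_id.sub continuousOn_const).inv₀ hne)
  rw [h1, rectIntegral_add hab hcd hds.continuous.continuousOn hc2,
    rectIntegral_const_mul, rectIntegral_inv ha hb hc hd,
    rectIntegral_eq_zero hab hcd hds.differentiableOn]
  ring

end

/-! ### Local analysis of the zeros of an entire function -/

section

open Complex Set Filter Topology MeasureTheory Metric

lemma finite_zeros_inter {F : ℂ → ℂ} (hF : Differentiable ℂ F) {s₀ : ℂ} (h0 : F s₀ ≠ 0)
    {K : Set ℂ} (hK : IsCompact K) : (K ∩ {s | F s = 0}).Finite := by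
  have h1 : AnalyticOnNhd ℂ F univ := fun z _ => hF.analyticAt z
  have h2 : (F ⁻¹' {0})ᶜ ∈ codiscrete ℂ := h1.preimage_zero_mem_codiscrete h0
  have h3 := mem_codiscrete'.mp h2
  have hcl : IsClosed (F ⁻¹' {0}) := by simpa using h3.1
  have hd : IsDiscrete (F ⁻¹' {0}) := by simpa using h3.2
  exact (hK.inter_right hcl).finite (hd.mono inter_subset_right)

lemma analyticOrderAt_ne_top_of_entire {F : ℂ → ℂ} (hF : Differentiable ℂ F) {s₀ : ℂ}
    (h0 : F s₀ ≠ 0) (z : ℂ) : analyticOrderAt F z ≠ ⊤ := by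
  have h1 : AnalyticOnNhd ℂ F univ := fun z _ => hF.analyticAt z
  refine h1.analyticOrderAt_ne_top_of_isPreconnected isPreconnected_univ (mem_univ s₀)
    (mem_univ z) ?_
  rw [(hF.analyticAt s₀).analyticOrderAt_eq_zero.2 h0]
  simp

/-- The zero of an entire function at a single point can be divided out. -/
lemma exists_entire_mul_pow {F : ℂ → ℂ} (hF : Differentiable ℂ F) {a : ℂ}
    (ha : analyticOrderAt F a ≠ ⊤) : ∃ G : ℂ → ℂ, Differentiable ℂ G ∧ G a ≠ 0 ∧
      ∀ z, F z = (z - a) ^ analyticOrderNatAt F a * G z := by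
  obtain ⟨g, hg, hg0, hge⟩ := ((hF.analyticAt a).analyticOrderNatAt_eq_iff ha
    (n := analyticOrderNatAt F a)).1 rfl
  set n := analyticOrderNatAt F a
  classical
  let H : ℂ → ℂ := fun z => if z = a then g a else F z / (z - a) ^ n
  have hHa : H =ᶠ[𝓝 a] g := by
    filter_upwards [hge] with z hz
    by_cases h : z = a
    · simp [H, h]
    · have : (z - a) ^ n ≠ 0 := pow_ne_zero _ (sub_ne_zero.2 h)
      simp only [H, h, if_false, hz, smul_eq_mul]
      field_simp
  refine ⟨H, fun z => ?_, by simpa [H] using hg0, fun z => ?_⟩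
  · by_cases h : z = a
    · subst h
      exact (hHa.differentiableAt_iff).2 hg.differentiableAt
    · have : H =ᶠ[𝓝 z] fun z => F z / (z - a) ^ n := by
        filter_upwards [isOpen_ne.mem_nhds h] with y hy
        simp only [H, if_neg hy]
      refine (this.differentiableAt_iff).2 (hF.differentiableAt.div (by fun_prop) ?_)
      exact pow_ne_zero _ (sub_ne_zero.2 h)
  · by_cases h : z = a
    · subst h
      have := hge.self_of_nhds
      simpa [H] using this
    · have : (z - a) ^ n ≠ 0 := pow_ne_zero _ (sub_ne_zero.2 h)
      simp only [H, if_neg h]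
      field_simp

/-- A finite set of zeros of an entire function can be divided out. -/
lemma exists_entire_mul_prod {F : ℂ → ℂ} (hF : Differentiable ℂ F) {s₀ : ℂ} (h0 : F s₀ ≠ 0)
    (S : Finset ℂ) : ∃ G : ℂ → ℂ, Differentiable ℂ G ∧ (∀ ρ ∈ S, G ρ ≠ 0) ∧
      ∀ z, F z = (∏ ρ ∈ S, (z - ρ) ^ analyticOrderNatAt F ρ) * G z := by
  classical
  induction S using Finset.induction_on with
  | empty => exact ⟨F, hF, by simp, by simp⟩
  | insert a S ha ih =>
    obtain ⟨G, hG, hGS, hFG⟩ := ih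
    have hPa : (∏ ρ ∈ S, (a - ρ) ^ analyticOrderNatAt F ρ) ≠ 0 :=
      Finset.prod_ne_zero_iff.2 fun ρ hρ => pow_ne_zero _ (sub_ne_zero.2 fun h => ha (h ▸ hρ))
    have hP : Differentiable ℂ fun z => ∏ ρ ∈ S, (z - ρ) ^ analyticOrderNatAt F ρ := by fun_prop
    have hord : analyticOrderAt F a = analyticOrderAt G a := by
      have : F = (fun z => ∏ ρ ∈ S, (z - ρ) ^ analyticOrderNatAt F ρ) * G := funext hFG
      rw [this, analyticOrderAt_mul (hP.analyticAt a) (hG.analyticAt a),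
        (hP.analyticAt a).analyticOrderAt_eq_zero.2 hPa, zero_add]
    have hnat : analyticOrderNatAt F a = analyticOrderNatAt G a := by
      simp [analyticOrderNatAt, hord]
    obtain ⟨H, hH, hHa, hGH⟩ := exists_entire_mul_pow hG
      (hord ▸ analyticOrderAt_ne_top_of_entire hF h0 a)
    refine ⟨H, hH, ?_, fun z => ?_⟩
    · intro ρ hρ
      rcases Finset.mem_insert.1 hρ with rfl | hρ
      · exact hHa
      · intro h
        apply hGS ρ hρ
        rw [hGH, h, mul_zero]
    · rw [Finset.prod_insert ha, hFG z, hGH z, hnat]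
      ring

/-- A zero-free function on a disc has a holomorphic logarithm there, which the
Borel–Carathéodory inequality bounds in terms of an upper bound for the function alone. -/
lemma exists_log_of_ne_zero {G : ℂ → ℂ} {c : ℂ} {R B : ℝ} (hB : 0 < B) (hR : 0 < R)
    (hG : DifferentiableOn ℂ G (ball c R)) (h0 : ∀ z ∈ ball c R, G z ≠ 0)
    (hb : ∀ z ∈ ball c R, ‖G z‖ ≤ Real.exp B * ‖G c‖) :
    ∃ f : ℂ → ℂ, DifferentiableOn ℂ f (ball c R) ∧ (∀ z ∈ ball c R, G z = G c * exp (f z)) ∧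
      ∀ z ∈ ball c R, ‖f z‖ ≤ 2 * B * ‖z - c‖ / (R - ‖z - c‖) := by
  have hcm : c ∈ ball c R := mem_ball_self hR
  have hG' : DifferentiableOn ℂ (deriv G) (ball c R) := hG.deriv isOpen_ball
  obtain ⟨f, hfc, hf⟩ := ((hG'.div hG h0).isExactOn_ball).with_val_at c 0
  have hfd : DifferentiableOn ℂ f (ball c R) := fun z hz =>
    (hf z hz).differentiableAt.differentiableWithinAt
  have hexp : ∀ z ∈ ball c R, G z = G c * exp (f z) := by
    have hd : ∀ z ∈ ball c R, HasDerivAt (fun z => G z * exp (-f z)) 0 z := by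
      intro z hz
      have h1 := (hG.differentiableAt (isOpen_ball.mem_nhds hz)).hasDerivAt
      have h2 := (hf z hz).neg.cexp
      have e : deriv G z * exp (-f z) + G z * (exp (-f z) * -(deriv G / G) z) = 0 := by
        have := h0 z hz
        simp only [Pi.div_apply]
        field_simp
        ring
      rw [← e]
      exact h1.mul h2
    intro z hz
    have := (convex_ball c R).is_const_of_fderivWithin_eq_zero (𝕜 := ℂ)
      (f := fun z => G z * exp (-f z))
      (fun z hz => (hd z hz).differentiableAt.differentiableWithinAt) (fun w hw => by
        rw [fderivWithin_of_isOpen isOpen_ball hw]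
        have := (hd w hw).hasFDerivAt.fderiv
        rw [this]; ext; simp) hz hcm
    simp only [hfc, neg_zero, exp_zero, mul_one] at this
    rw [← this, mul_assoc, ← exp_add]; simp
  refine ⟨f, hfd, hexp, fun z hz => ?_⟩
  have hGc : 0 < ‖G c‖ := norm_pos_iff.2 (h0 c hcm)
  have hre : ∀ w ∈ ball c R, (f w).re ≤ B := by
    intro w hw
    have h1 := hb w hw
    rw [hexp w hw, norm_mul, norm_exp, mul_comm] at h1
    exact Real.exp_le_exp.1 (le_of_mul_le_mul_right h1 hGc)
  have hmaps : MapsTo (fun w => w + c) (ball 0 R) (ball c R) := by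
    intro w hw
    simpa using hw
  have := borelCaratheodory_zero (f := fun w => f (w + c)) (z := z - c) hB
    (hfd.comp (by fun_prop) hmaps) (fun w hw => hre _ (hmaps hw)) hR
    (by simpa [dist_eq_norm] using hz) (by simpa using hfc)
  simpa using this

/-- Cauchy's estimate for the logarithm of a zero-free function, on a disc of half the distance to the
boundary, bounds the logarithmic derivative by the growth of the function. -/
lemma norm_logDeriv_le_of_ne_zero {G : ℂ → ℂ} {c : ℂ} {R r B : ℝ} (hB : 0 < B) (hr : 0 ≤ r)
    (hrR : r < R) (hG : DifferentiableOn ℂ G (ball c R)) (h0 : ∀ z ∈ ball c R, G z ≠ 0)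
    (hb : ∀ z ∈ ball c R, ‖G z‖ ≤ Real.exp B * ‖G c‖) {z : ℂ} (hz : z ∈ closedBall c r) :
    ‖logDeriv G z‖ ≤ 8 * B * R / (R - r) ^ 2 := by
  have hR := hr.trans_lt hrR
  obtain ⟨f, hf, hexp, hfb⟩ := exists_log_of_ne_zero hB hR hG h0 hb
  have hzn : ‖z - c‖ ≤ r := by simpa [dist_eq_norm] using hz
  have hzR : z ∈ ball c R := by simpa [dist_eq_norm] using hzn.trans_lt hrR
  set δ := (R - r) / 2 with hδ
  have hδ0 : 0 < δ := by rw [hδ]; linarith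
  have hlog : logDeriv G z = deriv f z := by
    have hfz := (hf.differentiableAt (isOpen_ball.mem_nhds hzR))
    have h1 : G =ᶠ[𝓝 z] fun w => G c * exp (f w) := by
      filter_upwards [isOpen_ball.mem_nhds hzR] with w hw using hexp w hw
    have h2 := (hfz.hasDerivAt.cexp.const_mul (G c)).deriv
    have hGc := h0 c (mem_ball_self hR)
    rw [logDeriv_apply, h1.deriv_eq, h2, h1.self_of_nhds]
    have := exp_ne_zero (f z)
    field_simp
  have hsub : closedBall z δ ⊆ ball c R := by
    intro w hw
    have : ‖w - z‖ ≤ δ := by simpa [dist_eq_norm] using hw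
    have h2 : ‖w - c‖ ≤ ‖w - z‖ + ‖z - c‖ := by simpa using norm_add_le (w - z) (z - c)
    simp only [mem_ball, dist_eq_norm]
    rw [hδ] at this
    linarith
  rw [hlog]
  have hfb' : ∀ w ∈ sphere z δ, ‖f w‖ ≤ 2 * B * R / δ := by
    intro w hw
    have hw' := hfb w (hsub (sphere_subset_closedBall hw))
    refine hw'.trans ?_
    have h1 : ‖w - z‖ = δ := by simpa [dist_eq_norm] using hw
    have h2 : ‖w - c‖ ≤ ‖w - z‖ + ‖z - c‖ := by simpa using norm_add_le (w - z) (z - c)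
    have h3 : δ ≤ R - ‖w - c‖ := by rw [h1] at h2; rw [hδ] at h2 ⊢; linarith
    have h4 : ‖w - c‖ ≤ R := by linarith
    gcongr
  have := norm_deriv_le_of_forall_mem_sphere_norm_le hδ0 (f := f) (c := z) (R := δ)
    (C := 2 * B * R / δ) ⟨fun w hw => (hf w (hsub (ball_subset_closedBall hw))).mono
      (ball_subset_closedBall.trans hsub), by
        rw [closure_ball _ hδ0.ne']; exact hf.continuousOn.mono hsub⟩ hfb'
  refine this.trans (le_of_eq ?_)
  rw [hδ]
  have : R - r ≠ 0 := by linarith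
  field_simp
  ring

/-- The zeros of an entire function in a disc, and its logarithmic derivative in a smaller disc,
are controlled by its growth on a larger disc: Jensen's argument with the zeros divided out, then
Borel–Carathéodory for the zero-free cofactor. -/
lemma local_zeros {F : ℂ → ℂ} (hF : Differentiable ℂ F) {s₀ : ℂ} (h0 : F s₀ ≠ 0) {B : ℝ}
    (hB : 0 < B) (hb : ∀ s ∈ closedBall s₀ 12, ‖F s‖ ≤ Real.exp B * ‖F s₀‖) :
    ∃ S : Finset ℂ, (∀ ρ, ρ ∈ S ↔ F ρ = 0 ∧ ρ ∈ closedBall s₀ 4) ∧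
      (∑ ρ ∈ S, (analyticOrderNatAt F ρ : ℝ) ≤ 2 * B) ∧
      ∀ s ∈ closedBall s₀ 3, F s ≠ 0 →
        ‖logDeriv F s - ∑ ρ ∈ S, (analyticOrderNatAt F ρ : ℂ) / (s - ρ)‖ ≤ 32 * B := by
  classical
  have hfin := finite_zeros_inter hF h0 (isCompact_closedBall s₀ 4)
  refine ⟨hfin.toFinset, fun ρ => by simp [and_comm], ?_⟩
  set S := hfin.toFinset with hS
  have hSm : ∀ ρ ∈ S, ‖ρ - s₀‖ ≤ 4 := by
    intro ρ hρ
    have := (hfin.mem_toFinset.1 hρ).1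
    simpa [dist_eq_norm] using this
  obtain ⟨G, hG, hGS, hFG⟩ := exists_entire_mul_prod hF h0 S
  set m := analyticOrderNatAt F
  set M := ∑ ρ ∈ S, m ρ with hM
  have hFs0 : 0 < ‖F s₀‖ := norm_pos_iff.2 h0
  -- on the outer circle each linear factor is at least `8`, at the centre at most `4`
  have hout : ∀ s ∈ closedBall s₀ 12, ‖G s‖ ≤ Real.exp B * ‖F s₀‖ / 8 ^ M := by
    intro s hs
    have hbd : Bornology.IsBounded (ball s₀ 12) := isBounded_ball
    refine norm_le_of_forall_mem_frontier_norm_le hbd hG.diffContOnCl (z := s) ?_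
      (by rw [closure_ball _ (by norm_num)]; exact hs)
    intro z hz
    rw [frontier_ball _ (by norm_num), mem_sphere, dist_eq_norm] at hz
    rw [le_div_iff₀ (by positivity)]
    calc ‖G z‖ * 8 ^ M ≤ ‖G z‖ * ‖∏ ρ ∈ S, (z - ρ) ^ m ρ‖ := by
          gcongr
          rw [hM, ← Finset.prod_pow_eq_pow_sum, norm_prod]
          refine Finset.prod_le_prod (fun _ _ => by positivity) fun ρ hρ => ?_
          rw [norm_pow]
          gcongr
          have h1 := hSm ρ hρ
          have h2 : ‖z - s₀‖ ≤ ‖z - ρ‖ + ‖ρ - s₀‖ := by simpa using norm_add_le (z - ρ) (ρ - s₀)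
          linarith
      _ = ‖F z‖ := by rw [hFG z, norm_mul, mul_comm]
      _ ≤ _ := hb z (by simp [dist_eq_norm, hz])
  have hin : ‖F s₀‖ ≤ 4 ^ M * ‖G s₀‖ := by
    rw [hFG s₀, norm_mul]
    gcongr
    rw [hM, ← Finset.prod_pow_eq_pow_sum, norm_prod]
    refine Finset.prod_le_prod (fun _ _ => by positivity) fun ρ hρ => ?_
    rw [norm_pow, norm_sub_rev]
    gcongr
    exact hSm ρ hρ
  have h48 : (8 : ℝ) ^ M = 4 ^ M * 2 ^ M := by rw [← mul_pow]; norm_num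
  have hGs0 : 0 < ‖G s₀‖ := by
    by_contra h
    have : ‖G s₀‖ = 0 := le_antisymm (not_lt.1 h) (norm_nonneg _)
    rw [this, mul_zero] at hin
    linarith
  have h2M : (2 : ℝ) ^ M ≤ Real.exp B := by
    have h1 := hout s₀ (by simp)
    rw [le_div_iff₀ (by positivity), h48] at h1
    have h2 : ‖F s₀‖ * 2 ^ M ≤ Real.exp B * ‖F s₀‖ := by
      calc ‖F s₀‖ * 2 ^ M ≤ 4 ^ M * ‖G s₀‖ * 2 ^ M := by gcongr
        _ ≤ _ := by linarith
    rw [mul_comm] at h2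
    exact le_of_mul_le_mul_right h2 hFs0
  constructor
  · have h1 : (M : ℝ) * Real.log 2 ≤ B := by
      rw [← Real.log_pow, Real.log_le_iff_le_exp (by positivity)]
      exact h2M
    have h2 : (1 : ℝ) / 2 < Real.log 2 := by linarith [Real.log_two_gt_d9]
    have h3 : (M : ℝ) = ∑ ρ ∈ S, (m ρ : ℝ) := by rw [hM]; push_cast; rfl
    rw [← h3]
    nlinarith [(Nat.cast_nonneg M : (0 : ℝ) ≤ M)]
  · intro s hs hFs
    have hGne : ∀ z ∈ ball s₀ 4, G z ≠ 0 := by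
      intro z hz h
      have hzS : z ∈ S := hfin.mem_toFinset.2 ⟨ball_subset_closedBall hz, by
        change F z = 0
        rw [hFG z, h, mul_zero]⟩
      exact hGS z hzS h
    have hGb : ∀ z ∈ ball s₀ 4, ‖G z‖ ≤ Real.exp B * ‖G s₀‖ := by
      intro z hz
      have hz' : z ∈ closedBall s₀ 12 := by
        simp only [mem_ball, mem_closedBall] at hz ⊢; linarith
      refine (hout z hz').trans ?_
      rw [div_le_iff₀ (by positivity), h48, mul_assoc]
      have : (1 : ℝ) ≤ 2 ^ M := one_le_pow₀ (by norm_num)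
      have h3 : ‖F s₀‖ ≤ ‖G s₀‖ * (4 ^ M * 2 ^ M) := by
        calc ‖F s₀‖ ≤ 4 ^ M * ‖G s₀‖ * 1 := by linarith
          _ ≤ 4 ^ M * ‖G s₀‖ * 2 ^ M := by gcongr
          _ = _ := by ring
      gcongr
    have h1 := norm_logDeriv_le_of_ne_zero hB (by norm_num) (by norm_num : (3 : ℝ) < 4)
      hG.differentiableOn hGne hGb hs
    have h2 : logDeriv F s - ∑ ρ ∈ S, (m ρ : ℂ) / (s - ρ) = logDeriv G s := by
      have hFe : F = fun z => (∏ ρ ∈ S, (z - ρ) ^ m ρ) * G z := funext hFG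
      have hPs : (∏ ρ ∈ S, (s - ρ) ^ m ρ) ≠ 0 := by
        intro h; apply hFs; rw [hFG, h, zero_mul]
      have hGs : G s ≠ 0 := by
        intro h; apply hFs; rw [hFG, h, mul_zero]
      have hne := Finset.prod_ne_zero_iff.1 hPs
      have e1 : logDeriv F s = logDeriv (fun z => ∏ ρ ∈ S, (z - ρ) ^ m ρ) s + logDeriv G s := by
        conv_lhs => rw [hFe]
        exact logDeriv_mul s hPs hGs (by fun_prop) hG.differentiableAt
      rw [e1, logDeriv_prod hne (fun ρ _ => by fun_prop)]
      rw [add_sub_right_comm, ← Finset.sum_sub_distrib, Finset.sum_eq_zero, zero_add]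
      intro ρ _
      rw [logDeriv_fun_pow (by fun_prop)]
      simp [logDeriv_apply, div_eq_mul_inv]
    rw [h2]
    refine h1.trans (le_of_eq ?_)
    ring

end

/-! ### Moving vertical lines of integration -/

section

open Complex Set Filter Topology MeasureTheory Metric

lemma one_add_sq_le (y : ℝ) : 1 + y ^ 2 ≤ (1 + |y|) ^ 2 := by
  nlinarith [abs_nonneg y, sq_abs y]

lemma integrable_of_norm_le_div {f : ℝ → ℂ} (hf : AEStronglyMeasurable f volume) {K : ℝ}
    (hK : ∀ y, ‖f y‖ ≤ K / (1 + |y|) ^ 2) : Integrable f := by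
  refine Integrable.mono' (g := fun y => |K| * (1 + y ^ 2)⁻¹)
    (integrable_inv_one_add_sq.const_mul |K|) hf (Eventually.of_forall fun y => ?_)
  refine (hK y).trans ?_
  rw [div_eq_mul_inv]
  have h0 : (0 : ℝ) < 1 + y ^ 2 := by positivity
  gcongr
  · exact le_abs_self K
  · exact one_add_sq_le y

/-- If the integrand is small on horizontal segments of height tending to infinity, the rectangle
integrals converge to the difference of the integrals over the two vertical lines. -/
lemma tendsto_rectIntegral {f : ℂ → ℂ} {a b : ℝ}
    (ha : Integrable fun y : ℝ => f (a + y * I)) (hb : Integrable fun y : ℝ => f (b + y * I))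
    {u v : ℕ → ℝ} (hu : Tendsto u atTop atTop) (hv : Tendsto v atTop atBot) {e : ℕ → ℝ}
    (he : Tendsto e atTop (𝓝 0)) (hab : a ≤ b)
    (hu' : ∀ n, ∀ x ∈ Icc a b, ‖f (x + u n * I)‖ ≤ e n)
    (hv' : ∀ n, ∀ x ∈ Icc a b, ‖f (x + v n * I)‖ ≤ e n) :
    Tendsto (fun n => rectIntegral f a b (v n) (u n)) atTop
      (𝓝 (I * (∫ y : ℝ, f (b + y * I)) - I * ∫ y : ℝ, f (a + y * I))) := by
  have hz : ∀ w : ℕ → ℝ, (∀ n, ∀ x ∈ Icc a b, ‖f (x + w n * I)‖ ≤ e n) →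
      Tendsto (fun n => ∫ x : ℝ in a..b, f (x + w n * I)) atTop (𝓝 0) := by
    intro w hw
    have h2 : Tendsto (fun n => e n * |b - a|) atTop (𝓝 0) := by simpa using he.mul_const |b - a|
    refine squeeze_zero_norm (fun n => ?_) h2
    refine intervalIntegral.norm_integral_le_of_norm_le_const fun x hx => hw n x ?_
    rw [uIoc_of_le hab] at hx
    exact ⟨hx.1.le, hx.2⟩
  have h1 := intervalIntegral_tendsto_integral hb hv hu
  have h2 := intervalIntegral_tendsto_integral ha hv hu
  have := (((hz v hv').sub (hz u hu')).add (h1.const_mul I)).sub (h2.const_mul I)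
  simpa [rectIntegral] using this

lemma tendsto_const_div_one_add (K : ℝ) : Tendsto (fun n : ℕ => K / (1 + (n : ℝ))) atTop (𝓝 0) := by
  refine Tendsto.const_div_atTop (tendsto_atTop_add_const_left _ _ tendsto_natCast_atTop_atTop) K

/-- Moving a line of integration across a strip in which the integrand is holomorphic and decays. -/
lemma integral_vertical_eq {f : ℂ → ℂ} {a b K : ℝ} (hab : a ≤ b)
    (hf : DifferentiableOn ℂ f {s | a ≤ s.re ∧ s.re ≤ b})
    (hK : ∀ s : ℂ, a ≤ s.re → s.re ≤ b → ‖f s‖ ≤ K / (1 + |s.im|) ^ 2) :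
    ∫ y : ℝ, f (a + y * I) = ∫ y : ℝ, f (b + y * I) := by
  have hint : ∀ c ∈ Icc a b, Integrable fun y : ℝ => f (c + y * I) := by
    intro c hc
    refine integrable_of_norm_le_div (K := K) ?_ fun y => ?_
    · refine Continuous.aestronglyMeasurable ?_
      exact hf.continuousOn.comp_continuous (by fun_prop) fun y => by simpa using hc
    · simpa using hK (c + y * I) (by simpa using hc.1) (by simpa using hc.2)
  have hK0 : 0 ≤ K := by
    have := (norm_nonneg _).trans (hK a (by simp) (by simpa using hab))
    simpa using this
  have hb : ∀ (w : ℕ → ℝ), (∀ n : ℕ, (n : ℝ) ≤ |w n|) → ∀ n, ∀ x ∈ Icc a b,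
      ‖f (x + w n * I)‖ ≤ K / (1 + (n : ℝ)) := by
    intro w hw n x hx
    refine (hK (x + w n * I) (by simpa using hx.1) (by simpa using hx.2)).trans ?_
    have h1 : (1 : ℝ) + n ≤ 1 + |w n| := by linarith [hw n]
    have h2 : 1 + |w n| ≤ (1 + |w n|) ^ 2 := by nlinarith [abs_nonneg (w n)]
    simp only [add_im, ofReal_im, mul_im, ofReal_re, I_im, mul_one, I_re, mul_zero, add_zero,
      zero_add]
    gcongr
    linarith
  have h1 := tendsto_rectIntegral (hint a ⟨le_rfl, hab⟩) (hint b ⟨hab, le_rfl⟩)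
    (u := fun n : ℕ => (n : ℝ)) (v := fun n : ℕ => -(n : ℝ)) tendsto_natCast_atTop_atTop
    (tendsto_neg_atTop_atBot.comp tendsto_natCast_atTop_atTop) (tendsto_const_div_one_add K) hab
    (hb _ (fun n => by simp)) (by
      have := hb (fun n : ℕ => -(n : ℝ)) (fun n => by simp)
      simpa using this)
  have h2 : ∀ n : ℕ, rectIntegral f a b (-(n : ℝ)) n = 0 := fun n =>
    rectIntegral_eq_zero hab (by linarith [(Nat.cast_nonneg n : (0 : ℝ) ≤ n)])
      (hf.mono fun z hz => hz.1)
  simp only [h2] at h1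
  have h3 := tendsto_nhds_unique tendsto_const_nhds h1
  have h4 : I * ((∫ y : ℝ, f (b + y * I)) - ∫ y : ℝ, f (a + y * I)) = 0 := by
    rw [mul_sub]; exact h3.symm
  have h5 := (mul_eq_zero.1 h4).resolve_left I_ne_zero
  exact (sub_eq_zero.1 h5).symm

/-- The argument principle for a rectangle, with a holomorphic weight. -/
lemma rectIntegral_logDeriv_mul {F h : ℂ → ℂ} (hF : Differentiable ℂ F) (hh : Differentiable ℂ h)
    {a b c d : ℝ} (hab : a ≤ b) (hcd : c ≤ d)
    (h0 : ∀ z ∈ ((Icc a b ×ℂ {c}) ∪ (Icc a b ×ℂ {d}) ∪ ({a} ×ℂ Icc c d) ∪ ({b} ×ℂ Icc c d)),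
      F z ≠ 0) (S : Finset ℂ) (hS : ∀ ρ, ρ ∈ S ↔ F ρ = 0 ∧ ρ ∈ Icc a b ×ℂ Icc c d) :
    rectIntegral (fun z => logDeriv F z * h z) a b c d
      = 2 * Real.pi * I * ∑ ρ ∈ S, (analyticOrderNatAt F ρ : ℂ) * h ρ := by
  classical
  set m := analyticOrderNatAt F
  have hs0 : F (a + c * I) ≠ 0 := h0 _ (by simp [mem_reProdIm, hab])
  obtain ⟨G, hG, hGS, hFG⟩ := exists_entire_mul_prod hF hs0 S
  have hGne : ∀ z ∈ Icc a b ×ℂ Icc c d, G z ≠ 0 := by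
    intro z hz h
    exact hGS z ((hS z).2 ⟨by rw [hFG, h, mul_zero], hz⟩) h
  have hSint : ∀ ρ ∈ S, a < ρ.re ∧ ρ.re < b ∧ c < ρ.im ∧ ρ.im < d := by
    intro ρ hρ
    obtain ⟨h1, ⟨h2, h3⟩, h4, h5⟩ := (hS ρ).1 hρ
    refine ⟨lt_of_le_of_ne h2 ?_, lt_of_le_of_ne h3 ?_, lt_of_le_of_ne h4 ?_,
      lt_of_le_of_ne h5 ?_⟩ <;> intro h <;> apply h0 ρ ?_ h1
    · exact Or.inl (Or.inr ⟨h.symm, h4, h5⟩)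
    · exact Or.inr ⟨h, h4, h5⟩
    · exact Or.inl (Or.inl (Or.inl ⟨⟨h2, h3⟩, h.symm⟩))
    · exact Or.inl (Or.inl (Or.inr ⟨⟨h2, h3⟩, h⟩))
  have hsubr : ((Icc a b ×ℂ {c}) ∪ (Icc a b ×ℂ {d}) ∪ ({a} ×ℂ Icc c d) ∪ ({b} ×ℂ Icc c d))
      ⊆ Icc a b ×ℂ Icc c d := by
    rintro z (((⟨h1, h2⟩ | ⟨h1, h2⟩) | ⟨h1, h2⟩) | ⟨h1, h2⟩)
    · exact ⟨h1, by rw [mem_preimage, h2]; exact ⟨le_rfl, hcd⟩⟩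
    · exact ⟨h1, by rw [mem_preimage, h2]; exact ⟨hcd, le_rfl⟩⟩
    · exact ⟨by rw [mem_preimage, h1]; exact ⟨le_rfl, hab⟩, h2⟩
    · exact ⟨by rw [mem_preimage, h1]; exact ⟨hab, le_rfl⟩, h2⟩
  have hdG : DifferentiableOn ℂ (fun z => logDeriv G z * h z) (Icc a b ×ℂ Icc c d) := by
    intro z hz
    have h1 : DifferentiableAt ℂ (deriv G) z := hG.deriv z
    exact ((h1.div (hG z) (hGne z hz)).mul (hh z)).differentiableWithinAt
  have hcont : ∀ ρ ∈ S, ContinuousOn (fun z => h z / (z - ρ))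
      ((Icc a b ×ℂ {c}) ∪ (Icc a b ×ℂ {d}) ∪ ({a} ×ℂ Icc c d) ∪ ({b} ×ℂ Icc c d)) := by
    intro ρ hρ
    refine hh.continuous.continuousOn.div (by fun_prop) fun z hz h => ?_
    rw [sub_eq_zero] at h
    subst h
    exact h0 z hz ((hS z).1 hρ).1
  have hsum : ∀ R : Finset ℂ, R ⊆ S →
      ContBoundary (fun z => ∑ ρ ∈ R, (m ρ : ℂ) * (h z / (z - ρ))) a b c d ∧
      rectIntegral (fun z => ∑ ρ ∈ R, (m ρ : ℂ) * (h z / (z - ρ))) a b c d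
        = 2 * Real.pi * I * ∑ ρ ∈ R, (m ρ : ℂ) * h ρ := by
    intro R
    induction R using Finset.induction_on with
    | empty => exact fun _ => ⟨by simpa [ContBoundary] using continuousOn_const, by
        simp [rectIntegral]⟩
    | insert ρ R hρ ih =>
      intro hR
      obtain ⟨ih1, ih2⟩ := ih ((Finset.subset_insert _ _).trans hR)
      have hρS := hR (Finset.mem_insert_self ρ R)
      have hc : ContBoundary (fun z => (m ρ : ℂ) * (h z / (z - ρ))) a b c d :=
        continuousOn_const.mul (hcont ρ hρS)
      obtain ⟨g1, g2, g3, g4⟩ := hSint ρ hρS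
      simp only [Finset.sum_insert hρ]
      refine ⟨ContinuousOn.add hc ih1, ?_⟩
      rw [rectIntegral_add hab hcd hc ih1, ih2, rectIntegral_const_mul,
        rectIntegral_div_sub hh g1 g2 g3 g4]
      ring
  obtain ⟨k1, k2⟩ := hsum S subset_rfl
  rw [← k2]
  have hcG : ContBoundary (fun z => logDeriv G z * h z) a b c d := hdG.continuousOn.mono hsubr
  rw [rectIntegral_congr (g := fun z => (∑ ρ ∈ S, (m ρ : ℂ) * (h z / (z - ρ)))
    + logDeriv G z * h z) hab hcd, rectIntegral_add hab hcd k1 hcG,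
    rectIntegral_eq_zero hab hcd hdG, add_zero]
  intro s hs
  have hFs := h0 s hs
  have hFe : F = fun z => (∏ ρ ∈ S, (z - ρ) ^ m ρ) * G z := funext hFG
  have hPs : (∏ ρ ∈ S, (s - ρ) ^ m ρ) ≠ 0 := by
    intro h; apply hFs; rw [hFG, h, zero_mul]
  have hGs : G s ≠ 0 := hGne s (hsubr hs)
  have hne := Finset.prod_ne_zero_iff.1 hPs
  have e1 : logDeriv F s = logDeriv (fun z => ∏ ρ ∈ S, (z - ρ) ^ m ρ) s + logDeriv G s := by
    conv_lhs => rw [hFe]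
    exact logDeriv_mul s hPs hGs (by fun_prop) hG.differentiableAt
  simp only
  rw [e1, logDeriv_prod hne (fun ρ _ => by fun_prop), add_mul, Finset.sum_mul]
  congr 1
  refine Finset.sum_congr rfl fun ρ _ => ?_
  rw [logDeriv_fun_pow (by fun_prop)]
  simp [logDeriv_apply, div_eq_mul_inv]
  ring

/-- A horizontal line of controlled height that stays away from a given finite set, by the pigeonhole
principle applied to `#S + 1` equally spaced heights. -/
lemma exists_height_away (S : Finset ℂ) (T : ℝ) : ∃ t ∈ Icc T (T + 1),
    ∀ ρ ∈ S, 1 / (4 * ((S.card : ℝ) + 1)) ≤ |t - ρ.im| := by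
  by_contra! hcon
  set N : ℝ := (S.card : ℝ) + 1 with hN
  have hN0 : 0 < N := by positivity
  have hk : ∀ k ∈ Finset.range (S.card + 1), ∃ ρ ∈ S, |T + k / N - ρ.im| < 1 / (4 * N) := by
    intro k hk
    have hk' : (k : ℝ) ≤ N := by
      have := Finset.mem_range.1 hk
      rw [hN]; exact_mod_cast this.le
    exact hcon _ ⟨by linarith [div_nonneg (Nat.cast_nonneg k : (0 : ℝ) ≤ k) hN0.le],
      by linarith [(div_le_one hN0).2 hk']⟩
  choose! f hf hf' using hk
  obtain ⟨i, hi, j, hj, hij, hfij⟩ := Finset.exists_ne_map_eq_of_card_lt_of_maps_to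
    (s := Finset.range (S.card + 1)) (t := S) (by simp) (fun k hk => hf k hk)
  have h1 := hf' i hi
  have h2 := hf' j hj
  rw [hfij] at h1
  have h3 : |((i : ℝ) - j) / N| < 1 / (2 * N) := by
    have e : ((i : ℝ) - j) / N = (T + i / N - (f j).im) - (T + j / N - (f j).im) := by ring
    rw [e]
    refine (abs_sub _ _).trans_lt ?_
    have : 1 / (2 * N) = 1 / (4 * N) + 1 / (4 * N) := by field_simp; norm_num
    linarith
  rw [abs_div, abs_of_pos hN0, div_lt_div_iff₀ hN0 (by positivity)] at h3
  have h4 : (1 : ℝ) ≤ |(i : ℝ) - j| := by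
    have : (1 : ℤ) ≤ |(i : ℤ) - j| := Int.one_le_abs (sub_ne_zero.2 (by exact_mod_cast hij))
    exact_mod_cast this
  nlinarith

end

/-! ### Sums over zeros in the critical strip -/

section

open Complex Set Filter Topology MeasureTheory Metric

lemma norm_sub_center (σ y T : ℝ) :
    ‖((σ : ℂ) + y * I) - (3 / 2 + T * I)‖ ≤ |σ - 3 / 2| + |y - T| := by
  have e : ((σ : ℂ) + y * I) - (3 / 2 + T * I) = ((σ - 3 / 2 : ℝ) : ℂ) + ((y - T : ℝ) : ℂ) * I := by
    push_cast; ring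
  rw [e]
  refine (norm_add_le _ _).trans ?_
  rw [norm_mul, Complex.norm_real, Complex.norm_real, norm_I, mul_one]
  rfl

/-- An entire function whose zeros lie in the critical strip and whose growth in discs about
the line `Re s = 3/2` is at most exponential in the height. The radius `12` of the discs is what
`CubicRatios.local_zeros` needs to reach every point of `-1/2 ≤ Re s ≤ 3/2`. -/
structure StripFunction (F : ℂ → ℂ) (A : ℝ) : Prop where
  diff : Differentiable ℂ F
  zeros : ∀ s, F s = 0 → 0 < s.re ∧ s.re < 1
  one_le : 1 ≤ A
  growth : ∀ T : ℝ, ∀ s ∈ closedBall (3 / 2 + T * I : ℂ) 12,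
    ‖F s‖ ≤ Real.exp (A * (1 + |T|)) * ‖F (3 / 2 + T * I)‖

namespace StripFunction
variable {F : ℂ → ℂ} {A : ℝ}

lemma center_ne (hF : StripFunction F A) (T : ℝ) : F (3 / 2 + T * I) ≠ 0 := by
  intro h
  have := (hF.zeros _ h).2
  norm_num at this

lemma local_zeros (hF : StripFunction F A) (T : ℝ) :
    ∃ S : Finset ℂ, (∀ ρ, ρ ∈ S ↔ F ρ = 0 ∧ ρ ∈ closedBall (3 / 2 + T * I : ℂ) 4) ∧
      (∑ ρ ∈ S, (analyticOrderNatAt F ρ : ℝ) ≤ 2 * (A * (1 + |T|))) ∧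
      ∀ s ∈ closedBall (3 / 2 + T * I : ℂ) 3, F s ≠ 0 →
        ‖logDeriv F s - ∑ ρ ∈ S, (analyticOrderNatAt F ρ : ℂ) / (s - ρ)‖
          ≤ 32 * (A * (1 + |T|)) := by
  have hA := hF.one_le
  exact CubicRatios.local_zeros hF.diff (hF.center_ne T) (by positivity) (hF.growth T)

lemma norm_sum_div_le {S : Finset ℂ} {m : ℂ → ℕ} {s : ℂ} {d B : ℝ} (hd : 0 < d)
    (h : ∀ ρ ∈ S, d ≤ ‖s - ρ‖) (hB : ∑ ρ ∈ S, (m ρ : ℝ) ≤ B) :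
    ‖∑ ρ ∈ S, (m ρ : ℂ) / (s - ρ)‖ ≤ B / d := by
  calc ‖∑ ρ ∈ S, (m ρ : ℂ) / (s - ρ)‖ ≤ ∑ ρ ∈ S, ‖(m ρ : ℂ) / (s - ρ)‖ := norm_sum_le _ _
    _ ≤ ∑ ρ ∈ S, (m ρ : ℝ) / d := by
        refine Finset.sum_le_sum fun ρ hρ => ?_
        rw [norm_div, Complex.norm_natCast]
        have := h ρ hρ
        gcongr
    _ = (∑ ρ ∈ S, (m ρ : ℝ)) / d := by rw [Finset.sum_div]
    _ ≤ B / d := by gcongr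

/-- On the edges of the strip all zeros are at distance at least `1/2`, so the logarithmic derivative
grows at most linearly. -/
lemma vertical_bound (hF : StripFunction F A) {σ : ℝ} (hσ : σ = 3 / 2 ∨ σ = -1 / 2) (y : ℝ) :
    F (σ + y * I) ≠ 0 ∧ ‖logDeriv F (σ + y * I)‖ ≤ 36 * (A * (1 + |y|)) := by
  obtain ⟨S, hS, hM, hL⟩ := hF.local_zeros y
  have hne : F (σ + y * I) ≠ 0 := by
    intro h
    have := hF.zeros _ h
    simp at this
    rcases hσ with rfl | rfl <;> norm_num at this
  refine ⟨hne, ?_⟩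
  have h1 := hL (σ + y * I) (by
    rw [mem_closedBall, dist_eq_norm]
    refine (norm_sub_center σ y y).trans ?_
    rcases hσ with rfl | rfl <;> norm_num) hne
  have h2 := norm_sum_div_le (S := S) (m := analyticOrderNatAt F) (s := σ + y * I) (d := 1 / 2)
    (by norm_num) (fun ρ hρ => by
      have h3 := hF.zeros ρ ((hS ρ).1 hρ).1
      refine le_trans ?_ (Complex.abs_re_le_norm _)
      simp
      rcases hσ with rfl | rfl
      · rw [abs_of_pos] <;> linarith
      · rw [abs_of_neg] <;> linarith) hM
  have h3 := norm_add_le (logDeriv F (σ + y * I) - ∑ ρ ∈ S, (analyticOrderNatAt F ρ : ℂ) /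
    (σ + y * I - ρ)) (∑ ρ ∈ S, (analyticOrderNatAt F ρ : ℂ) / (σ + y * I - ρ))
  rw [sub_add_cancel] at h3
  have : 2 * (A * (1 + |y|)) / (1 / 2) = 4 * (A * (1 + |y|)) := by ring
  linarith

lemma analyticOrderNatAt_pos (hF : StripFunction F A) {ρ : ℂ} (hρ : F ρ = 0) :
    1 ≤ analyticOrderNatAt F ρ := by
  have h1 := analyticOrderAt_ne_top_of_entire hF.diff (hF.center_ne 0) ρ
  have h2 := (hF.diff.analyticAt ρ).analyticOrderAt_ne_zero.2 hρ
  rw [Nat.one_le_iff_ne_zero]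
  intro h
  rw [← Nat.cast_analyticOrderNatAt h1, h] at h2
  simp at h2

/-- In each window of unit length there is a height at which the logarithmic derivative is polynomially
bounded across the whole strip. -/
lemma good_height (hF : StripFunction F A) (T : ℝ) : ∃ t ∈ Icc T (T + 1),
    ∀ σ ∈ Icc (-1 / 2 : ℝ) (3 / 2), F (σ + t * I) ≠ 0 ∧
      ‖logDeriv F (σ + t * I)‖ ≤ 224 * A ^ 2 * (1 + |t|) ^ 2 := by
  obtain ⟨S, hS, hM, hL⟩ := hF.local_zeros T
  obtain ⟨t, ht, hgap⟩ := exists_height_away S T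
  refine ⟨t, ht, fun σ hσ => ?_⟩
  have hA := hF.one_le
  set B := A * (1 + |T|) with hB
  have hB1 : 1 ≤ B := by nlinarith [abs_nonneg T]
  have hcard : (S.card : ℝ) ≤ 2 * B := by
    refine le_trans ?_ hM
    rw [Finset.card_eq_sum_ones]
    push_cast
    refine Finset.sum_le_sum fun ρ hρ => ?_
    exact_mod_cast hF.analyticOrderNatAt_pos ((hS ρ).1 hρ).1
  have hσ' : |σ - 3 / 2| ≤ 2 := by rw [abs_le]; constructor <;> linarith [hσ.1, hσ.2]
  have ht' : |t - T| ≤ 1 := by rw [abs_le]; constructor <;> linarith [ht.1, ht.2]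
  have hball : ∀ r : ℝ, 3 ≤ r → (σ + t * I : ℂ) ∈ closedBall (3 / 2 + T * I : ℂ) r := by
    intro r hr
    rw [mem_closedBall, dist_eq_norm]
    exact (norm_sub_center σ t T).trans (by linarith)
  have hd0 : (0 : ℝ) < 1 / (4 * ((S.card : ℝ) + 1)) := by positivity
  have hne : F (σ + t * I) ≠ 0 := by
    intro h
    have := hgap _ ((hS _).2 ⟨h, hball 4 (by norm_num)⟩)
    rw [show ((σ : ℂ) + t * I).im = t by simp, sub_self, abs_zero] at this
    linarith
  refine ⟨hne, ?_⟩
  have h1 := hL _ (hball 3 le_rfl) hne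
  have h2 := norm_sum_div_le (S := S) (m := analyticOrderNatAt F) (s := σ + t * I)
    hd0 (fun ρ hρ => by
      refine (hgap ρ hρ).trans ?_
      refine le_trans (le_of_eq ?_) (Complex.abs_im_le_norm _)
      simp) hM
  have h3 := norm_add_le (logDeriv F (σ + t * I) - ∑ ρ ∈ S, (analyticOrderNatAt F ρ : ℂ) /
    (σ + t * I - ρ)) (∑ ρ ∈ S, (analyticOrderNatAt F ρ : ℂ) / (σ + t * I - ρ))
  rw [sub_add_cancel] at h3
  have h4 : 2 * B / (1 / (4 * ((S.card : ℝ) + 1))) ≤ 2 * B * (4 * (2 * B + 1)) := by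
    rw [div_div_eq_mul_div, div_one]
    gcongr
  have h5 : B ≤ 2 * A * (1 + |t|) := by
    have : |T| ≤ |t| + 1 := by
      have := abs_sub_abs_le_abs_sub T t
      rw [abs_sub_comm] at this
      linarith
    rw [hB]
    nlinarith [abs_nonneg t]
  have h6 : 56 * B ^ 2 ≤ 56 * (2 * A * (1 + |t|)) ^ 2 := by gcongr
  nlinarith

end StripFunction

lemma sum_natAbs_summable : Summable fun n : ℤ => ((1 + |(n : ℝ)|) ^ 2)⁻¹ := by
  have h1 : Summable fun n : ℕ => ((1 + (n : ℝ)) ^ 2)⁻¹ := by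
    have := (summable_nat_add_iff 1).2 (Real.summable_nat_pow_inv.2 (by norm_num : 1 < 2))
    refine this.congr fun n => ?_
    push_cast; rw [add_comm]
  refine Summable.of_nat_of_neg ?_ ?_ <;>
  · refine h1.congr fun n => ?_
    simp

namespace StripFunction
variable {F : ℂ → ℂ} {A : ℝ}

/-- Absolute convergence of sums over the zeros against a weight of rapid vertical decay: there are
`O(1 + |n|)` zeros with ordinate in `[n, n + 1)`. -/
lemma summable_zeros (hF : StripFunction F A) {h : ℂ → ℂ} {K : ℝ}
    (hK : ∀ s : ℂ, -1 / 2 ≤ s.re → s.re ≤ 3 / 2 → ‖h s‖ ≤ K / (1 + |s.im|) ^ 8) :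
    Summable fun ρ : {s : ℂ // F s = 0} => (analyticOrderNatAt F ρ.1 : ℂ) * h ρ.1 := by
  classical
  have hA := hF.one_le
  have hK0 : 0 ≤ K := by
    simpa using (norm_nonneg _).trans (hK 0 (by norm_num) (by norm_num))
  choose S hS hM hL using hF.local_zeros
  set g : ℤ → ℝ := fun n => 2 * A * K * 64 * ((1 + |(n : ℝ)|) ^ 2)⁻¹ with hg
  have hgs : Summable g := sum_natAbs_summable.mul_left _
  refine Summable.of_norm (summable_of_sum_le (c := ∑' n, g n) (fun _ => norm_nonneg _) fun U => ?_)
  set fl : {s : ℂ // F s = 0} → ℤ := fun ρ => ⌊ρ.1.im⌋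
  have hfib : ∀ n ∈ U.image fl,
      ∑ ρ ∈ U.filter (fun ρ => fl ρ = n), ‖(analyticOrderNatAt F ρ.1 : ℂ) * h ρ.1‖ ≤ g n := by
    intro n _
    have hn : ∀ ρ ∈ U.filter (fun ρ => fl ρ = n), (n : ℝ) ≤ ρ.1.im ∧ ρ.1.im < n + 1 := by
      intro ρ hρ
      exact Int.floor_eq_iff.1 (Finset.mem_filter.1 hρ).2
    have hle : ∀ ρ ∈ U.filter (fun ρ => fl ρ = n), ‖(analyticOrderNatAt F ρ.1 : ℂ) * h ρ.1‖
        ≤ (analyticOrderNatAt F ρ.1 : ℝ) * (K * 64 / (1 + |(n : ℝ)|) ^ 3) := by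
      intro ρ hρ
      rw [norm_mul, Complex.norm_natCast]
      have hz := hF.zeros ρ.1 ρ.2
      have h1 := hK ρ.1 (by linarith) (by linarith)
      refine mul_le_mul_of_nonneg_left (h1.trans ?_) (Nat.cast_nonneg _)
      obtain ⟨h2, h3⟩ := hn ρ hρ
      have h4 : 1 + |(n : ℝ)| ≤ 2 * (1 + |ρ.1.im|) := by
        have := abs_sub_abs_le_abs_sub (n : ℝ) ρ.1.im
        have h5 : |(n : ℝ) - ρ.1.im| ≤ 1 := by rw [abs_le]; constructor <;> linarith
        linarith [abs_nonneg ρ.1.im]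
      have h5 : (1 + |(n : ℝ)|) ^ 3 ≤ (2 * (1 + |ρ.1.im|)) ^ 3 := by gcongr
      have h6 : (1 + |ρ.1.im|) ^ 3 ≤ (1 + |ρ.1.im|) ^ 8 :=
        pow_le_pow_right₀ (by linarith [abs_nonneg ρ.1.im]) (by norm_num)
      rw [div_le_div_iff₀ (by positivity) (by positivity)]
      calc K * (1 + |(n : ℝ)|) ^ 3 ≤ K * (8 * (1 + |ρ.1.im|) ^ 8) := by
            gcongr
            refine h5.trans ?_
            rw [mul_pow]
            nlinarith
        _ ≤ K * 64 * (1 + |ρ.1.im|) ^ 8 := by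
            have : 0 ≤ K * (1 + |ρ.1.im|) ^ 8 := by positivity
            linarith
    have hsub : ∑ ρ ∈ U.filter (fun ρ => fl ρ = n), (analyticOrderNatAt F ρ.1 : ℝ)
        ≤ 2 * (A * (1 + |(n : ℝ)|)) := by
      refine le_trans ?_ (hM n)
      have hmap := Finset.sum_map (U.filter (fun ρ => fl ρ = n)) (Function.Embedding.subtype _)
        (fun ρ : ℂ => (analyticOrderNatAt F ρ : ℝ))
      simp only [Function.Embedding.subtype_apply] at hmap
      rw [← hmap]
      refine Finset.sum_le_sum_of_subset_of_nonneg ?_ fun _ _ _ => Nat.cast_nonneg _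
      intro ρ hρ
      obtain ⟨ρ', hρ', rfl⟩ := Finset.mem_map.1 hρ
      refine (hS _ _).2 ⟨ρ'.2, ?_⟩
      obtain ⟨h2, h3⟩ := hn ρ' hρ'
      have hz := hF.zeros ρ'.1 ρ'.2
      rw [mem_closedBall, dist_eq_norm]
      have h4 := norm_sub_center ρ'.1.re ρ'.1.im n
      rw [re_add_im] at h4
      have h5 : |ρ'.1.re - 3 / 2| ≤ 3 / 2 := by rw [abs_le]; constructor <;> linarith
      have h6 : |ρ'.1.im - n| ≤ 1 := by rw [abs_le]; constructor <;> linarith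
      exact_mod_cast h4.trans (by linarith)
    refine (Finset.sum_le_sum hle).trans ?_
    rw [← Finset.sum_mul]
    refine (mul_le_mul_of_nonneg_right hsub (by positivity)).trans (le_of_eq ?_)
    simp only [hg]
    field_simp
  calc ∑ ρ ∈ U, ‖(analyticOrderNatAt F ρ.1 : ℂ) * h ρ.1‖
      = ∑ n ∈ U.image fl, ∑ ρ ∈ U.filter (fun ρ => fl ρ = n),
          ‖(analyticOrderNatAt F ρ.1 : ℂ) * h ρ.1‖ :=
        (Finset.sum_fiberwise_of_maps_to (fun ρ hρ => Finset.mem_image_of_mem fl hρ) _).symm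
    _ ≤ ∑ n ∈ U.image fl, g n := Finset.sum_le_sum hfib
    _ ≤ ∑' n, g n := hgs.sum_le_tsum _ fun n _ => by positivity

lemma integrable_vertical (hF : StripFunction F A) {h : ℂ → ℂ} (hh : Differentiable ℂ h) {K : ℝ}
    (hK : ∀ s : ℂ, -1 / 2 ≤ s.re → s.re ≤ 3 / 2 → ‖h s‖ ≤ K / (1 + |s.im|) ^ 8)
    {σ : ℝ} (hσ : σ = 3 / 2 ∨ σ = -1 / 2) :
    Integrable fun y : ℝ => logDeriv F (σ + y * I) * h (σ + y * I) := by
  have hA := hF.one_le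
  have hσ' : -1 / 2 ≤ σ ∧ σ ≤ 3 / 2 := by rcases hσ with rfl | rfl <;> norm_num
  refine integrable_of_norm_le_div (K := 36 * A * K) ?_ fun y => ?_
  · refine Continuous.aestronglyMeasurable ?_
    have h1 : Continuous fun y : ℝ => deriv F (σ + y * I) :=
      hF.diff.deriv.continuous.comp (by fun_prop)
    have h2 : Continuous fun y : ℝ => F (σ + y * I) := hF.diff.continuous.comp (by fun_prop)
    have h3 : Continuous fun y : ℝ => h (σ + y * I) := hh.continuous.comp (by fun_prop)
    exact (h1.div h2 fun y => (hF.vertical_bound hσ y).1).mul h3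
  · rw [norm_mul]
    have h1 := (hF.vertical_bound hσ y).2
    have h2 := hK (σ + y * I) (by simpa using hσ'.1) (by simpa using hσ'.2)
    simp only [add_im, ofReal_im, mul_im, ofReal_re, I_im, mul_one, I_re, mul_zero, add_zero,
      zero_add] at h2
    have hK0 : 0 ≤ K := by
      have := (norm_nonneg _).trans (hK 0 (by norm_num) (by norm_num))
      simpa using this
    have hy := abs_nonneg y
    calc ‖logDeriv F (σ + y * I)‖ * ‖h (σ + y * I)‖
        ≤ 36 * (A * (1 + |y|)) * (K / (1 + |y|) ^ 8) := by gcongr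
      _ = 36 * A * K * (1 / (1 + |y|) ^ 7) := by field_simp
      _ ≤ 36 * A * K * (1 / (1 + |y|) ^ 2) := by
          gcongr ?_ * (1 / ?_)
          exact pow_le_pow_right₀ (by linarith) (by norm_num)
      _ = _ := by ring

/-- The sum over all zeros, as a difference of integrals over the two edges of a strip: the limit of
the argument principle for rectangles whose horizontal sides are at good heights. -/
theorem hasSum_zeros (hF : StripFunction F A) {h : ℂ → ℂ} (hh : Differentiable ℂ h) {K : ℝ}
    (hK : ∀ s : ℂ, -1 / 2 ≤ s.re → s.re ≤ 3 / 2 → ‖h s‖ ≤ K / (1 + |s.im|) ^ 8) :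
    HasSum (fun ρ : {s : ℂ // F s = 0} => (analyticOrderNatAt F ρ.1 : ℂ) * h ρ.1)
      ((2 * Real.pi : ℂ)⁻¹ * ((∫ y : ℝ, logDeriv F ((3 / 2 : ℝ) + y * I) * h ((3 / 2 : ℝ) + y * I))
        - ∫ y : ℝ, logDeriv F ((-1 / 2 : ℝ) + y * I) * h ((-1 / 2 : ℝ) + y * I))) := by
  classical
  have hA := hF.one_le
  have hK0 : 0 ≤ K := by
    simpa using (norm_nonneg _).trans (hK 0 (by norm_num) (by norm_num))
  choose t ht hgood using hF.good_height
  set u : ℕ → ℝ := fun n => t n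
  set v : ℕ → ℝ := fun n => t (-(n : ℝ) - 1)
  have hu : ∀ n : ℕ, (n : ℝ) ≤ u n := fun n => (ht n).1
  have hv : ∀ n : ℕ, v n ≤ -(n : ℝ) := fun n => by linarith [(ht (-(n : ℝ) - 1)).2]
  have hbound : ∀ T σ : ℝ, σ ∈ Icc (-1 / 2 : ℝ) (3 / 2) → ∀ n : ℕ, (n : ℝ) ≤ |t T| →
      ‖logDeriv F (σ + t T * I) * h (σ + t T * I)‖ ≤ 224 * A ^ 2 * K / (1 + (n : ℝ)) := by
    intro T σ hσ n hn
    rw [norm_mul]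
    have h1 := (hgood T σ hσ).2
    have h2 := hK (σ + t T * I) (by simpa using hσ.1) (by simpa using hσ.2)
    simp only [add_im, ofReal_im, mul_im, ofReal_re, I_im, mul_one, I_re, mul_zero, add_zero,
      zero_add] at h2
    have hy := abs_nonneg (t T)
    calc ‖logDeriv F (σ + t T * I)‖ * ‖h (σ + t T * I)‖
        ≤ 224 * A ^ 2 * (1 + |t T|) ^ 2 * (K / (1 + |t T|) ^ 8) := by gcongr
      _ = 224 * A ^ 2 * K * (1 / (1 + |t T|) ^ 6) := by field_simp
      _ ≤ 224 * A ^ 2 * K * (1 / (1 + (n : ℝ))) := by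
          gcongr ?_ * (1 / ?_)
          calc (1 : ℝ) + n ≤ 1 + |t T| := by linarith
            _ ≤ (1 + |t T|) ^ 6 := le_self_pow₀ (by linarith) (by norm_num)
      _ = _ := by ring
  have hlim := tendsto_rectIntegral (f := fun s => logDeriv F s * h s) (a := -1 / 2) (b := 3 / 2)
    (by exact_mod_cast hF.integrable_vertical hh hK (Or.inr rfl))
    (by exact_mod_cast hF.integrable_vertical hh hK (Or.inl rfl))
    (u := u) (v := v) (tendsto_atTop_mono hu tendsto_natCast_atTop_atTop)
    (tendsto_atBot_mono hv (tendsto_neg_atTop_atBot.comp tendsto_natCast_atTop_atTop))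
    (tendsto_const_div_one_add (224 * A ^ 2 * K)) (by norm_num)
    (fun n x hx => hbound _ x hx n ((hu n).trans (le_abs_self _)))
    (fun n x hx => hbound _ x hx n (by
      have := hv n
      have h2 := neg_le_abs (v n)
      change (n : ℝ) ≤ |v n|
      linarith))
  have hfin : ∀ n : ℕ, ((Icc (-1 / 2 : ℝ) (3 / 2) ×ℂ Icc (v n) (u n)) ∩ {s | F s = 0}).Finite :=
    fun n => finite_zeros_inter hF.diff (hF.center_ne 0)
      ((isCompact_Icc).reProdIm isCompact_Icc)
  have hrect : ∀ n : ℕ, rectIntegral (fun s => logDeriv F s * h s) (-1 / 2) (3 / 2) (v n) (u n)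
      = 2 * Real.pi * I * ∑ ρ ∈ (hfin n).toFinset, (analyticOrderNatAt F ρ : ℂ) * h ρ := by
    intro n
    have hn : (0 : ℝ) ≤ n := Nat.cast_nonneg n
    refine rectIntegral_logDeriv_mul hF.diff hh (by norm_num) (by linarith [hu n, hv n]) ?_ _
      (fun ρ => by simp [and_comm])
    rintro z (((⟨h1, h2⟩ | ⟨h1, h2⟩) | ⟨h1, h2⟩) | ⟨h1, h2⟩)
    · have := (hgood (-(n : ℝ) - 1) z.re h1).1
      rw [mem_preimage, mem_singleton_iff] at h2
      have e : z = z.re + v n * I := by rw [← h2, re_add_im]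
      rw [e]; exact this
    · have := (hgood n z.re h1).1
      rw [mem_preimage, mem_singleton_iff] at h2
      have e : z = z.re + u n * I := by rw [← h2, re_add_im]
      rw [e]; exact this
    · intro h0
      have := (hF.zeros z h0).1
      rw [mem_preimage, mem_singleton_iff] at h1
      linarith
    · intro h0
      have := (hF.zeros z h0).2
      rw [mem_preimage, mem_singleton_iff] at h1
      linarith
  have hsum := (hF.summable_zeros hK).hasSum
  set U : ℕ → Finset {s : ℂ // F s = 0} := fun n => (hfin n).toFinset.subtype (fun s => F s = 0)
  have hU : Tendsto U atTop atTop := by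
    rw [Filter.tendsto_atTop]
    intro V
    obtain ⟨N, hN⟩ : ∃ N : ℕ, ∀ ρ ∈ V, |ρ.1.im| ≤ N := by
      obtain ⟨N, hN⟩ := exists_nat_ge (∑ ρ ∈ V, |ρ.1.im|)
      exact ⟨N, fun ρ hρ => (Finset.single_le_sum (f := fun ρ : {s : ℂ // F s = 0} => |ρ.1.im|)
        (fun _ _ => abs_nonneg _) hρ).trans hN⟩
    filter_upwards [eventually_ge_atTop N] with n hn
    intro ρ hρ
    simp only [U, Finset.mem_subtype, Set.Finite.mem_toFinset]
    have h1 := hF.zeros ρ.1 ρ.2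
    have h2 := abs_le.1 (hN ρ hρ)
    have h3 : (N : ℝ) ≤ n := by exact_mod_cast hn
    exact ⟨⟨⟨by linarith, by linarith⟩, ⟨by linarith [hv n], by linarith [hu n]⟩⟩, ρ.2⟩
  have hlim2 := (hsum.comp hU).const_mul (2 * Real.pi * I)
  have heq : ∀ n, rectIntegral (fun s => logDeriv F s * h s) (-1 / 2) (3 / 2) (v n) (u n) =
      2 * Real.pi * I * ((fun s : Finset {s : ℂ // F s = 0} =>
        ∑ ρ ∈ s, (analyticOrderNatAt F ρ.1 : ℂ) * h ρ.1) ∘ U) n := by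
    intro n
    rw [hrect n]
    congr 1
    simp only [Function.comp, U]
    rw [Finset.sum_subtype_of_mem (fun ρ => (analyticOrderNatAt F ρ : ℂ) * h ρ)]
    intro ρ hρ
    exact ((hfin n).mem_toFinset.1 hρ).2
  simp only [heq] at hlim
  have h3 := tendsto_nhds_unique hlim2 hlim
  convert hsum using 1
  have hpi : (Real.pi : ℂ) ≠ 0 := by exact_mod_cast Real.pi_ne_zero
  rw [inv_mul_eq_iff_eq_mul₀ (by simp)]
  have h4 : I * (2 * Real.pi * ∑' ρ : {s : ℂ // F s = 0}, (analyticOrderNatAt F ρ.1 : ℂ) * h ρ.1)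
      = I * ((∫ y : ℝ, logDeriv F ((3 / 2 : ℝ) + y * I) * h ((3 / 2 : ℝ) + y * I))
        - ∫ y : ℝ, logDeriv F ((-1 / 2 : ℝ) + y * I) * h ((-1 / 2 : ℝ) + y * I)) := by
    rw [mul_sub, ← h3]; ring
  exact (mul_left_cancel₀ I_ne_zero h4).symm
end StripFunction

end

/-! ### Bounds for the gamma and digamma functions -/

section

open Complex Set Filter Topology MeasureTheory Metric

lemma norm_Gamma_le {z : ℂ} (hz : 0 < z.re) : ‖Gamma z‖ ≤ Real.Gamma z.re := by
  rw [Gamma_eq_integral hz, Real.Gamma_eq_integral hz, GammaIntegral]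
  refine (norm_integral_le_integral_norm _).trans (le_of_eq ?_)
  refine setIntegral_congr_fun measurableSet_Ioi fun x hx => ?_
  simp only [norm_mul, Complex.norm_real]
  rw [Complex.norm_cpow_eq_rpow_re_of_pos hx, Real.norm_of_nonneg (Real.exp_pos _).le]
  simp

lemma norm_sin_le (z : ℂ) : ‖sin z‖ ≤ Real.exp |z.im| := by
  rw [Complex.sin, norm_div, norm_mul, norm_I, mul_one]
  have h1 : ‖cexp (-z * I)‖ ≤ Real.exp |z.im| := by
    rw [norm_exp]; simpa using le_abs_self z.im
  have h2 : ‖cexp (z * I)‖ ≤ Real.exp |z.im| := by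
    rw [norm_exp]; simpa using neg_le_abs z.im
  have h3 := norm_sub_le (cexp (-z * I)) (cexp (z * I))
  rw [div_le_iff₀ (by norm_num), Complex.norm_ofNat]
  linarith

/-- Upper and lower bounds for `Γ` in `1/8 ≤ Re z ≤ 7/8`. The lower bound comes from the reflection
formula, as `Γ(1 - z)` is bounded in the same strip. -/
lemma exists_Gamma_bounds : ∃ M : ℝ, 1 ≤ M ∧ ∀ z : ℂ, 1 / 8 ≤ z.re → z.re ≤ 7 / 8 →
    ‖Gamma z‖ ≤ M ∧ Real.exp (-(Real.pi * |z.im|)) ≤ M * ‖Gamma z‖ := by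
  have hc : ContinuousOn Real.Gamma (Icc (1 / 8) (7 / 8)) := by
    intro x hx
    refine (Real.differentiableAt_Gamma fun m => ?_).continuousAt.continuousWithinAt
    have : (0 : ℝ) ≤ m := Nat.cast_nonneg m
    linarith [hx.1]
  obtain ⟨M, hM⟩ := isCompact_Icc.bddAbove_image hc
  have hM' : ∀ x ∈ Icc (1 / 8 : ℝ) (7 / 8), Real.Gamma x ≤ M := fun x hx =>
    hM (mem_image_of_mem _ hx)
  refine ⟨max M 1, le_max_right _ _, fun z h1 h2 => ?_⟩
  have hz : ‖Gamma z‖ ≤ max M 1 :=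
    (norm_Gamma_le (by linarith)).trans ((hM' _ ⟨h1, h2⟩).trans (le_max_left _ _))
  refine ⟨hz, ?_⟩
  have h1z : ‖Gamma (1 - z)‖ ≤ max M 1 := by
    refine (norm_Gamma_le (by simp; linarith)).trans ((hM' _ ⟨?_, ?_⟩).trans (le_max_left _ _)) <;>
    simp <;> linarith
  have hr := Complex.Gamma_mul_Gamma_one_sub z
  have hg1 : Gamma z ≠ 0 := Gamma_ne_zero_of_re_pos (by linarith)
  have hg2 : Gamma (1 - z) ≠ 0 := Gamma_ne_zero_of_re_pos (by simp; linarith)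
  have hsin : sin (Real.pi * z) ≠ 0 := by
    intro h
    rw [h, div_zero] at hr
    exact mul_ne_zero hg1 hg2 hr
  have hn := congrArg norm hr
  rw [norm_mul, norm_div, Complex.norm_real, Real.norm_of_nonneg Real.pi_pos.le,
    eq_div_iff (norm_ne_zero_iff.2 hsin)] at hn
  have h3 := norm_sin_le (Real.pi * z)
  have h4 : ((Real.pi : ℂ) * z).im = Real.pi * z.im := by simp
  rw [h4, abs_mul, abs_of_pos Real.pi_pos] at h3
  have hM0 : 0 < max M 1 := lt_max_of_lt_right one_pos
  have h5 : 1 ≤ (max M 1 * ‖Gamma z‖) * Real.exp (Real.pi * |z.im|) := by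
    calc (1 : ℝ) ≤ Real.pi := by linarith [Real.pi_gt_three]
      _ = ‖Gamma z‖ * ‖Gamma (1 - z)‖ * ‖sin (Real.pi * z)‖ := hn.symm
      _ ≤ ‖Gamma z‖ * max M 1 * Real.exp (Real.pi * |z.im|) := by gcongr
      _ = _ := by ring
  rw [Real.exp_neg, inv_le_iff_one_le_mul₀ (Real.exp_pos _)]
  exact h5

/-- The digamma function grows at most linearly in the strip `1/4 ≤ Re z ≤ 3/4`. -/
lemma exists_digamma_bound : ∃ C : ℝ, 0 ≤ C ∧ ∀ z : ℂ, 1 / 4 ≤ z.re → z.re ≤ 3 / 4 →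
    ‖digamma z‖ ≤ C * (1 + |z.im|) := by
  obtain ⟨M, hM1, hM⟩ := exists_Gamma_bounds
  refine ⟨64 * (Real.pi + 2 * M), by positivity, fun z h1 h2 => ?_⟩
  have hre : ∀ w ∈ ball z (1 / 8), 1 / 8 ≤ w.re ∧ w.re ≤ 7 / 8 := by
    intro w hw
    rw [mem_ball, dist_eq_norm] at hw
    have := abs_lt.1 ((Complex.abs_re_le_norm (w - z)).trans_lt hw)
    simp at this
    constructor <;> linarith
  have h3 := norm_logDeriv_le_of_ne_zero (G := Gamma) (c := z) (R := 1 / 8) (r := 0)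
    (B := Real.pi * |z.im| + 2 * M) (by positivity) le_rfl (by norm_num)
    (fun w hw => (differentiableAt_Gamma w fun m h => by
      have := (hre w hw).1
      rw [h] at this
      simp at this
      have hm : (0 : ℝ) ≤ m := Nat.cast_nonneg m
      linarith).differentiableWithinAt)
    (fun w hw => Gamma_ne_zero_of_re_pos (by linarith [(hre w hw).1]))
    (fun w hw => by
      have h4 := (hM w (hre w hw).1 (hre w hw).2).1
      have h5 := (hM z (by linarith) (by linarith)).2
      have h6 : M ≤ Real.exp M := by linarith [Real.add_one_le_exp M]
      have h7 : 1 ≤ Real.exp (Real.pi * |z.im|) * (M * ‖Gamma z‖) := by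
        rw [Real.exp_neg] at h5
        rwa [← inv_le_iff_one_le_mul₀' (Real.exp_pos _)]
      calc ‖Gamma w‖ ≤ M * 1 := by linarith
        _ ≤ M * (Real.exp (Real.pi * |z.im|) * (M * ‖Gamma z‖)) := by gcongr
        _ = Real.exp (Real.pi * |z.im|) * (M * M) * ‖Gamma z‖ := by ring
        _ ≤ Real.exp (Real.pi * |z.im|) * (Real.exp M * Real.exp M) * ‖Gamma z‖ := by gcongr
        _ = _ := by rw [← Real.exp_add, ← Real.exp_add]; ring_nf)
    (z := z) (by simp)
  rw [digamma_def]
  refine h3.trans (le_of_sub_nonneg ?_)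
  have := abs_nonneg z.im
  have e : 64 * (Real.pi + 2 * M) * (1 + |z.im|) - 8 * (Real.pi * |z.im| + 2 * M) * (1 / 8) /
    (1 / 8 - 0) ^ 2 = 64 * (Real.pi + 2 * M * |z.im|) := by ring
  rw [e]
  positivity

end

/-! ### Completed `L`-functions of even characters -/

section

open Complex Set Filter Topology MeasureTheory Metric

/-- A Mellin transform is bounded in every vertical strip in which it converges. -/
lemma exists_mellin_bound {f : ℝ → ℂ} (hf : ∀ s : ℂ, MellinConvergent f s) (a b : ℝ) :
    ∃ C : ℝ, ∀ s : ℂ, a ≤ s.re → s.re ≤ b → ‖mellin f s‖ ≤ C := by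
  have hn : ∀ s : ℂ, ∀ t ∈ Ioi (0 : ℝ),
      ‖(t : ℂ) ^ (s - 1) • f t‖ = t ^ (s.re - 1) * ‖f t‖ := by
    intro s t ht
    rw [norm_smul, norm_cpow_eq_rpow_re_of_pos ht]
    simp
  have hi : ∀ c : ℝ, IntegrableOn (fun t : ℝ => t ^ (c - 1) * ‖f t‖) (Ioi 0) := by
    intro c
    have h1 : IntegrableOn (fun t : ℝ => ‖(t : ℂ) ^ ((c : ℂ) - 1) • f t‖) (Ioi 0) := (hf c).norm
    refine h1.congr_fun (fun t ht => ?_) measurableSet_Ioi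
    simpa using hn c t ht
  refine ⟨∫ t in Ioi (0 : ℝ), (t ^ (a - 1) * ‖f t‖ + t ^ (b - 1) * ‖f t‖), fun s h1 h2 => ?_⟩
  rw [mellin]
  refine (norm_integral_le_integral_norm _).trans ?_
  refine setIntegral_mono_on (hf s).norm ((hi a).add (hi b)) measurableSet_Ioi fun t ht => ?_
  rw [hn s t ht, ← add_mul]
  refine mul_le_mul_of_nonneg_right ?_ (norm_nonneg _)
  have ha : 0 ≤ t ^ (a - 1) := Real.rpow_nonneg (le_of_lt ht) _
  have hb : 0 ≤ t ^ (b - 1) := Real.rpow_nonneg (le_of_lt ht) _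
  rcases le_total 1 t with h | h
  · have := Real.rpow_le_rpow_of_exponent_le h (by linarith : s.re - 1 ≤ b - 1)
    linarith
  · have := Real.rpow_le_rpow_of_exponent_ge ht h (by linarith : a - 1 ≤ s.re - 1)
    linarith

lemma exists_completedHurwitzZetaEven₀_bound (x : UnitAddCircle) (a b : ℝ) :
    ∃ C : ℝ, ∀ s : ℂ, a ≤ s.re → s.re ≤ b → ‖HurwitzZeta.completedHurwitzZetaEven₀ x s‖ ≤ C := by
  set P := HurwitzZeta.hurwitzEvenFEPair x
  obtain ⟨C, hC⟩ := exists_mellin_bound (f := P.f_modif)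
    (fun s => (P.isStrongFEPair_toStrongFEPair.hasMellin s).1) (a / 2) (b / 2)
  refine ⟨C / 2, fun s h1 h2 => ?_⟩
  have h3 := hC (s / 2) (by simp; linarith) (by simp; linarith)
  rw [HurwitzZeta.completedHurwitzZetaEven₀, norm_div]
  simp only [Complex.norm_ofNat]
  have : ‖P.Λ₀ (s / 2)‖ ≤ C := h3
  gcongr

variable {N : ℕ}

lemma inv_even {χ : DirichletCharacter ℂ N} (hχ : χ.Even) : (χ⁻¹).Even := by
  rw [DirichletCharacter.Even, MulChar.inv_apply]
  have : Ring.inverse (-1 : ZMod N) = -1 := by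
    have h : IsUnit (-1 : ZMod N) := isUnit_one.neg
    have h2 := Ring.mul_inverse_cancel _ h
    linear_combination -h2
  rw [this]; exact hχ

variable [NeZero N]

/-- The completed `L`-function of an even nontrivial character is a finite combination of entire
completed Hurwitz zeta functions, each of them a Mellin transform, so it is bounded in strips. -/
lemma exists_completedLFunction_bound {χ : DirichletCharacter ℂ N} (hχ : χ.Even) (hχ1 : χ ≠ 1)
    (a b : ℝ) : ∃ C : ℝ, ∀ s : ℂ, a ≤ s.re → s.re ≤ b → ‖χ.completedLFunction s‖ ≤ C := by
  choose C hC using fun j : ZMod N =>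
    exists_completedHurwitzZetaEven₀_bound (ZMod.toAddCircle j) a b
  have hN1 : N ≠ 1 := fun h => hχ1 (DirichletCharacter.level_one' _ h)
  have hN : (0 : ℝ) < N := Nat.cast_pos.2 (NeZero.pos N)
  have hN' : (1 : ℝ) ≤ N := by exact_mod_cast NeZero.one_le
  have hodd : ∀ s, ∑ j, χ j * HurwitzZeta.completedHurwitzZetaOdd (ZMod.toAddCircle j) s = 0 := by
    intro s
    refine (hχ.to_fun.mul_odd fun j => ?_).sum_eq_zero
    rw [map_neg, HurwitzZeta.completedHurwitzZetaOdd_neg]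
  refine ⟨(N : ℝ) ^ (-a) * ∑ j, ‖χ j‖ * |C j|, fun s h1 h2 => ?_⟩
  rw [DirichletCharacter.completedLFunction, ZMod.completedLFunction_eq,
    χ.map_zero' hN1, χ.sum_eq_zero_of_ne_one hχ1, ZMod.completedLFunction₀, hodd]
  simp only [mul_zero, zero_div, add_zero, sub_zero, norm_mul]
  gcongr
  · rw [← ofReal_natCast, norm_cpow_eq_rpow_re_of_pos hN]
    exact Real.rpow_le_rpow_of_exponent_le hN' (by simpa using h1)
  · refine (norm_sum_le _ _).trans (Finset.sum_le_sum fun j _ => ?_)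
    rw [norm_mul]
    gcongr
    exact (hC j s h1 h2).trans (le_abs_self _)

lemma completedLFunction_eq_mul {χ : DirichletCharacter ℂ N} (hχ : χ.Even) {s : ℂ}
    (hs : 0 < s.re) : χ.completedLFunction s = Gammaℝ s * χ.LFunction s := by
  have h0 : s ≠ 0 := fun h => by simp [h] at hs
  rw [DirichletCharacter.LFunction_eq_completed_div_gammaFactor χ s (Or.inl h0),
    hχ.gammaFactor_def, mul_div_cancel₀ _ (Gammaℝ_ne_zero_of_re_pos hs)]

lemma completedLFunction_ne_zero_of_one_le_re {χ : DirichletCharacter ℂ N} (hχ : χ.Even)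
    (hχ1 : χ ≠ 1) {s : ℂ} (hs : 1 ≤ s.re) : χ.completedLFunction s ≠ 0 := by
  rw [completedLFunction_eq_mul hχ (by linarith)]
  exact mul_ne_zero (Gammaℝ_ne_zero_of_re_pos (by linarith))
    (χ.LFunction_ne_zero_of_one_le_re (Or.inl hχ1) hs)

lemma rootNumber_ne_zero {χ : DirichletCharacter ℂ N} (hχ : χ.Even) (hχ1 : χ ≠ 1)
    (hp : χ.IsPrimitive) : χ.rootNumber ≠ 0 := by
  intro h
  have := hp.completedLFunction_one_sub (-1)
  rw [h, mul_zero, zero_mul] at this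
  exact completedLFunction_ne_zero_of_one_le_re hχ hχ1 (by norm_num) this

/-- The functional equation confines the zeros of the completed `L`-function to the open critical strip. -/
lemma completedLFunction_zeros {χ : DirichletCharacter ℂ N} (hχ : χ.Even) (hχ1 : χ ≠ 1)
    (hp : χ.IsPrimitive) {s : ℂ} (hs : χ.completedLFunction s = 0) : 0 < s.re ∧ s.re < 1 := by
  constructor
  · by_contra h
    have h1 := hp.completedLFunction_one_sub (1 - s)
    rw [sub_sub_cancel, hs] at h1
    have h2 : (χ⁻¹).completedLFunction (1 - s) ≠ 0 :=
      completedLFunction_ne_zero_of_one_le_re (inv_even hχ) (inv_ne_one.2 hχ1) (by simp; linarith)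
    have h3 : (N : ℂ) ^ (1 - s - 1 / 2) ≠ 0 := by
      rw [cpow_ne_zero_iff]
      exact Or.inl (NeZero.ne _)
    exact mul_ne_zero (mul_ne_zero h3 (rootNumber_ne_zero hχ hχ1 hp)) h2 h1.symm
  · by_contra h
    exact completedLFunction_ne_zero_of_one_le_re hχ hχ1 (not_lt.1 h) hs

/-- The value `ζ(3/2)`, as a sum. -/
noncomputable def zetaThreeHalves : ℝ := ∑' n : ℕ, 1 / (n : ℝ) ^ (3 / 2 : ℝ)

lemma summable_rpow_three_halves : Summable fun n : ℕ => 1 / (n : ℝ) ^ (3 / 2 : ℝ) :=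
  Real.summable_one_div_nat_rpow.2 (by norm_num)

lemma norm_LSeries_le_zetaThreeHalves {f : ℕ → ℂ} (hf : ∀ n, ‖f n‖ ≤ 1) {s : ℂ}
    (hs : 3 / 2 ≤ s.re) : ‖LSeries f s‖ ≤ zetaThreeHalves := by
  refine tsum_of_norm_bounded summable_rpow_three_halves.hasSum fun n => ?_
  rcases eq_or_ne n 0 with rfl | hn
  · simp
  · rw [LSeries.norm_term_eq, if_neg hn]
    have : (1 : ℝ) ≤ n := by exact_mod_cast Nat.one_le_iff_ne_zero.2 hn
    gcongr
    exact hf n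

lemma norm_LFunction_le (χ : DirichletCharacter ℂ N) {s : ℂ} (hs : 3 / 2 ≤ s.re) :
    ‖χ.LFunction s‖ ≤ zetaThreeHalves := by
  rw [χ.LFunction_eq_LSeries (by linarith)]
  exact norm_LSeries_le_zetaThreeHalves (fun n => χ.norm_le_one n) hs

/-- `1 / L(s, χ)` is the Dirichlet series of `μ χ`, so it is bounded by `ζ(3/2)` as well. -/
lemma one_le_mul_norm_LFunction (χ : DirichletCharacter ℂ N) {s : ℂ} (hs : 3 / 2 ≤ s.re) :
    1 ≤ zetaThreeHalves * ‖χ.LFunction s‖ := by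
  have h := DirichletCharacter.LSeries.mul_mu_eq_one χ (s := s) (by linarith)
  rw [← χ.LFunction_eq_LSeries (by linarith)] at h
  have h2 := congrArg norm h
  rw [norm_mul, norm_one, mul_comm] at h2
  rw [← h2]
  gcongr
  refine norm_LSeries_le_zetaThreeHalves (fun n => ?_) hs
  simp only [Pi.mul_apply, norm_mul]
  refine mul_le_one₀ (χ.norm_le_one n) (norm_nonneg _) ?_
  have hmu := ArithmeticFunction.abs_moebius_le_one (n := n)
  simp only [norm_intCast]
  exact_mod_cast hmu

lemma zetaThreeHalves_pos : 0 < zetaThreeHalves := by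
  have h := one_le_mul_norm_LFunction (1 : DirichletCharacter ℂ 1) (s := 2) (by norm_num)
  by_contra h0
  have := mul_nonpos_of_nonpos_of_nonneg (not_lt.1 h0)
    (norm_nonneg ((1 : DirichletCharacter ℂ 1).LFunction 2))
  linarith

lemma norm_Gammaℝ_three_halves (T : ℝ) :
    ‖Gammaℝ (3 / 2 + T * I)‖ = Real.pi ^ (-3 / 4 : ℝ) * ‖Gamma (3 / 4 + T / 2 * I)‖ := by
  rw [Gammaℝ_def, norm_mul, norm_cpow_eq_rpow_re_of_pos Real.pi_pos]
  congr 2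
  · simp; norm_num
  · ring_nf

/-- The completed `L`-function is bounded in strips, and at `3/2 + i T` it is at least `e ^ (-π |T|)` up
to a constant, by the lower bounds for `Γ` and for `L(s, χ)`. -/
theorem stripFunction_completedLFunction {χ : DirichletCharacter ℂ N} (hχ : χ.Even) (hχ1 : χ ≠ 1)
    (hp : χ.IsPrimitive) : ∃ A, StripFunction χ.completedLFunction A := by
  obtain ⟨C, hC⟩ := exists_completedLFunction_bound hχ hχ1 (-11) 14
  obtain ⟨M, hM1, hM⟩ := exists_Gamma_bounds
  have hZ := zetaThreeHalves_pos
  set D : ℝ := |C| * (Real.pi ^ (3 / 4 : ℝ) * M * zetaThreeHalves) with hD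
  have hD0 : 0 ≤ D := by positivity
  have hlow : ∀ T : ℝ, Real.exp (-(Real.pi * |T|)) ≤
      Real.pi ^ (3 / 4 : ℝ) * M * zetaThreeHalves * ‖χ.completedLFunction (3 / 2 + T * I)‖ := by
    intro T
    rw [completedLFunction_eq_mul hχ (by simp), norm_mul, norm_Gammaℝ_three_halves]
    have h1 := one_le_mul_norm_LFunction χ (s := 3 / 2 + T * I) (by simp)
    have h2 := (hM (3 / 4 + T / 2 * I) (by simp; norm_num) (by simp; norm_num)).2
    have h3 : ((3 / 4 + T / 2 * I : ℂ)).im = T / 2 := by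
      have : (3 / 4 + T / 2 * I : ℂ) = ((3 / 4 : ℝ) : ℂ) + ((T / 2 : ℝ) : ℂ) * I := by
        push_cast; ring
      rw [this]; simp only [add_im, ofReal_im, mul_im, ofReal_re, I_im, I_re]; ring
    rw [h3] at h2
    have h4 : Real.pi ^ (3 / 4 : ℝ) * Real.pi ^ (-3 / 4 : ℝ) = 1 := by
      rw [← Real.rpow_add Real.pi_pos]; norm_num
    have h5 : |T / 2| ≤ |T| := by
      rw [abs_div]; norm_num
    calc Real.exp (-(Real.pi * |T|)) ≤ Real.exp (-(Real.pi * |T / 2|)) := by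
          apply Real.exp_le_exp.2
          have := mul_le_mul_of_nonneg_left h5 Real.pi_pos.le
          linarith
      _ ≤ M * ‖Gamma (3 / 4 + T / 2 * I)‖ * 1 := by linarith
      _ ≤ M * ‖Gamma (3 / 4 + T / 2 * I)‖ * (zetaThreeHalves * ‖χ.LFunction (3 / 2 + T * I)‖) := by
          gcongr
      _ = (Real.pi ^ (3 / 4 : ℝ) * Real.pi ^ (-3 / 4 : ℝ)) * (M * ‖Gamma (3 / 4 + T / 2 * I)‖ *
            (zetaThreeHalves * ‖χ.LFunction (3 / 2 + T * I)‖)) := by rw [h4, one_mul]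
      _ = _ := by ring
  refine ⟨Real.pi + D, DirichletCharacter.differentiable_completedLFunction hχ1,
    fun s hs => completedLFunction_zeros hχ hχ1 hp hs, by linarith [Real.pi_gt_three],
    fun T s hs => ?_⟩
  have hre : -11 ≤ s.re ∧ s.re ≤ 14 := by
    rw [mem_closedBall, dist_eq_norm] at hs
    have := abs_le.1 ((Complex.abs_re_le_norm (s - (3 / 2 + T * I))).trans hs)
    simp at this
    constructor <;> linarith
  have hDe : D ≤ Real.exp D := by linarith [Real.add_one_le_exp D]
  calc ‖χ.completedLFunction s‖ ≤ |C| * 1 := by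
        have := (hC s hre.1 hre.2).trans (le_abs_self C); linarith
    _ = |C| * (Real.exp (Real.pi * |T|) * Real.exp (-(Real.pi * |T|))) := by
        rw [← Real.exp_add]; simp
    _ ≤ |C| * (Real.exp (Real.pi * |T|) * (Real.pi ^ (3 / 4 : ℝ) * M * zetaThreeHalves *
          ‖χ.completedLFunction (3 / 2 + T * I)‖)) := by gcongr; exact hlow T
    _ = D * Real.exp (Real.pi * |T|) * ‖χ.completedLFunction (3 / 2 + T * I)‖ := by rw [hD]; ring
    _ ≤ Real.exp D * Real.exp (Real.pi * |T|) * ‖χ.completedLFunction (3 / 2 + T * I)‖ := by gcongr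
    _ ≤ _ := by
        rw [← Real.exp_add]
        gcongr
        have := abs_nonneg T
        have h6 := Real.pi_pos
        nlinarith [mul_nonneg hD0 this]

end

/-! ### The cubic characters are even and primitive -/

section

open UniqueFactorizationMonoid

lemma primeSymbol_cube (P : Ideal EisInt) (x : EisInt) :
    primeSymbol P x ^ 3 = 0 ∨ primeSymbol P x ^ 3 = 1 := by
  unfold primeSymbol
  split_ifs
  · left; norm_num
  · right; norm_num
  · right; exact omegaC_cube
  · right; rw [← pow_mul, mul_comm, pow_mul, omegaC_cube, one_pow]

lemma cubicSymbol_cube (α x : EisInt) : cubicSymbol α x ^ 3 = 0 ∨ cubicSymbol α x ^ 3 = 1 := by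
  classical
  unfold cubicSymbol
  generalize normalizedFactors (Ideal.span {α}) = s
  induction s using Multiset.induction_on with
  | empty => right; simp
  | cons P s ih =>
    rw [Multiset.map_cons, Multiset.prod_cons, mul_pow]
    rcases ih with h | h <;> rcases primeSymbol_cube P x with h' | h' <;> simp [h, h']

/-- `χ(-1)` is a square root of `1` and a cube root of `1`. -/
lemma cubicChar_even (α : family) : (cubicChar α).Even := by
  have h1 : cubicChar α (-1) ^ 2 = 1 := by
    rw [← map_pow]; simp
  have h2 : cubicChar α (-1) ^ 3 = 0 ∨ cubicChar α (-1) ^ 3 = 1 :=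
    cubicSymbol_cube α.1 _
  rcases h2 with h2 | h2
  · have := pow_eq_zero_iff (by norm_num) |>.1 h2
    rw [this] at h1; norm_num at h1
  · rw [DirichletCharacter.Even]
    linear_combination h2 - cubicChar α (-1) * h1

instance : IsPrincipalIdealRing EisInt := IsCyclotomicExtension.Rat.three_pid EisField

open scoped Classical in
lemma factors_nodup {α : EisInt} (hα : α ∈ family) :
    (normalizedFactors (Ideal.span {α})).Nodup := by
  have h0 : Ideal.span {α} ≠ ⊥ := by simpa using family_ne_zero hα
  refine (squarefree_iff_nodup_normalizedFactors h0).1 fun I hI => ?_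
  obtain ⟨π, rfl⟩ := (IsPrincipalIdealRing.principal I)
  change Ideal.span {π} * Ideal.span {π} ∣ _ at hI
  rw [Ideal.span_singleton_mul_span_singleton, Ideal.dvd_span_singleton,
    Ideal.mem_span_singleton] at hI
  have := hα.2.1 π hI
  change IsUnit (Ideal.span {π})
  rw [Ideal.isUnit_iff, Ideal.span_singleton_eq_top]
  exact this

lemma finrank_eisInt : Module.finrank ℤ EisInt = 2 := by
  rw [NumberField.RingOfIntegers.rank, IsCyclotomicExtension.finrank (n := 3) EisField
    (Polynomial.cyclotomic.irreducible_rat (by norm_num))]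
  rfl

lemma absNorm_span_natCast (p : ℕ) : Ideal.absNorm (Ideal.span {(p : EisInt)}) = p ^ 2 := by
  rw [Ideal.absNorm_span_singleton]
  have : ((p : ℕ) : EisInt) = algebraMap ℤ EisInt p := by simp
  rw [this, Algebra.norm_algebraMap, finrank_eisInt]
  simp [Int.natAbs_pow]

open scoped Classical in
/-- A prime factor of a member of the family has degree one, since `p` is inert otherwise and would
divide `α`. -/
lemma factor_norm_prime {α : EisInt} (hα : α ∈ family) {P : Ideal EisInt}
    (hP : P ∈ normalizedFactors (Ideal.span {α})) : ∃ p : ℕ, p.Prime ∧ Ideal.absNorm P = p := by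
  obtain ⟨h1, h2, h3, h4⟩ := factor_spec hα hP
  have hN1 : Ideal.absNorm P ≠ 1 := fun h => h1.ne_top (Ideal.absNorm_eq_one_iff.1 h)
  obtain ⟨p, hp, hpN⟩ := Nat.exists_prime_and_dvd hN1
  refine ⟨p, hp, ?_⟩
  have hmem := prime_mem_of_dvd_absNorm h2 hp hpN
  have hdvd : P ∣ Ideal.span {(p : EisInt)} := Ideal.dvd_span_singleton.2 hmem
  obtain ⟨Q, hQ⟩ := hdvd
  have hNorm : Ideal.absNorm P * Ideal.absNorm Q = p ^ 2 := by
    rw [← map_mul, ← hQ, absNorm_span_natCast]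
  obtain ⟨k, hk, hk'⟩ := (Nat.dvd_prime_pow hp).1 (Dvd.intro _ hNorm)
  interval_cases k
  · exact absurd (by simpa using hk') hN1
  · simpa using hk'
  · exfalso
    rw [hk'] at hNorm
    have hQ1 : Ideal.absNorm Q = 1 := by
      have : 0 < p ^ 2 := pow_pos hp.pos 2
      exact Nat.eq_of_mul_eq_mul_left this (by rw [hNorm, mul_one])
    rw [Ideal.absNorm_eq_one_iff] at hQ1
    rw [hQ1, Ideal.mul_top] at hQ
    rw [← hQ, Ideal.mem_span_singleton] at h4
    exact hα.2.2.1 p hp h4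

open scoped Classical in
/-- Two distinct prime factors of equal norm `p` would make the rational prime `p` divide `α`. -/
lemma factor_norm_injective {α : EisInt} (hα : α ∈ family) {P Q : Ideal EisInt}
    (hP : P ∈ normalizedFactors (Ideal.span {α})) (hQ : Q ∈ normalizedFactors (Ideal.span {α}))
    (hPQ : Ideal.absNorm P = Ideal.absNorm Q) : P = Q := by
  by_contra hne
  obtain ⟨p, hp, hpP⟩ := factor_norm_prime hα hP
  obtain ⟨p1, p2, p3, p4⟩ := factor_spec hα hP
  obtain ⟨q1, q2, q3, q4⟩ := factor_spec hα hQ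
  have hPm := prime_mem_of_dvd_absNorm p2 hp (dvd_of_eq hpP.symm)
  have hQm := prime_mem_of_dvd_absNorm q2 hp (dvd_of_eq (hPQ ▸ hpP).symm)
  have hmaxP : P.IsMaximal := p1.isMaximal p2
  have hmaxQ : Q.IsMaximal := q1.isMaximal q2
  have hcop : IsCoprime P Q := Ideal.isCoprime_of_isMaximal hne
  have hd : P * Q ∣ Ideal.span {(p : EisInt)} :=
    hcop.mul_dvd (Ideal.dvd_span_singleton.2 hPm) (Ideal.dvd_span_singleton.2 hQm)
  have hd2 : P * Q ∣ Ideal.span {α} :=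
    hcop.mul_dvd (Ideal.dvd_span_singleton.2 p4) (Ideal.dvd_span_singleton.2 q4)
  obtain ⟨R, hR⟩ := hd
  have hNorm : p ^ 2 * Ideal.absNorm R = p ^ 2 := by
    have h := absNorm_span_natCast p
    rw [hR, map_mul, map_mul, ← hPQ, hpP] at h
    rwa [pow_two] at h ⊢
  have hR1 : Ideal.absNorm R = 1 :=
    Nat.eq_of_mul_eq_mul_left (pow_pos hp.pos 2) (by rw [hNorm, mul_one])
  rw [Ideal.absNorm_eq_one_iff] at hR1
  rw [hR1, Ideal.mul_top] at hR
  rw [← hR, Ideal.dvd_span_singleton, Ideal.mem_span_singleton] at hd2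
  exact hα.2.2.1 p hp hd2

lemma omegaC_ne_one : omegaC ≠ 1 := by
  intro h
  have h2 := congrArg Complex.re h
  simp [omegaC] at h2
  norm_num at h2

lemma omegaC_sq_ne_one : omegaC ^ 2 ≠ 1 := by
  intro h
  apply omegaC_ne_one
  have := omegaC_cube
  rw [pow_succ, h, one_mul] at this
  exact this

/-- The symbol modulo a prime of degree one is nontrivial on rational integers. -/
lemma exists_primeSymbol_ne_one {P : Ideal EisInt} [hP : P.IsPrime] (h0 : P ≠ ⊥)
    (h3 : (3 : EisInt) ∉ P) {p : ℕ} (hp : p.Prime) (hN : Ideal.absNorm P = p) :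
    ∃ g : ℕ, primeSymbol P g ≠ 1 ∧ ¬ p ∣ g := by
  have hmax : P.IsMaximal := hP.isMaximal h0
  have : Fact p.Prime := ⟨hp⟩
  let F := EisInt ⧸ P
  let _ : Field F := Ideal.Quotient.field P
  have : Finite F := Ideal.finiteQuotientOfFreeOfNeBot P h0
  let _ : Fintype F := Fintype.ofFinite F
  have hcard : Fintype.card F = p := by
    rw [← hN, ← Nat.card_eq_fintype_card]; rfl
  let f : EisInt →+* F := Ideal.Quotient.mk P
  have hf : ∀ z, f z = 0 ↔ z ∈ P := fun z => Ideal.Quotient.eq_zero_iff_mem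
  have hpm : (p : EisInt) ∈ P := prime_mem_of_dvd_absNorm h0 hp (dvd_of_eq hN.symm)
  have hchar : CharP F p := by
    have : ringChar F ∣ p := ringChar.dvd (by
      have := (hf p).2 hpm
      rwa [map_natCast] at this)
    have h2 := (Nat.dvd_prime hp).1 this
    rcases h2 with h2 | h2
    · exact absurd h2 CharP.ringChar_ne_one
    · rw [← h2]; infer_instance
  obtain ⟨u, hu⟩ := IsCyclic.exists_generator (α := Fˣ)
  have hord : orderOf u = p - 1 := by
    rw [orderOf_eq_card_of_forall_mem_zpowers hu, Nat.card_units, Nat.card_eq_fintype_card, hcard]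
  have hw : f omega ≠ 1 := fun h => omega_sub_one_notMem h3 ((hf _).1 (by simp [h]))
  have hw3 : f omega ^ 3 = 1 := by rw [← map_pow, omega_cube, map_one]
  have hdvd : 3 ∣ p - 1 := by
    have hw0 : f omega ≠ 0 := by
      intro h; rw [h] at hw3; norm_num at hw3
    have h := orderOf_dvd_of_pow_eq_one (FiniteField.pow_card_sub_one_eq_one _ hw0)
    rwa [orderOf_eq_prime hw3 hw, hcard] at h
  have hp1 : 0 < p - 1 := Nat.sub_pos_of_lt hp.one_lt
  let e := ZMod.ringEquivOfPrime F hp hcard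
  set z : ZMod p := e.symm u
  have hz : ((z.val : ℕ) : F) = u := by
    have h1 : e z = u := e.apply_symm_apply _
    rw [← h1, ← map_natCast e, ZMod.natCast_zmod_val]
  have hgP : ((z.val : ℕ) : EisInt) ∉ P := by
    rw [← hf, map_natCast, hz]
    exact u.ne_zero
  refine ⟨z.val, ?_, ?_⟩
  · unfold primeSymbol
    rw [if_neg hgP, hN, if_neg]
    · split_ifs
      · exact omegaC_ne_one
      · exact omegaC_sq_ne_one
    · rw [← hf, map_sub, map_pow, map_natCast, hz, map_one, sub_eq_zero]
      intro h
      have h1 : u ^ ((p - 1) / 3) = 1 := Units.ext (by simpa using h)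
      have h2 := orderOf_dvd_of_pow_eq_one h1
      rw [hord] at h2
      have h3 : 0 < (p - 1) / 3 := Nat.div_pos (Nat.le_of_dvd hp1 hdvd) (by norm_num)
      have h4 := Nat.le_of_dvd h3 h2
      have h5 := Nat.div_lt_self hp1 (by norm_num : 1 < 3)
      omega
  · rintro ⟨c, hc⟩
    apply hgP
    rw [hc, Nat.cast_mul]
    exact P.mul_mem_right _ hpm

/-- If a prime `p` could be omitted from the conductor, `χ` would take the value `1` on every `x`
congruent to `1` modulo `q / p`. For such an `x` that is a cubic nonresidue modulo the prime ideal over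
`p`, however, `χ(x) ≠ 1`. -/
theorem cubicChar_isPrimitive (α : family) : (cubicChar α).IsPrimitive := by
  classical
  obtain ⟨α, hα⟩ := α
  set χ := cubicChar ⟨α, hα⟩ with hχ
  set s := normalizedFactors (Ideal.span {α}) with hs
  have h0 : Ideal.span {α} ≠ ⊥ := by simpa using family_ne_zero hα
  have hprod : nrm α = (s.map Ideal.absNorm).prod := by
    rw [← map_multiset_prod, Ideal.prod_normalizedFactors_eq_self h0, Ideal.absNorm_span_singleton,
      nrm]
  have hq0 : nrm α ≠ 0 := (lt_trans Nat.zero_lt_one hα.2.2.2).ne'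
  by_contra hcon
  rw [DirichletCharacter.isPrimitive_def] at hcon
  obtain ⟨k, hk⟩ := χ.conductor_dvd_level
  change nrm α = _ at hk
  have hk1 : k ≠ 1 := by
    rintro rfl
    exact hcon (by rw [mul_one] at hk; exact hk.symm)
  obtain ⟨p, hp, hpk⟩ := Nat.exists_prime_and_dvd hk1
  have hpq : p ∣ nrm α := hk ▸ hpk.mul_left _
  rw [hprod] at hpq
  obtain ⟨P, hP, hpP⟩ := hp.prime.exists_mem_multiset_map_dvd hpq
  obtain ⟨p', hp', hPp'⟩ := factor_norm_prime hα hP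
  have hpp : p = p' := (Nat.prime_dvd_prime_iff_eq hp hp').1 (hPp' ▸ hpP)
  subst hpp
  obtain ⟨t, ht⟩ := Multiset.exists_cons_of_mem hP
  have hnd := factors_nodup hα
  rw [← hs, ht, Multiset.nodup_cons] at hnd
  set m := (t.map Ideal.absNorm).prod with hm
  have hqm : nrm α = p * m := by rw [hprod, ht, Multiset.map_cons, Multiset.prod_cons, hPp']
  have hts : ∀ Q ∈ t, Q ∈ s := fun Q hQ => by rw [ht]; exact Multiset.mem_cons_of_mem hQ
  have hcop : p.Coprime m := by
    rw [hp.coprime_iff_not_dvd]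
    intro hd
    obtain ⟨Q, hQ, hpQ⟩ := hp.prime.exists_mem_multiset_map_dvd hd
    obtain ⟨q, hq, hQq⟩ := factor_norm_prime hα (hts Q hQ)
    have : p = q := (Nat.prime_dvd_prime_iff_eq hp hq).1 (hQq ▸ hpQ)
    have hPQ := factor_norm_injective hα hP (hts Q hQ) (by rw [hPp', hQq, this])
    exact hnd.1 (hPQ ▸ hQ)
  obtain ⟨p1, p2, p3, p4⟩ := factor_spec hα hP
  obtain ⟨g, hg1, hg2⟩ := exists_primeSymbol_ne_one p2 p3 hp hPp'
  obtain ⟨x, hxp, hxm⟩ := Nat.chineseRemainder hcop g 1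
  have hpm : (p : EisInt) ∈ P := prime_mem_of_dvd_absNorm p2 hp (dvd_of_eq hPp'.symm)
  have hcast : ∀ (Q : Ideal EisInt) (a b n : ℕ), (n : EisInt) ∈ Q → a ≡ b [MOD n] →
      ((a : EisInt) - b) ∈ Q := by
    intro Q a b n hn hab
    obtain ⟨c, hc⟩ := Nat.modEq_iff_dvd.1 hab.symm
    have hc' : (a : EisInt) - b = (n : EisInt) * (c : EisInt) := by
      exact_mod_cast congrArg (fun z : ℤ => (z : EisInt)) hc
    rw [hc']
    exact Q.mul_mem_right _ hn
  have hval : χ (x : ZMod (nrm α)) = primeSymbol P g := by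
    have h1 := cubicChar_natCast ⟨α, hα⟩ x
    rw [← hχ] at h1
    change χ (x : ZMod (nrm α)) = cubicSymbol α x at h1
    rw [h1, cubicSymbol, ← hs, ht, Multiset.map_cons, Multiset.prod_cons,
      primeSymbol_congr (hcast P x g p hpm hxp), Multiset.prod_eq_one, mul_one]
    intro y hy
    obtain ⟨Q, hQ, rfl⟩ := Multiset.mem_map.1 hy
    obtain ⟨q1, q2, q3, q4⟩ := factor_spec hα (hts Q hQ)
    have hmQ : (m : EisInt) ∈ Q := by
      have h2 : Ideal.absNorm Q ∣ m := Multiset.dvd_prod (Multiset.mem_map_of_mem _ hQ)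
      obtain ⟨c, hc⟩ := h2
      rw [hc, Nat.cast_mul]
      exact Q.mul_mem_right _ (Ideal.absNorm_mem Q)
    have h3 := primeSymbol_congr (hcast Q x 1 m hmQ hxm)
    rw [Nat.cast_one, primeSymbol_one] at h3
    exact h3
  have hxcop : x.Coprime (nrm α) := by
    rw [hqm]
    refine Nat.Coprime.mul_right ?_ ?_
    · rw [Nat.coprime_comm, hp.coprime_iff_not_dvd]
      intro hd
      exact hg2 ((Nat.ModEq.dvd_iff hxp dvd_rfl).1 hd)
    · have := hxm.gcd_eq
      rw [Nat.gcd_one_left] at this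
      exact this
  have hdm : χ.conductor ∣ m := by
    obtain ⟨c, hc⟩ := hpk
    refine ⟨c, Nat.eq_of_mul_eq_mul_left hp.pos ?_⟩
    refine hqm.symm.trans (hk.trans ?_)
    rw [hc]; ring
  have hfac := χ.factorsThrough_conductor
  have hone : χ (x : ZMod (nrm α)) = 1 := by
    obtain ⟨hd, χ₀, hχ₀⟩ := hfac
    have hxi : IsCoprime (x : ℤ) ((nrm α : ℕ) : ℤ) := Nat.isCoprime_iff_coprime.2 hxcop
    have h1 := χ₀.changeLevel_eq_cast_of_dvd' hd (a := (x : ℤ)) hxi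
    rw [← hχ₀] at h1
    have h2 : (((x : ℤ)) : ZMod χ.conductor) = 1 := by
      have := (ZMod.natCast_eq_natCast_iff x 1 χ.conductor).2 (hxm.of_dvd hdm)
      push_cast at this ⊢
      exact this
    rw [h2, map_one, Int.cast_natCast] at h1
    exact h1
  exact hg1 (hval ▸ hone)

lemma cubicChar_ne_one (α : family) : cubicChar α ≠ 1 := by
  intro h
  have h1 := cubicChar_isPrimitive α
  rw [DirichletCharacter.isPrimitive_def, h, DirichletCharacter.conductor_one] at h1
  have := α.2.2.2.2
  omega

end

/-! ### Counting Eisenstein integers -/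

section

open Filter Topology

/-- The Eisenstein integer `x + y ω`. -/
noncomputable def eis (x y : ℤ) : EisInt := x + y * omega

lemma exists_eis_basis : ∃ b : Module.Basis (Fin 2) ℤ EisInt, b 0 = 1 ∧ b 1 = omega := by
  set B := (IsCyclotomicExtension.zeta_spec 3 ℚ EisField).integralPowerBasis
  have hdim : B.dim = 2 := by
    rw [← finrank_eisInt]; exact B.finrank.symm
  refine ⟨B.basis.reindex (finCongr hdim), ?_, ?_⟩
  · simp
  · simp only [Module.Basis.reindex_apply, PowerBasis.basis_eq_pow]
    have : (((finCongr hdim).symm 1 : Fin B.dim) : ℕ) = 1 := by simp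
    rw [this, pow_one, IsPrimitiveRoot.integralPowerBasis_gen]
    rfl

lemma eis_surjective (α : EisInt) : ∃ x y : ℤ, α = eis x y := by
  obtain ⟨b, h0, h1⟩ := exists_eis_basis
  refine ⟨b.repr α 0, b.repr α 1, ?_⟩
  conv_lhs => rw [← b.sum_repr α]
  simp [h0, h1, eis]

lemma eis_injective {x y x' y' : ℤ} (h : eis x y = eis x' y') : x = x' ∧ y = y' := by
  obtain ⟨b, h0, h1⟩ := exists_eis_basis
  have hr : ∀ u v : ℤ, b.repr (eis u v) 0 = u ∧ b.repr (eis u v) 1 = v := by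
    intro u v
    have e : eis u v = u • b 0 + v • b 1 := by simp [eis, h0, h1]
    rw [e, map_add, map_smul, map_smul, b.repr_self, b.repr_self]
    simp
  have h2 := hr x y
  rw [h] at h2
  have h3 := hr x' y'
  exact ⟨h2.1.symm.trans h3.1, h2.2.symm.trans h3.2⟩

lemma nrm_eis (x y : ℤ) : (nrm (eis x y) : ℤ) = x ^ 2 - x * y + y ^ 2 := by
  obtain ⟨b, h0, h1⟩ := exists_eis_basis
  have hr : ∀ u v : ℤ, b.repr (eis u v) 0 = u ∧ b.repr (eis u v) 1 = v := by
    intro u v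
    have e : eis u v = u • b 0 + v • b 1 := by simp [eis, h0, h1]
    rw [e, map_add, map_smul, map_smul, b.repr_self, b.repr_self]
    simp
  have hmul : eis x y * omega = eis (-y) (x - y) := by
    simp only [eis]
    push_cast
    linear_combination (y : EisInt) * omega_quad
  have hnorm : Algebra.norm ℤ (eis x y) = x ^ 2 - x * y + y ^ 2 := by
    rw [Algebra.norm_eq_matrix_det b, Matrix.det_fin_two]
    simp only [Algebra.leftMulMatrix_eq_repr_mul, h0, h1, mul_one, hmul, hr]
    ring
  rw [nrm, hnorm]
  apply Int.natAbs_of_nonneg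
  nlinarith [sq_nonneg (x - y), sq_nonneg x, sq_nonneg y]

lemma nrm_mul (α β : EisInt) : nrm (α * β) = nrm α * nrm β := by
  simp [nrm, Int.natAbs_mul]

lemma nrm_eq_zero {α : EisInt} : nrm α = 0 ↔ α = 0 := by
  simp [nrm]

lemma nrm_natCast (n : ℕ) : nrm (n : EisInt) = n ^ 2 := by
  have := absNorm_span_natCast n
  rwa [Ideal.absNorm_span_singleton] at this

lemma dvd_nrm (α : EisInt) : α ∣ (nrm α : EisInt) :=
  Ideal.mem_span_singleton.1 (nrm_mem (Ideal.mem_span_singleton_self α))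

lemma natCast_dvd_eis {M : ℕ} {x y : ℤ} (h : (M : EisInt) ∣ eis x y) :
    (M : ℤ) ∣ x ∧ (M : ℤ) ∣ y := by
  obtain ⟨c, hc⟩ := h
  obtain ⟨u, v, rfl⟩ := eis_surjective c
  have : eis x y = eis (M * u) (M * v) := by
    rw [hc]; simp only [eis]; push_cast; ring
  obtain ⟨h1, h2⟩ := eis_injective this
  exact ⟨⟨u, h1⟩, ⟨v, h2⟩⟩

lemma card_Icc_ceil_floor_le {a b : ℝ} (hab : a ≤ b) :
    ((Finset.Icc ⌈a⌉ ⌊b⌋).card : ℝ) ≤ b - a + 1 := by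
  rw [Int.card_Icc]
  have h1 := Int.floor_le b
  have h2 := Int.le_ceil a
  rcases le_total 0 (⌊b⌋ + 1 - ⌈a⌉) with h | h
  · have : (((⌊b⌋ + 1 - ⌈a⌉).toNat : ℤ) : ℝ) = ((⌊b⌋ + 1 - ⌈a⌉ : ℤ) : ℝ) := by
      rw [Int.toNat_of_nonneg h]
    rw [Int.cast_natCast] at this
    rw [this]; push_cast; linarith
  · rw [Int.toNat_of_nonpos h]; push_cast; linarith

lemma le_card_Icc_ceil_floor (a b : ℝ) : b - a - 1 ≤ ((Finset.Icc ⌈a⌉ ⌊b⌋).card : ℝ) := by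
  rw [Int.card_Icc]
  have h1 := Int.lt_floor_add_one b
  have h2 := Int.ceil_lt_add_one a
  have h3 : ((⌊b⌋ + 1 - ⌈a⌉ : ℤ) : ℝ) ≤ ((⌊b⌋ + 1 - ⌈a⌉).toNat : ℝ) := by
    exact_mod_cast Int.self_le_toNat _
  push_cast at h3
  linarith

/-- The number of Eisenstein integers of bounded norm in a residue class. -/
lemma card_residue_le {M : ℕ} (hM : 0 < M) (β₀ : EisInt) {Z : ℝ} (hZ : 0 ≤ Z) (S : Finset EisInt)
    (hS : ∀ β ∈ S, (M : EisInt) ∣ β - β₀ ∧ (nrm β : ℝ) ≤ Z) :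
    (S.card : ℝ) ≤ 11 * Z / M ^ 2 + 2 := by
  classical
  obtain ⟨x₀, y₀, rfl⟩ := eis_surjective β₀
  have hM' : (0 : ℝ) < M := by exact_mod_cast hM
  set R := √(4 / 3 * Z) with hR
  have hR0 : 0 ≤ R := Real.sqrt_nonneg _
  have hRsq : R ^ 2 = 4 / 3 * Z := Real.sq_sqrt (by positivity)
  let f : ℤ × ℤ → EisInt := fun k => eis (x₀ + M * k.1) (y₀ + M * k.2)
  let I : ℤ → Finset ℤ := fun z => Finset.Icc ⌈(-R - z) / M⌉ ⌊(R - z) / M⌋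
  have hI : ∀ z : ℤ, ((I z).card : ℝ) ≤ 2 * R / M + 1 := by
    intro z
    have hle : (-R - z) / M ≤ (R - z) / M := by gcongr; linarith
    refine (card_Icc_ceil_floor_le hle).trans (le_of_eq ?_)
    field_simp; ring
  have hmem : ∀ z k : ℤ, ((z + M * k : ℤ) : ℝ) ^ 2 ≤ R ^ 2 → k ∈ I z := by
    intro z k h
    have h1 := abs_le.1 (abs_le_of_sq_le_sq h hR0)
    push_cast at h1
    rw [Finset.mem_Icc, Int.ceil_le, Int.le_floor, div_le_iff₀ hM', le_div_iff₀ hM']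
    constructor <;> linarith [h1.1, h1.2]
  have hsub : S ⊆ (I x₀ ×ˢ I y₀).image f := by
    intro β hβ
    obtain ⟨x, y, rfl⟩ := eis_surjective β
    obtain ⟨h1, h2⟩ := hS _ hβ
    have e : eis x y - eis x₀ y₀ = eis (x - x₀) (y - y₀) := by simp only [eis]; push_cast; ring
    rw [e] at h1
    obtain ⟨⟨u, hu⟩, ⟨v, hv⟩⟩ := natCast_dvd_eis h1
    have hx : x = x₀ + M * u := by linarith
    have hy : y = y₀ + M * v := by linarith
    have h3 : ((nrm (eis x y) : ℤ) : ℝ) = (x : ℝ) ^ 2 - x * y + y ^ 2 := by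
      rw [nrm_eis]; push_cast; ring
    rw [Int.cast_natCast] at h3
    rw [h3] at h2
    refine Finset.mem_image.2 ⟨(u, v), Finset.mem_product.2 ⟨hmem _ _ ?_, hmem _ _ ?_⟩, ?_⟩
    · rw [← hx, hRsq]
      nlinarith [sq_nonneg ((x : ℝ) - 2 * y)]
    · rw [← hy, hRsq]
      nlinarith [sq_nonneg ((y : ℝ) - 2 * x)]
    · simp only [f, hx, hy]
  have h1 : (S.card : ℝ) ≤ (I x₀).card * (I y₀).card := by
    have := (Finset.card_le_card hsub).trans Finset.card_image_le
    rw [Finset.card_product] at this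
    exact_mod_cast this
  have hq : 0 ≤ 2 * R / M + 1 := by positivity
  calc (S.card : ℝ) ≤ (2 * R / M + 1) * (2 * R / M + 1) := by
        refine h1.trans ?_
        gcongr
        · exact hI _
        · exact hI _
    _ ≤ 2 * (2 * R / M) ^ 2 + 2 := by nlinarith [sq_nonneg (2 * R / M - 1)]
    _ = 8 * R ^ 2 / M ^ 2 + 2 := by ring
    _ ≤ _ := by
        rw [hRsq]
        have h8 : 8 * (4 / 3 * Z) ≤ 11 * Z := by linarith
        linarith [div_le_div_of_nonneg_right h8 (by positivity : (0 : ℝ) ≤ (M : ℝ) ^ 2)]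

/-- The number of multiples of `δ` of bounded norm in the residue class of `1`. -/
lemma card_dvd_le {M : ℕ} (hM : 0 < M) {δ : EisInt} (hδ : δ ≠ 0) {Z : ℝ} (hZ : 0 ≤ Z)
    (S : Finset EisInt)
    (hS : ∀ α ∈ S, (M : EisInt) ∣ α - 1 ∧ δ ∣ α ∧ (nrm α : ℝ) ≤ Z) :
    (S.card : ℝ) ≤ 11 * Z / M ^ 2 * (1 / nrm δ) + 2 := by
  classical
  have hN : (0 : ℝ) < nrm δ := by
    exact_mod_cast Nat.pos_of_ne_zero fun h => hδ (nrm_eq_zero.1 h)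
  rcases S.eq_empty_or_nonempty with rfl | ⟨α₀, hα₀⟩
  · simp; positivity
  have hdiv : ∀ α ∈ S, ∃ β, α = δ * β := fun α hα => (hS α hα).2.1
  choose! q hq using hdiv
  have hinj : Set.InjOn q S := by
    intro a ha b hb hab
    rw [hq a ha, hq b hb, hab]
  rw [← Finset.card_image_of_injOn hinj]
  have h1 := card_residue_le hM (q α₀) (Z := Z / nrm δ) (by positivity) (S.image q) (by
    intro β hβ
    obtain ⟨α, hα, rfl⟩ := Finset.mem_image.1 hβ
    obtain ⟨h1, -, h3⟩ := hS α hα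
    obtain ⟨h1', -, -⟩ := hS α₀ hα₀
    constructor
    · -- `δ` is invertible modulo `M`, with inverse `q α₀`
      have e : q α - q α₀ = q α₀ * (α - 1) - q α * (α₀ - 1) := by
        have h4 := hq α hα
        have h5 := hq α₀ hα₀
        linear_combination -q α₀ * h4 + q α * h5
      rw [e]
      exact dvd_sub (h1.mul_left _) (h1'.mul_left _)
    · rw [le_div_iff₀ hN]
      have h4 : nrm α = nrm δ * nrm (q α) := by conv_lhs => rw [hq α hα, nrm_mul]
      rw [h4] at h3
      push_cast at h3
      linarith)
  refine h1.trans (le_of_eq ?_)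
  field_simp

lemma sq_add_sq_le_nrm (x y : ℤ) : (x : ℝ) ^ 2 + (y : ℝ) ^ 2 ≤ 2 * nrm (eis x y) := by
  have h3 : ((nrm (eis x y) : ℤ) : ℝ) = (x : ℝ) ^ 2 - x * y + y ^ 2 := by
    rw [nrm_eis]; push_cast; ring
  rw [Int.cast_natCast] at h3
  rw [h3]
  nlinarith [sq_nonneg ((x : ℝ) - y)]

lemma summable_inv_one_add_sq : Summable fun n : ℤ => (1 + (n : ℝ) ^ 2)⁻¹ := by
  have h1 : Summable fun n : ℕ => (1 + (n : ℝ) ^ 2)⁻¹ := by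
    rw [← summable_nat_add_iff 1]
    refine Summable.of_nonneg_of_le (fun n => by positivity) (fun n => ?_)
      ((summable_nat_add_iff 1).2 (Real.summable_nat_pow_inv.2 (by norm_num : 1 < 2)))
    gcongr
    linarith
  refine Summable.of_nat_of_neg ?_ ?_ <;>
  · refine h1.congr fun n => ?_
    simp

lemma summable_inv_nrm_sq : Summable fun α : EisInt => ((nrm α : ℝ) ^ 2)⁻¹ := by
  have h1 : Summable fun k : ℤ × ℤ => (1 + (k.1 : ℝ) ^ 2)⁻¹ * (1 + (k.2 : ℝ) ^ 2)⁻¹ :=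
    summable_inv_one_add_sq.mul_of_nonneg summable_inv_one_add_sq
      (fun _ => by positivity) (fun _ => by positivity)
  have hbij : Function.Bijective fun k : ℤ × ℤ => eis k.1 k.2 := by
    refine ⟨fun a b h => ?_, fun α => ?_⟩
    · obtain ⟨h1, h2⟩ := eis_injective h
      exact Prod.ext h1 h2
    · obtain ⟨x, y, rfl⟩ := eis_surjective α
      exact ⟨(x, y), rfl⟩
  rw [← (Equiv.ofBijective _ hbij).summable_iff]
  refine Summable.of_nonneg_of_le (fun _ => inv_nonneg.2 (sq_nonneg _)) (fun k => ?_) (h1.mul_left 9)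
  obtain ⟨x, y⟩ := k
  simp only [Function.comp, Equiv.ofBijective_apply]
  rcases Nat.eq_zero_or_pos (nrm (eis x y)) with h | h
  · rw [h]; simp; positivity
  · have h2 : (1 : ℝ) ≤ nrm (eis x y) := by exact_mod_cast h
    have h3 := sq_add_sq_le_nrm x y
    have h2' : (0 : ℝ) < nrm (eis x y) := by linarith
    have h4 : (1 + (x : ℝ) ^ 2) * (1 + (y : ℝ) ^ 2) ≤ (1 + (x : ℝ) ^ 2 + (y : ℝ) ^ 2) ^ 2 := by
      nlinarith [sq_nonneg (x : ℝ), sq_nonneg (y : ℝ), mul_nonneg (sq_nonneg (x : ℝ))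
        (sq_nonneg (y : ℝ))]
    have h5 : (1 + (x : ℝ) ^ 2 + (y : ℝ) ^ 2) ^ 2 ≤ (3 * nrm (eis x y)) ^ 2 := by
      gcongr; linarith
    have h6 : 0 < (1 + (x : ℝ) ^ 2) * (1 + (y : ℝ) ^ 2) := by positivity
    have h7 : 0 < (nrm (eis x y) : ℝ) ^ 2 := pow_pos h2' 2
    rw [← mul_inv, ← div_eq_mul_inv, inv_eq_one_div, div_le_div_iff₀ h7 h6]
    nlinarith

/-- The tail of a summable family of reals, ordered by an index function `g`, is eventually small. -/
lemma exists_tail_lt {ι : Type*} {f : ι → ℝ} (hf : Summable f) (g : ι → ℕ)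
    {ε : ℝ} (hε : 0 < ε) :
    ∃ P : ℕ, ∀ Q ≥ P, ∀ T : Finset ι, (∀ i ∈ T, Q < g i) → ∑ i ∈ T, f i < ε := by
  obtain ⟨F, hF⟩ := summable_iff_vanishing_norm.1 hf ε hε
  refine ⟨∑ i ∈ F, g i, fun Q hQ T hT => ?_⟩
  have hd : Disjoint T F := by
    rw [Finset.disjoint_left]
    intro i hi hiF
    have h1 := hT i hi
    have h2 := Finset.single_le_sum (f := g) (fun _ _ => Nat.zero_le _) hiF
    omega
  exact (le_abs_self _).trans_lt (hF T hd)

end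

/-! ### The size of the family -/

section

open Filter Topology

/-- The square `[r s, (r + η) s] × [0, η s]` lies in the region `t₁ s² ≤ x² - x y + y² ≤ t₂ s²`. -/
lemma annulus_bounds {t₁ t₂ r η s X x y : ℝ} (hd : 0 < t₂ - t₁) (hr0 : 0 < r) (hη0 : 0 < η)
    (hrsq : r ^ 2 = (t₁ + t₂) / 2) (hη1 : η ≤ r) (hη2 : η * r ≤ (t₂ - t₁) / 8) (hs0 : 0 < s)
    (hsX : s ^ 2 = X) (hx1 : r * s ≤ x) (hx2 : x ≤ (r + η) * s) (hy1 : 0 ≤ y) (hy2 : y ≤ η * s) :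
    t₁ * X ≤ x ^ 2 - x * y + y ^ 2 ∧ x ^ 2 - x * y + y ^ 2 ≤ t₂ * X := by
  have hrs : 0 ≤ r * s := by positivity
  have hx0 : 0 ≤ x := hrs.trans hx1
  have hxy : x * y ≤ (r + η) * s * (η * s) := by gcongr
  have hηr : η * η ≤ η * r := by gcongr
  have hxx1 : (r * s) ^ 2 ≤ x ^ 2 := by gcongr
  have hxx2 : x ^ 2 ≤ ((r + η) * s) ^ 2 := by gcongr
  have hyy : y ^ 2 ≤ (η * s) ^ 2 := by gcongr
  have hxy0 : 0 ≤ x * y := by positivity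
  have hs2 : 0 ≤ s ^ 2 := by positivity
  constructor
  · have e : t₁ * X ≤ (r * s) ^ 2 - (r + η) * s * (η * s) := by
      rw [← hsX]
      have : t₁ ≤ r ^ 2 - (r + η) * η := by rw [hrsq]; nlinarith
      calc t₁ * s ^ 2 ≤ (r ^ 2 - (r + η) * η) * s ^ 2 := by gcongr
        _ = _ := by ring
    nlinarith [sq_nonneg y]
  · have e : ((r + η) * s) ^ 2 + (η * s) ^ 2 ≤ t₂ * X := by
      rw [← hsX]
      have : (r + η) ^ 2 + η ^ 2 ≤ t₂ := by
        have : (r + η) ^ 2 + η ^ 2 = r ^ 2 + 2 * (η * r) + 2 * (η * η) := by ring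
        rw [this, hrsq]; linarith
      calc ((r + η) * s) ^ 2 + (η * s) ^ 2 = ((r + η) ^ 2 + η ^ 2) * s ^ 2 := by ring
        _ ≤ _ := by gcongr
    linarith

set_option maxHeartbeats 1000000 in
/-- A positive proportion of a thin annulus consists of members of the family: inside the class of
`1` modulo a suitable `M`, which disposes of all small divisors, the non-members are too few. -/
lemma exists_card_family_ge {t₁ t₂ : ℝ} (h1 : 0 < t₁) (h12 : t₁ < t₂) :
    ∃ c : ℝ, 0 < c ∧ ∀ᶠ X : ℝ in atTop, ∃ S : Finset EisInt, (c * X ≤ S.card) ∧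
      ∀ α ∈ S, α ∈ family ∧ t₁ * X ≤ nrm α ∧ (nrm α : ℝ) ≤ t₂ * X := by
  classical
  have ht2 : 0 < t₂ := h1.trans h12
  set d := t₂ - t₁ with hd
  have hd0 : 0 < d := by rw [hd]; linarith
  set r := √((t₁ + t₂) / 2) with hr
  have hr0 : 0 < r := Real.sqrt_pos.2 (by linarith)
  have hrsq : r ^ 2 = (t₁ + t₂) / 2 := Real.sq_sqrt (by linarith)
  set η := min r (d / (8 * r)) with hη
  have hη0 : 0 < η := lt_min hr0 (by positivity)
  have hη1 : η ≤ r := min_le_left _ _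
  have hη2 : η * r ≤ d / 8 := by
    have : η ≤ d / (8 * r) := min_le_right _ _
    calc η * r ≤ d / (8 * r) * r := by gcongr
      _ = d / 8 := by field_simp
  -- the density of candidates is `η² / M²`; multiples of large `δ` will have density `≤ η² / (8 M²)`
  set ε := η ^ 2 / (200 * t₂) with hε
  have hε0 : 0 < ε := by positivity
  obtain ⟨P₁, hP₁⟩ := exists_tail_lt summable_inv_nrm_sq nrm hε0
  obtain ⟨P₂, hP₂⟩ := exists_tail_lt (Real.summable_nat_pow_inv.2 (by norm_num : 1 < 2))
    (id : ℕ → ℕ) hε0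
  set P := max P₁ P₂ with hP
  set M := 3 * P.factorial with hMdef
  have hM : 0 < M := by positivity
  have hM' : (0 : ℝ) < M := by exact_mod_cast hM
  have hM1 : (1 : ℝ) ≤ M := by exact_mod_cast hM
  have hsmall : ∀ n : ℕ, 0 < n → n ≤ P → n ∣ M := fun n h0 hn =>
    (Nat.dvd_factorial h0 hn).mul_left 3
  refine ⟨η ^ 2 / (8 * M ^ 2), by positivity, ?_⟩
  have hev : ∀ᶠ X : ℝ in atTop, 4 * M / η ≤ √X ∧
      8 * M ^ 2 * (4 * √t₂ + 22 * √t₂ + 20) / η ^ 2 ≤ √X ∧ 2 / √t₁ ≤ √X ∧ 1 ≤ √X :=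
    ((Real.tendsto_sqrt_atTop.eventually_ge_atTop _).and
      ((Real.tendsto_sqrt_atTop.eventually_ge_atTop _).and
        ((Real.tendsto_sqrt_atTop.eventually_ge_atTop _).and
          (Real.tendsto_sqrt_atTop.eventually_ge_atTop _))))
  filter_upwards [hev, eventually_gt_atTop 0] with X ⟨hX1, hX2, hX3, hX4⟩ hX0
  set s := √X with hs
  have hs0 : 0 < s := by linarith
  have hsX : s ^ 2 = X := Real.sq_sqrt hX0.le
  set I := Finset.Icc ⌈(r * s - 1) / M⌉ ⌊((r + η) * s - 1) / M⌋ with hI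
  set J := Finset.Icc ⌈(0 : ℝ)⌉ ⌊η * s / M⌋ with hJ
  let f : ℤ × ℤ → EisInt := fun k => eis (1 + M * k.1) (M * k.2)
  have hf : Function.Injective f := by
    intro a b hab
    obtain ⟨h1, h2⟩ := eis_injective hab
    have hMz : (M : ℤ) ≠ 0 := by exact_mod_cast hM.ne'
    exact Prod.ext (mul_left_cancel₀ hMz (by linarith)) (mul_left_cancel₀ hMz h2)
  set A := (I ×ˢ J).image f with hA
  set Y := η * s / M with hY
  have hY4 : 4 ≤ Y := by
    rw [hY, le_div_iff₀ hM']
    rw [div_le_iff₀ hη0] at hX1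
    linarith
  have hAcard : Y ^ 2 / 2 ≤ A.card := by
    rw [hA, Finset.card_image_of_injective _ hf, Finset.card_product]
    have hi := le_card_Icc_ceil_floor ((r * s - 1) / M) (((r + η) * s - 1) / M)
    have hj := le_card_Icc_ceil_floor 0 (η * s / M)
    have e : ((r + η) * s - 1) / M - (r * s - 1) / M - 1 = Y - 1 := by rw [hY]; ring
    rw [e, ← hI] at hi
    rw [sub_zero, ← hY, ← hJ] at hj
    push_cast
    calc Y ^ 2 / 2 ≤ (Y - 1) * (Y - 1) := by nlinarith
      _ ≤ _ := by
        have : 0 ≤ Y - 1 := by linarith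
        gcongr
  have hAprop : ∀ α ∈ A, (M : EisInt) ∣ α - 1 ∧ t₁ * X ≤ nrm α ∧ (nrm α : ℝ) ≤ t₂ * X := by
    intro α hα
    obtain ⟨⟨i, j⟩, hij, rfl⟩ := Finset.mem_image.1 hα
    obtain ⟨hi, hj⟩ := Finset.mem_product.1 hij
    rw [hI, Finset.mem_Icc, Int.ceil_le, Int.le_floor, div_le_iff₀ hM', le_div_iff₀ hM'] at hi
    rw [hJ, Finset.mem_Icc, Int.ceil_le, Int.le_floor, le_div_iff₀ hM'] at hj
    simp only at hi hj
    refine ⟨⟨eis i j, ?_⟩, ?_⟩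
    · simp only [f, eis]; push_cast; ring
    · have h3 : ((nrm (f (i, j)) : ℤ) : ℝ) = (1 + M * i : ℝ) ^ 2 - (1 + M * i) * (M * j)
          + (M * j) ^ 2 := by
        simp only [f]
        rw [nrm_eis]; push_cast; ring
      rw [Int.cast_natCast] at h3
      rw [h3]
      have hx1 : r * s ≤ 1 + M * i := by linarith
      have hx2 : 1 + M * i ≤ (r + η) * s := by linarith
      have hy1 : (0 : ℝ) ≤ M * j := mul_nonneg hM'.le hj.1
      have hy2 : (M : ℝ) * j ≤ η * s := by linarith
      exact annulus_bounds (hd ▸ hd0) hr0 hη0 hrsq hη1 (hd ▸ hη2) hs0 hsX hx1 hx2 hy1 hy2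
  -- the candidates outside the family have a divisor `π²`, or a rational divisor `n`, of large norm
  set U := t₂ * X with hU
  have hU0 : 0 ≤ U := by positivity
  have hsqU : √U = √t₂ * s := by rw [hU, Real.sqrt_mul ht2.le]
  have hfinN : {π : EisInt | (nrm π : ℝ) ≤ √U}.Finite := by
    by_contra hinf
    obtain ⟨t, ht, htc⟩ := (Set.not_finite.1 hinf).exists_subset_card_eq (⌈11 * √U + 2⌉₊ + 1)
    have h := card_residue_le (M := 1) one_pos 0 (Real.sqrt_nonneg U) t (fun β hβ => by
      simpa using ht hβ)
    rw [htc] at h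
    push_cast at h
    have := Nat.le_ceil (11 * √U + 2)
    norm_num at h
    linarith
  set T := hfinN.toFinset.filter (fun π => P < nrm π) with hT
  have hTcard : (T.card : ℝ) ≤ 11 * √U + 2 := by
    have := card_residue_le (M := 1) one_pos 0 (Real.sqrt_nonneg U) T (fun β hβ => by
      have := (Finset.mem_filter.1 hβ).1
      simpa using this)
    simpa using this
  set Nn := (Finset.range (⌊√U⌋₊ + 1)).filter (fun n => P < n) with hNn
  have hNcard : (Nn.card : ℝ) ≤ √U + 1 := by
    have h := Finset.card_filter_le (Finset.range (⌊√U⌋₊ + 1)) (fun n => P < n)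
    rw [Finset.card_range] at h
    have h2 := Nat.floor_le (Real.sqrt_nonneg U)
    have h3 : ((Nn.card : ℕ) : ℝ) ≤ ((⌊√U⌋₊ + 1 : ℕ) : ℝ) := by exact_mod_cast h
    push_cast at h3
    linarith
  have hunit : ∀ α ∈ A, ∀ δ n, δ ∣ α → n = nrm δ → n ≠ 0 → n ≤ P → IsUnit δ := by
    intro α hα δ n h1 h2 h3 h4
    have hδM : δ ∣ (M : EisInt) := by
      refine (dvd_nrm δ).trans ?_
      rw [← h2]
      exact_mod_cast Nat.cast_dvd_cast (α := EisInt) (hsmall n (Nat.pos_of_ne_zero h3) h4)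
    have h5 : δ ∣ α - (α - 1) := dvd_sub h1 (hδM.trans (hAprop α hα).1)
    rw [sub_sub_cancel] at h5
    exact isUnit_of_dvd_one h5
  set bad := A.filter (fun α => α ∉ family) with hbad
  have hsub : bad ⊆ T.biUnion (fun π => A.filter (fun α => π * π ∣ α)) ∪
      Nn.biUnion (fun n => A.filter (fun α => (n : EisInt) ∣ α)) := by
    intro α hα
    obtain ⟨hαA, hαf⟩ := Finset.mem_filter.1 hα
    obtain ⟨hα1, hα2, hα3⟩ := hAprop α hαA
    have hα0 : (1 : ℝ) < nrm α := by
      have h3 : 4 ≤ t₁ * X := by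
        rw [div_le_iff₀ (Real.sqrt_pos.2 h1)] at hX3
        rw [← hsX]
        have h4 : √t₁ ^ 2 = t₁ := Real.sq_sqrt h1.le
        rw [← h4]
        nlinarith
      linarith
    have hα00 : 1 < nrm α := by exact_mod_cast hα0
    have h3 : (3 : EisInt) ∣ α - 1 := by
      refine dvd_trans ?_ hα1
      rw [hMdef]; push_cast; exact dvd_mul_right _ _
    have hnrmle : ∀ δ : EisInt, δ ∣ α → nrm δ ≤ nrm α := by
      rintro δ ⟨c, hc⟩
      refine Nat.le_of_dvd (by omega) ⟨nrm c, ?_⟩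
      rw [hc, nrm_mul]
    have hne0 : ∀ δ : EisInt, δ ∣ α → nrm δ ≠ 0 := by
      rintro δ ⟨c, hc⟩ h0
      rw [hc, nrm_mul, h0, zero_mul] at hα00
      omega
    rw [Finset.mem_union]
    by_cases hsqf : Squarefree α
    · right
      have : ∃ p : ℕ, p.Prime ∧ (p : EisInt) ∣ α := by
        by_contra! hcon
        exact hαf ⟨h3, hsqf, hcon, hα00⟩
      obtain ⟨p, hp, hpα⟩ := this
      have hple : p ^ 2 ≤ nrm α := by rw [← nrm_natCast]; exact hnrmle _ hpα
      refine Finset.mem_biUnion.2 ⟨p, Finset.mem_filter.2 ⟨?_, ?_⟩, Finset.mem_filter.2 ⟨hαA, hpα⟩⟩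
      · rw [Finset.mem_range, Nat.lt_succ_iff]
        apply Nat.le_floor
        apply Real.le_sqrt_of_sq_le
        have : ((p ^ 2 : ℕ) : ℝ) ≤ nrm α := by exact_mod_cast hple
        push_cast at this
        linarith
      · by_contra hle
        have hdM : (p : EisInt) ∣ (M : EisInt) :=
          Nat.cast_dvd_cast (hsmall p hp.pos (not_lt.1 hle))
        have h5 : (p : EisInt) ∣ α - (α - 1) := dvd_sub hpα (hdM.trans hα1)
        rw [sub_sub_cancel] at h5
        obtain ⟨c, hc⟩ := h5
        have h6 := congrArg nrm hc
        rw [nrm_mul, nrm_natCast] at h6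
        have h7 : nrm 1 = 1 := by simp [nrm]
        rw [h7] at h6
        have h8 := Nat.eq_one_of_mul_eq_one_right h6.symm
        have := hp.one_lt
        nlinarith
    · left
      obtain ⟨π, hπ, hπu⟩ : ∃ π : EisInt, π * π ∣ α ∧ ¬ IsUnit π := by
        simpa [Squarefree] using hsqf
      have hπα : π ∣ α := (dvd_mul_right π π).trans hπ
      refine Finset.mem_biUnion.2 ⟨π, Finset.mem_filter.2 ⟨?_, ?_⟩, Finset.mem_filter.2 ⟨hαA, hπ⟩⟩
      · rw [hfinN.mem_toFinset]
        apply Real.le_sqrt_of_sq_le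
        have h4 := hnrmle _ hπ
        rw [nrm_mul] at h4
        have h5 : ((nrm π * nrm π : ℕ) : ℝ) ≤ nrm α := by exact_mod_cast h4
        push_cast at h5
        nlinarith
      · by_contra hle
        exact hπu (hunit α hαA π _ hπα rfl (hne0 π hπα) (not_lt.1 hle))
  have hb1 : ∀ π ∈ T, ((A.filter (fun α => π * π ∣ α)).card : ℝ)
      ≤ 11 * U / M ^ 2 * ((nrm π : ℝ) ^ 2)⁻¹ + 2 := by
    intro π hπ
    have hπ0 : π ≠ 0 := by
      rintro rfl
      have := (Finset.mem_filter.1 hπ).2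
      simp [nrm] at this
    have h := card_dvd_le hM (mul_ne_zero hπ0 hπ0) hU0 (A.filter (fun α => π * π ∣ α))
      (fun α hα => ⟨(hAprop α (Finset.mem_filter.1 hα).1).1, (Finset.mem_filter.1 hα).2,
        (hAprop α (Finset.mem_filter.1 hα).1).2.2⟩)
    rw [nrm_mul] at h
    refine h.trans (le_of_eq ?_)
    simp only [Nat.cast_mul, one_div, pow_two]
  have hb2 : ∀ n ∈ Nn, ((A.filter (fun α => (n : EisInt) ∣ α)).card : ℝ)
      ≤ 11 * U / M ^ 2 * ((n : ℝ) ^ 2)⁻¹ + 2 := by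
    intro n hn
    have hn0 : n ≠ 0 := by
      rintro rfl
      have := (Finset.mem_filter.1 hn).2
      omega
    have h := card_dvd_le hM (Nat.cast_ne_zero.2 hn0) hU0 (A.filter (fun α => (n : EisInt) ∣ α))
      (fun α hα => ⟨(hAprop α (Finset.mem_filter.1 hα).1).1, (Finset.mem_filter.1 hα).2,
        (hAprop α (Finset.mem_filter.1 hα).1).2.2⟩)
    rw [nrm_natCast] at h
    refine h.trans (le_of_eq ?_)
    push_cast
    rw [one_div]
  have hs1 : ∑ π ∈ T, ((nrm π : ℝ) ^ 2)⁻¹ < ε :=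
    hP₁ P (le_max_left _ _) T fun π hπ => (Finset.mem_filter.1 hπ).2
  have hs2 : ∑ n ∈ Nn, ((n : ℝ) ^ 2)⁻¹ < ε :=
    hP₂ P (le_max_right _ _) Nn fun n hn => (Finset.mem_filter.1 hn).2
  have hbadcard : (bad.card : ℝ) ≤ 22 * U / M ^ 2 * ε + 2 * (12 * √U + 3) := by
    have hc1 : (bad.card : ℝ) ≤ ∑ π ∈ T, ((A.filter (fun α => π * π ∣ α)).card : ℝ)
        + ∑ n ∈ Nn, ((A.filter (fun α => (n : EisInt) ∣ α)).card : ℝ) := by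
      have h1 := (Finset.card_le_card hsub).trans (Finset.card_union_le _ _)
      have h2 := h1.trans (add_le_add Finset.card_biUnion_le Finset.card_biUnion_le)
      exact_mod_cast h2
    have hc2 := Finset.sum_le_sum hb1
    have hc3 := Finset.sum_le_sum hb2
    rw [Finset.sum_add_distrib, ← Finset.mul_sum, Finset.sum_const, nsmul_eq_mul] at hc2 hc3
    have hk : 0 ≤ 11 * U / M ^ 2 := by positivity
    have hc4 := mul_le_mul_of_nonneg_left hs1.le hk
    have hc5 := mul_le_mul_of_nonneg_left hs2.le hk
    have e : 22 * U / M ^ 2 * ε = 11 * U / M ^ 2 * ε + 11 * U / M ^ 2 * ε := by ring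
    rw [e]
    linarith
  refine ⟨A.filter (fun α => α ∈ family), ?_, fun α hα => ?_⟩
  · have hsplit : (A.card : ℝ) = (A.filter (fun α => α ∈ family)).card + bad.card := by
      rw [hbad]
      exact_mod_cast (Finset.card_filter_add_card_filter_not (s := A) (fun α => α ∈ family)).symm
    have hYX : Y ^ 2 = η ^ 2 * X / M ^ 2 := by rw [hY, ← hsX]; ring
    have hm : 22 * U / M ^ 2 * ε = 22 / 200 * (η ^ 2 * X / M ^ 2) := by
      rw [hU, hε]; field_simp
    have herr : 2 * (12 * √U + 3) ≤ η ^ 2 * X / (8 * M ^ 2) := by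
      rw [hsqU, le_div_iff₀ (by positivity), ← hsX]
      rw [div_le_iff₀ (by positivity)] at hX2
      have h5 : 2 * (12 * (√t₂ * s) + 3) ≤ (4 * √t₂ + 22 * √t₂ + 20) * s := by
        have : 0 ≤ √t₂ * s := by positivity
        nlinarith
      calc 2 * (12 * (√t₂ * s) + 3) * (8 * M ^ 2)
          ≤ (4 * √t₂ + 22 * √t₂ + 20) * s * (8 * M ^ 2) := by gcongr
        _ = 8 * M ^ 2 * (4 * √t₂ + 22 * √t₂ + 20) * s := by ring
        _ ≤ s * η ^ 2 * s := by gcongr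
        _ = _ := by ring
    have e1 : η ^ 2 * X / (8 * M ^ 2) = 1 / 8 * (η ^ 2 * X / M ^ 2) := by field_simp
    have e2 : η ^ 2 / (8 * M ^ 2) * X = 1 / 8 * (η ^ 2 * X / M ^ 2) := by field_simp
    have hpos : 0 ≤ η ^ 2 * X / M ^ 2 := by positivity
    rw [e2]
    rw [hYX] at hAcard
    rw [hm] at hbadcard
    rw [e1] at herr
    linarith
  · obtain ⟨h1, h2⟩ := Finset.mem_filter.1 hα
    exact ⟨h2, (hAprop α h1).2⟩

end

/-! ### `L(s, χ)` to the right of the critical line -/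

section

open Complex Set Filter Topology MeasureTheory

lemma norm_sum_range_le_of_periodic {f : ℕ → ℂ} {N : ℕ} (hN : 0 < N) (hper : ∀ k, f (N + k) = f k)
    (h0 : ∑ k ∈ Finset.range N, f k = 0) (h1 : ∀ k, ‖f k‖ ≤ 1) (n : ℕ) :
    ‖∑ k ∈ Finset.range n, f k‖ ≤ N := by
  induction n using Nat.strong_induction_on with
  | _ n ih =>
    rcases lt_or_ge n N with h | h
    · refine (norm_sum_le_of_le _ fun k _ => h1 k).trans ?_
      simpa using h.le
    · obtain ⟨m, rfl⟩ := Nat.exists_eq_add_of_le h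
      rw [Finset.sum_range_add, h0, zero_add]
      simp_rw [hper]
      exact ih m (by omega)

variable {N : ℕ} [NeZero N]

lemma norm_sum_Icc_dirichlet_le {χ : DirichletCharacter ℂ N} (hχ : χ ≠ 1) (n : ℕ) :
    ‖∑ k ∈ Finset.Icc 1 n, χ (k : ZMod N)‖ ≤ 2 * N := by
  have hN : 0 < N := NeZero.pos N
  have h0 : ∑ k ∈ Finset.range N, χ (k : ZMod N) = 0 := by
    rw [← MulChar.sum_eq_zero_of_ne_one hχ]
    refine Finset.sum_nbij' (fun k => (k : ZMod N)) ZMod.val (fun _ _ => Finset.mem_univ _)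
      (fun a _ => Finset.mem_range.2 (ZMod.val_lt a)) (fun k hk => ?_) (fun a _ => by simp)
      (fun _ _ => rfl)
    exact ZMod.val_cast_of_lt (Finset.mem_range.1 hk)
  have h := norm_sum_range_le_of_periodic (f := fun k => χ (k : ZMod N)) hN (fun k => by simp) h0
    (fun k => χ.norm_le_one _) (n + 1)
  rw [Nat.range_succ_eq_Icc_zero, ← Finset.insert_Icc_add_one_left_eq_Icc n.zero_le,
    Finset.sum_insert (by simp)] at h
  have h2 := χ.norm_le_one ((0 : ℕ) : ZMod N)
  have hN1 : (1 : ℝ) ≤ N := by exact_mod_cast hN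
  have h3 := norm_sub_le (χ ((0 : ℕ) : ZMod N) + ∑ k ∈ Finset.Icc (0 + 1) n, χ (k : ZMod N))
    (χ ((0 : ℕ) : ZMod N))
  rw [add_sub_cancel_left] at h3
  simp only [zero_add] at h3 h
  linarith

/-- Partial summation bounds `L(s, χ)` linearly in the conductor on `Re s ≥ 1/2`. -/
lemma norm_LFunction_le_of_half_le {χ : DirichletCharacter ℂ N} (hχ : χ ≠ 1) {s : ℂ}
    (hs : 1 / 2 ≤ s.re) : ‖χ.LFunction s‖ ≤ 4 * N * ‖s‖ := by
  set S : ℝ → ℂ := fun t => ∑ k ∈ Finset.Icc 1 ⌊t⌋₊, χ (k : ZMod N) with hS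
  have hSb : ∀ t, ‖S t‖ ≤ 2 * N := fun t => norm_sum_Icc_dirichlet_le hχ _
  have hSm : Measurable S :=
    (measurable_from_nat (f := fun n : ℕ => ∑ k ∈ Finset.Icc 1 n, χ (k : ZMod N))).comp
      Nat.measurable_floor
  have hS0 : ∀ t < 1, S t = 0 := fun t ht => by
    simp [hS, Nat.floor_eq_zero.2 ht]
  have hloc : LocallyIntegrableOn S (Ioi 0) :=
    ((locallyIntegrable_const (2 * N : ℝ)).mono hSm.aestronglyMeasurable
      (ae_of_all _ fun t => (hSb t).trans (le_abs_self _))).locallyIntegrableOn _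
  have hmel : ∀ z : ℂ, mellin S (-z)
      = ∫ t in Ioi (1 : ℝ), S t * (t : ℂ) ^ (-(z + 1)) := by
    intro z
    rw [mellin]
    have e : ∀ t : ℝ, (t : ℂ) ^ (-z - 1) • S t = S t * (t : ℂ) ^ (-(z + 1)) := fun t => by
      rw [smul_eq_mul, mul_comm]; ring_nf
    simp_rw [e]
    rw [← integral_Ici_eq_integral_Ioi (x := (1 : ℝ))]
    refine setIntegral_eq_of_subset_of_forall_sdiff_eq_zero measurableSet_Ioi
      (Set.Ici_subset_Ioi.2 one_pos) (fun t ht => ?_)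
    rw [hS0 t (not_le.1 ht.2), zero_mul]
  have hdiff : DifferentiableOn ℂ (fun z => z * mellin S (-z)) {z | 0 < z.re} := by
    intro z hz
    have hz' : 0 < z.re := hz
    have h1 : DifferentiableAt ℂ (mellin S) (-z) := by
      refine mellin_differentiableAt_of_isBigO_rpow (a := 0) (b := -z.re - 1) hloc ?_
        (by simpa using hz') ?_ (by simp)
      · simp only [neg_zero, Real.rpow_zero]
        exact Asymptotics.IsBigO.of_bound (2 * N) (Eventually.of_forall fun t => by
          simpa using hSb t)
      · refine Asymptotics.IsBigO.of_bound 1 ?_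
        have : ∀ᶠ t : ℝ in 𝓝[>] 0, t < 1 :=
          nhdsWithin_le_nhds (eventually_lt_nhds (by norm_num))
        filter_upwards [this] with t ht
        rw [hS0 t ht]; simp
    exact (differentiableAt_id.mul (h1.comp z differentiableAt_id.neg)).differentiableWithinAt
  have hopen : IsOpen {z : ℂ | 0 < z.re} := isOpen_lt continuous_const continuous_re
  have hLd : Differentiable ℂ χ.LFunction := DirichletCharacter.differentiable_LFunction hχ
  have heq : EqOn χ.LFunction (fun z => z * mellin S (-z)) {z | 0 < z.re} := by
    refine AnalyticOnNhd.eqOn_of_preconnected_of_eventuallyEq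
      (hLd.differentiableOn.analyticOnNhd hopen) (hdiff.analyticOnNhd hopen)
      (convex_halfSpace_re_gt 0).isPreconnected (z₀ := 2) (by simp) ?_
    have h2 : ∀ᶠ z : ℂ in 𝓝 2, 1 < z.re :=
      (isOpen_lt continuous_const continuous_re).mem_nhds (by simp)
    filter_upwards [h2] with z hz
    rw [χ.LFunction_eq_LSeries hz, hmel]
    refine LSeries_eq_mul_integral _ le_rfl (by linarith) (χ.LSeriesSummable_of_one_lt_re hz) ?_
    simp only [Real.rpow_zero]
    exact Asymptotics.IsBigO.of_bound (2 * N) (Eventually.of_forall fun n => by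
      simpa using norm_sum_Icc_dirichlet_le hχ n)
  have hs0 : 0 < s.re := by linarith
  rw [heq hs0]
  simp only [hmel, norm_mul]
  have hint : ‖∫ t in Ioi (1 : ℝ), S t * (t : ℂ) ^ (-(s + 1))‖ ≤ 4 * N := by
    calc ‖∫ t in Ioi (1 : ℝ), S t * (t : ℂ) ^ (-(s + 1))‖
        ≤ ∫ t in Ioi (1 : ℝ), 2 * N * t ^ (-(s.re + 1)) := by
          refine norm_integral_le_of_norm_le ?_ ?_
          · exact (integrableOn_Ioi_rpow_of_lt (by linarith) one_pos).const_mul _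
          · filter_upwards [ae_restrict_mem measurableSet_Ioi] with t ht
            have ht0 : 0 < t := lt_trans one_pos ht
            rw [norm_mul, norm_cpow_eq_rpow_re_of_pos ht0]
            simp only [neg_re, add_re, one_re]
            gcongr
            exact hSb t
      _ = 2 * N * s.re⁻¹ := by
          rw [integral_const_mul, integral_Ioi_rpow_of_lt (by linarith) one_pos]
          simp
      _ ≤ 4 * N := by
          have : s.re⁻¹ ≤ 2 := by
            rw [inv_le_comm₀ hs0 (by norm_num)]; linarith
          have hN0 : (0 : ℝ) ≤ N := Nat.cast_nonneg _
          nlinarith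
  calc ‖s‖ * _ ≤ ‖s‖ * (4 * N) := by gcongr
    _ = _ := by ring

/-! ### Sums against the weight -/

lemma exists_weight_bound (w : 𝓢(ℝ, ℝ)) (k : ℕ) : ∃ C : ℝ, 0 < C ∧ ∀ t, |t| ^ k * |w t| ≤ C := by
  obtain ⟨C, hC0, hC⟩ := w.decay k 0
  exact ⟨C, hC0, fun t => by simpa using hC t⟩

lemma one_le_nrm (α : family) : (1 : ℝ) ≤ nrm α.1 := by
  have := α.2.2.2.2
  exact_mod_cast this.le

lemma summable_family_inv_sq : Summable fun α : family => ((nrm α.1 : ℝ) ^ 2)⁻¹ :=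
  summable_inv_nrm_sq.comp_injective Subtype.val_injective

/-- A majorant for `w(N(α)/X) N(α)^m`, summable over the family. -/
lemma exists_weight_majorant (w : 𝓢(ℝ, ℝ)) {X : ℝ} (hX : 0 < X) (m : ℕ) :
    ∃ C : ℝ, 0 < C ∧ ∀ α : family,
      |w ((nrm α.1 : ℝ) / X)| * (nrm α.1 : ℝ) ^ m ≤ C * ((nrm α.1 : ℝ) ^ 2)⁻¹ := by
  obtain ⟨C, hC0, hC⟩ := exists_weight_bound w (m + 2)
  refine ⟨C * X ^ (m + 2), by positivity, fun α => ?_⟩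
  have h1 := one_le_nrm α
  have h0 : (0 : ℝ) < nrm α.1 := by linarith
  have h2 := hC ((nrm α.1 : ℝ) / X)
  rw [abs_of_nonneg (a := (nrm α.1 : ℝ) / X) (by positivity), div_pow, div_mul_eq_mul_div,
    div_le_iff₀ (by positivity)] at h2
  rw [← div_eq_mul_inv, le_div_iff₀ (by positivity)]
  calc _ = (nrm α.1 : ℝ) ^ (m + 2) * |w ((nrm α.1 : ℝ) / X)| := by ring
    _ ≤ _ := h2

lemma summable_weight_mul (w : 𝓢(ℝ, ℝ)) {X : ℝ} (hX : 0 < X) {g : family → ℂ} {A : ℝ} {m : ℕ}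
    (hg : ∀ α : family, w ((nrm α.1 : ℝ) / X) ≠ 0 → ‖g α‖ ≤ A * (nrm α.1 : ℝ) ^ m) :
    Summable fun α : family => (w ((nrm α.1 : ℝ) / X) : ℂ) * g α := by
  obtain ⟨C, hC0, hC⟩ := exists_weight_majorant w hX m
  refine Summable.of_norm_bounded ((summable_family_inv_sq.mul_left C).mul_left |A|) fun α => ?_
  rw [norm_mul, norm_real, Real.norm_eq_abs]
  by_cases hw : w ((nrm α.1 : ℝ) / X) = 0
  · rw [hw, abs_zero, zero_mul]; positivity
  · calc _ ≤ |w ((nrm α.1 : ℝ) / X)| * (|A| * (nrm α.1 : ℝ) ^ m) := by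
          gcongr
          refine (hg α hw).trans ?_
          gcongr
          exact le_abs_self A
      _ = |A| * (|w ((nrm α.1 : ℝ) / X)| * (nrm α.1 : ℝ) ^ m) := by ring
      _ ≤ _ := mul_le_mul_of_nonneg_left (hC α) (abs_nonneg A)

lemma summable_weight (w : 𝓢(ℝ, ℝ)) {X : ℝ} (hX : 0 < X) :
    Summable fun α : family => w ((nrm α.1 : ℝ) / X) := by
  have := summable_weight_mul w hX (g := fun _ => 1) (A := 1) (m := 0) (by simp)
  simp only [mul_one] at this
  exact_mod_cast this

/-- The total weight has order at least `X`. -/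
lemma exists_mul_le_totalWeight {w : 𝓢(ℝ, ℝ)} (hw_even : ∀ t : ℝ, w (-t) = w t)
    (hw_nonneg : ∀ t : ℝ, 0 ≤ w t) (hw_ne : w ≠ 0) :
    ∃ c : ℝ, 0 < c ∧ ∀ᶠ X : ℝ in atTop, c * X ≤ totalWeight w X := by
  obtain ⟨t₀, ht₀, hwt₀⟩ : ∃ t₀ : ℝ, 0 < t₀ ∧ 0 < w t₀ := by
    by_contra! h
    apply hw_ne
    have hz : ∀ t : ℝ, t ≠ 0 → w t = 0 := by
      intro t ht
      rcases lt_or_gt_of_ne ht with h' | h'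
      · rw [← hw_even]
        exact le_antisymm (h _ (by linarith)) (hw_nonneg _)
      · exact le_antisymm (h _ h') (hw_nonneg _)
    have : (w : ℝ → ℝ) = fun _ => 0 :=
      Continuous.ext_on (dense_compl_singleton (0 : ℝ)) w.continuous continuous_const
        (fun t ht => hz t ht)
    ext t
    simpa using congrFun this t
  obtain ⟨η, hη, hball⟩ := Metric.eventually_nhds_iff.1
    (w.continuous.continuousAt.eventually (eventually_gt_nhds (half_lt_self hwt₀)))
  set d := min (η / 2) (t₀ / 2) with hd
  have hd0 : 0 < d := by positivity
  have hd1 : d ≤ η / 2 := min_le_left _ _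
  have hd2 : d ≤ t₀ / 2 := min_le_right _ _
  obtain ⟨c, hc, hev⟩ := exists_card_family_ge (t₁ := t₀ - d) (t₂ := t₀ + d) (by linarith)
    (by linarith)
  refine ⟨w t₀ / 2 * c, by positivity, ?_⟩
  filter_upwards [hev, eventually_gt_atTop 0] with X ⟨S, hS1, hS2⟩ hX
  classical
  set S' : Finset family := S.subtype (· ∈ family) with hS'
  have hcard : S'.card = S.card := by
    rw [hS', Finset.card_subtype, Finset.filter_true_of_mem fun α hα => (hS2 α hα).1]
  have hle : ∑ α ∈ S', w ((nrm α.1 : ℝ) / X) ≤ totalWeight w X :=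
    (summable_weight w hX).sum_le_tsum S' fun α _ => hw_nonneg _
  have hlow : S'.card • (w t₀ / 2) ≤ ∑ α ∈ S', w ((nrm α.1 : ℝ) / X) := by
    refine Finset.card_nsmul_le_sum _ _ _ fun α hα => ?_
    obtain ⟨-, h1, h2⟩ := hS2 α.1 (by simpa [hS'] using hα)
    refine (hball ?_).le
    rw [Real.dist_eq, abs_lt]
    have h3 : t₀ - d ≤ (nrm α.1 : ℝ) / X := by rwa [le_div_iff₀ hX]
    have h4 : (nrm α.1 : ℝ) / X ≤ t₀ + d := by rwa [div_le_iff₀ hX]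
    constructor <;> linarith
  rw [hcard, nsmul_eq_mul] at hlow
  calc w t₀ / 2 * c * X = c * X * (w t₀ / 2) := by ring
    _ ≤ S.card * (w t₀ / 2) := by gcongr
    _ ≤ _ := hlow.trans hle

end

/-! ### Test functions of exponential type -/

section

open Complex Set Filter Topology MeasureTheory

/-- An entire function of exponential type at most `σ`, rapidly decreasing on horizontal strips. -/
structure IsTestFunction (g : ℂ → ℂ) (σ : ℝ) : Prop where
  differentiable : Differentiable ℂ g
  nonneg : 0 ≤ σ
  decay : ∀ k : ℕ, ∃ C : ℝ, 0 < C ∧ ∀ z : ℂ, ‖g z‖ ≤ C * Real.exp (σ * |z.im|) / (1 + |z.re|) ^ k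

lemma IsTestFunction.conj {g : ℂ → ℂ} {σ : ℝ} (hg : IsTestFunction g σ) :
    IsTestFunction (fun z => starRingEnd ℂ (g (starRingEnd ℂ z))) σ where
  differentiable := fun z => by
    have := (hg.differentiable (starRingEnd ℂ z)).hasDerivAt.conj_conj
    rw [conj_conj] at this
    exact this.differentiableAt
  nonneg := hg.nonneg
  decay := fun k => by
    obtain ⟨C, hC, h⟩ := hg.decay k
    exact ⟨C, hC, fun z => by simpa using h (starRingEnd ℂ z)⟩

/-- The Fourier–Laplace transform `z ↦ ∫ f(x) e^{2πixz} dx`. -/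
noncomputable def fourierLaplace (f : ℝ → ℂ) (z : ℂ) : ℂ :=
  ∫ x : ℝ, f x * Complex.exp (2 * Real.pi * I * x * z)

section
variable {f : ℝ → ℂ} {σ : ℝ}

lemma norm_exp_kernel (x : ℝ) (z : ℂ) :
    ‖Complex.exp (2 * Real.pi * I * x * z)‖ = Real.exp (-(2 * Real.pi * x * z.im)) := by
  rw [norm_exp]
  congr 1
  have : (2 * Real.pi * I * x * z : ℂ) = ((2 * Real.pi * x : ℝ) : ℂ) * (I * z) := by
    push_cast; ring
  rw [this, re_ofReal_mul]
  simp

lemma norm_kernel_le (hσ : ∀ x, f x ≠ 0 → |x| ≤ σ) (x : ℝ) (z : ℂ) :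
    ‖f x * Complex.exp (2 * Real.pi * I * x * z)‖
      ≤ ‖f x‖ * Real.exp (2 * Real.pi * σ * |z.im|) := by
  by_cases hx : f x = 0
  · simp [hx]
  rw [norm_mul, norm_exp_kernel]
  gcongr
  have h1 : -(x * z.im) ≤ |x| * |z.im| := by rw [← abs_mul]; exact neg_le_abs _
  have h2 : |x| * |z.im| ≤ σ * |z.im| := by gcongr; exact hσ x hx
  have := Real.pi_pos
  nlinarith

lemma integrable_kernel (hf : Integrable f) (hσ : ∀ x, f x ≠ 0 → |x| ≤ σ) (z : ℂ) :
    Integrable fun x : ℝ => f x * Complex.exp (2 * Real.pi * I * x * z) := by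
  refine Integrable.mono' (hf.norm.mul_const (Real.exp (2 * Real.pi * σ * |z.im|))) ?_
    (ae_of_all _ fun x => norm_kernel_le hσ x z)
  exact hf.aestronglyMeasurable.mul (by fun_prop : Continuous fun x : ℝ =>
    Complex.exp (2 * Real.pi * I * x * z)).aestronglyMeasurable

lemma norm_fourierLaplace_le (hf : Integrable f) (hσ : ∀ x, f x ≠ 0 → |x| ≤ σ) (z : ℂ) :
    ‖fourierLaplace f z‖ ≤ (∫ x, ‖f x‖) * Real.exp (2 * Real.pi * σ * |z.im|) := by
  rw [← integral_mul_const]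
  exact norm_integral_le_of_norm_le (hf.norm.mul_const _) (ae_of_all _ fun x =>
    norm_kernel_le hσ x z)

lemma differentiable_fourierLaplace (hf : Integrable f) (hσ : ∀ x, f x ≠ 0 → |x| ≤ σ) :
    Differentiable ℂ (fourierLaplace f) := by
  intro z₀
  have hm : ∀ z : ℂ, AEStronglyMeasurable
      (fun x : ℝ => f x * Complex.exp (2 * Real.pi * I * x * z)) := fun z =>
    (integrable_kernel hf hσ z).aestronglyMeasurable
  refine (hasDerivAt_integral_of_dominated_loc_of_deriv_le (s := Metric.ball z₀ 1)
    (F := fun z (x : ℝ) => f x * Complex.exp (2 * Real.pi * I * x * z))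
    (F' := fun z (x : ℝ) => f x * Complex.exp (2 * Real.pi * I * x * z) * (2 * Real.pi * I * x))
    (bound := fun x => ‖f x‖ * (Real.exp (2 * Real.pi * σ * (|z₀.im| + 1)) * (2 * Real.pi * σ)))
    (Metric.ball_mem_nhds _ one_pos) (Eventually.of_forall hm) (integrable_kernel hf hσ z₀)
    ((hm z₀).mul (by fun_prop : Continuous fun x : ℝ =>
      (2 * Real.pi * I * x : ℂ)).aestronglyMeasurable) (ae_of_all _ fun x z hz => ?_)
    (hf.norm.mul_const _) (ae_of_all _ fun x z _ => ?_)).2.differentiableAt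
  · by_cases hx : f x = 0
    · simp [hx]
    have hxσ := hσ x hx
    have hσ0 : 0 ≤ σ := (abs_nonneg _).trans hxσ
    have him : |z.im| ≤ |z₀.im| + 1 := by
      have h1 : |(z - z₀).im| ≤ ‖z - z₀‖ := abs_im_le_norm _
      rw [Metric.mem_ball, dist_eq_norm] at hz
      rw [sub_im] at h1
      have h2 := abs_sub_abs_le_abs_sub z.im z₀.im
      linarith
    rw [norm_mul, ← mul_assoc]
    have h3 : ‖(2 * Real.pi * I * x : ℂ)‖ = 2 * Real.pi * |x| := by
      simp [abs_of_pos Real.pi_pos]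
    rw [h3]
    have hpi := Real.pi_pos
    gcongr
    exact (norm_kernel_le hσ x z).trans (by gcongr)
  · have h1 : HasDerivAt (fun z : ℂ => 2 * Real.pi * I * x * z) (2 * Real.pi * I * x) z := by
      simpa using (hasDerivAt_id z).const_mul (2 * Real.pi * I * x : ℂ)
    have := (h1.cexp).const_mul (f x)
    simpa [mul_assoc] using this

lemma fourierLaplace_deriv (hf : ContDiff ℝ 1 f) (hc : HasCompactSupport f) (z : ℂ) :
    fourierLaplace (deriv f) z = -(2 * Real.pi * I * z) * fourierLaplace f z := by
  have hd : ∀ x, HasDerivAt f (deriv f x) x := fun x =>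
    (hf.differentiable one_ne_zero x).hasDerivAt
  have he : ∀ x : ℝ, HasDerivAt (fun x : ℝ => Complex.exp (2 * Real.pi * I * x * z))
      (Complex.exp (2 * Real.pi * I * x * z) * (2 * Real.pi * I * z)) x := by
    intro x
    have h1 : HasDerivAt (fun x : ℝ => (2 * Real.pi * I * x * z : ℂ)) (2 * Real.pi * I * z) x := by
      have := ((hasDerivAt_id x).ofReal_comp.const_mul (2 * Real.pi * I : ℂ)).mul_const z
      simpa using this
    exact h1.cexp
  have hfc := hf.continuous
  have hdc : Continuous (deriv f) := hf.continuous_deriv le_rfl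
  have hec : Continuous fun x : ℝ => Complex.exp (2 * Real.pi * I * x * z) := by fun_prop
  have hec' : Continuous fun x : ℝ =>
      Complex.exp (2 * Real.pi * I * x * z) * (2 * Real.pi * I * z) := by fun_prop
  have h := integral_mul_deriv_eq_deriv_mul_of_integrable (u := f)
    (v := fun x : ℝ => Complex.exp (2 * Real.pi * I * x * z)) (fun x _ => hd x) (fun x _ => he x)
    ((hfc.mul hec').integrable_of_hasCompactSupport hc.mul_right)
    ((hdc.mul hec).integrable_of_hasCompactSupport hc.deriv.mul_right)
    ((hfc.mul hec).integrable_of_hasCompactSupport hc.mul_right)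
  rw [fourierLaplace, fourierLaplace, ← integral_const_mul]
  rw [← neg_eq_iff_eq_neg] at h
  rw [← h, ← integral_neg]
  congr 1
  ext x
  ring

/-- Integrating by parts `k` times trades `k` derivatives of `f` for decay of order `k`. -/
lemma exists_pow_mul_fourierLaplace_le (k : ℕ) : ∀ {f : ℝ → ℂ}, ContDiff ℝ (⊤ : ℕ∞) f →
    HasCompactSupport f → (∀ x ∈ tsupport f, |x| ≤ σ) →
    ∃ C : ℝ, 0 ≤ C ∧ ∀ z : ℂ, ‖z‖ ^ k * ‖fourierLaplace f z‖
      ≤ C * Real.exp (2 * Real.pi * σ * |z.im|) := by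
  induction k with
  | zero =>
    intro f hf hc hσ
    refine ⟨∫ x, ‖f x‖, integral_nonneg fun _ => norm_nonneg _, fun z => ?_⟩
    rw [pow_zero, one_mul]
    exact norm_fourierLaplace_le (hf.continuous.integrable_of_hasCompactSupport hc)
      (fun x hx => hσ x (subset_tsupport _ hx)) z
  | succ k ih =>
    intro f hf hc hσ
    have hf' : ContDiff ℝ (⊤ : ℕ∞) (deriv f) := by
      have := (contDiff_infty_iff_deriv (𝕜 := ℝ) (f := f)).1 hf
      exact this.2
    obtain ⟨C, hC0, hC⟩ := ih hf' hc.deriv (fun x hx => hσ x (tsupport_deriv_subset hx))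
    refine ⟨C, hC0, fun z => ?_⟩
    have h := hC z
    rw [fourierLaplace_deriv (hf.of_le (by exact_mod_cast le_top)) hc, norm_mul] at h
    have h3 : ‖-(2 * Real.pi * I * z : ℂ)‖ = 2 * Real.pi * ‖z‖ := by
      simp [abs_of_pos Real.pi_pos]
    rw [h3] at h
    refine le_trans ?_ h
    have hpi := Real.pi_gt_three
    have h4 : ‖z‖ ≤ 2 * Real.pi * ‖z‖ := by nlinarith [norm_nonneg z]
    calc ‖z‖ ^ (k + 1) * ‖fourierLaplace f z‖ = ‖z‖ ^ k * (‖z‖ * ‖fourierLaplace f z‖) := by ring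
      _ ≤ _ := by gcongr

lemma isTestFunction_fourierLaplace (hf : ContDiff ℝ (⊤ : ℕ∞) f) (hc : HasCompactSupport f) :
    ∃ σ, IsTestFunction (fourierLaplace f) σ := by
  obtain ⟨R, hR⟩ := hc.isCompact.isBounded.exists_norm_le
  have hσ : ∀ x ∈ tsupport f, |x| ≤ |R| := fun x hx => (hR x hx).trans (le_abs_self R)
  refine ⟨2 * Real.pi * |R|, ?_, ?_, fun k => ?_⟩
  · exact differentiable_fourierLaplace (hf.continuous.integrable_of_hasCompactSupport hc)
      (fun x hx => hσ x (subset_tsupport _ hx))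
  · have := Real.pi_pos
    positivity
  · obtain ⟨C₀, h00, hC₀⟩ := exists_pow_mul_fourierLaplace_le 0 hf hc hσ
    obtain ⟨C₁, h10, hC₁⟩ := exists_pow_mul_fourierLaplace_le k hf hc hσ
    refine ⟨2 ^ (k - 1) * (C₀ + C₁) + 1, by positivity, fun z => ?_⟩
    rw [le_div_iff₀ (by positivity)]
    have h0 := hC₀ z
    have h1 := hC₁ z
    rw [pow_zero, one_mul] at h0
    have h2 : (1 + |z.re|) ^ k ≤ 2 ^ (k - 1) * (1 ^ k + ‖z‖ ^ k) :=
      (add_pow_le zero_le_one (abs_nonneg _) k).trans (by gcongr; exact abs_re_le_norm z)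
    rw [one_pow] at h2
    calc ‖fourierLaplace f z‖ * (1 + |z.re|) ^ k
        ≤ ‖fourierLaplace f z‖ * (2 ^ (k - 1) * (1 + ‖z‖ ^ k)) := by gcongr
      _ = 2 ^ (k - 1) * (‖fourierLaplace f z‖ + ‖z‖ ^ k * ‖fourierLaplace f z‖) := by ring
      _ ≤ 2 ^ (k - 1) * (C₀ * Real.exp (2 * Real.pi * |R| * |z.im|)
            + C₁ * Real.exp (2 * Real.pi * |R| * |z.im|)) := by gcongr
      _ = 2 ^ (k - 1) * (C₀ + C₁) * Real.exp (2 * Real.pi * |R| * |z.im|) := by ring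
      _ ≤ _ := by gcongr; linarith

end

lemma isTestFunction_entireExt (φ : 𝓢(ℝ, ℂ)) (hφ : HasCompactSupport (𝓕 (φ : ℝ → ℂ))) :
    ∃ σ, IsTestFunction (entireExt φ) σ := by
  have h := SchwartzMap.fourier_coe φ
  refine isTestFunction_fourierLaplace ?_ hφ
  rw [← h]
  exact (𝓕 φ).smooth ⊤

lemma entireExt_ofReal (φ : 𝓢(ℝ, ℂ)) (t : ℝ) : entireExt φ t = φ t := by
  have h := congrFun (φ.continuous.fourierInv_fourier_eq φ.integrable (by
    rw [← SchwartzMap.fourier_coe]; exact (𝓕 φ).integrable)) t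
  rw [← h, Real.fourierInv_eq', entireExt]
  congr 1
  ext x
  rw [smul_eq_mul, mul_comm]
  congr 2
  simp
  ring

lemma entireExt_neg (φ : 𝓢(ℝ, ℂ)) (hφ : ∀ τ : ℝ, φ (-τ) = φ τ) (z : ℂ) :
    entireExt φ (-z) = entireExt φ z := by
  have h : ∀ x, 𝓕 (φ : ℝ → ℂ) (-x) = 𝓕 (φ : ℝ → ℂ) x := by
    intro x
    rw [← Real.fourierInv_eq_fourier_neg, Real.fourierInv_eq_fourier_comp_neg]
    simp_rw [hφ]
  rw [entireExt, entireExt, ← integral_neg_eq_self]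
  congr 1
  ext x
  rw [h]
  congr 2
  push_cast
  ring

lemma fourier_zero_eq_integral (φ : 𝓢(ℝ, ℂ)) : 𝓕 (φ : ℝ → ℂ) 0 = ∫ τ : ℝ, φ τ := by
  rw [Real.fourier_eq']
  simp

end

/-! ### The explicit formula -/

section

open Complex Set Filter Topology MeasureTheory

lemma strip_re_im (s : ℂ) (κ : ℝ) : (-I * (s - 1 / 2) * κ).re = κ * s.im ∧
    (-I * (s - 1 / 2) * κ).im = -(κ * (s.re - 1 / 2)) := by
  rw [mul_comm _ (κ : ℂ)]
  constructor
  · rw [re_ofReal_mul]; simp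
  · rw [im_ofReal_mul]; simp; ring

/-- Decay of `s ↦ g(-i (s - 1/2) κ)` in the strip `-1/2 ≤ Re s ≤ 3/2`. -/
lemma IsTestFunction.exists_strip_decay {g : ℂ → ℂ} {σ κ : ℝ} (hg : IsTestFunction g σ)
    (hκ : 0 < κ) (k : ℕ) : ∃ K : ℝ, 0 < K ∧ ∀ s : ℂ, -1 / 2 ≤ s.re → s.re ≤ 3 / 2 →
      ‖g (-I * (s - 1 / 2) * κ)‖ ≤ K / (1 + |s.im|) ^ k := by
  obtain ⟨C, hC, h⟩ := hg.decay k
  set m := min 1 κ with hm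
  have hm0 : 0 < m := lt_min one_pos hκ
  refine ⟨C * Real.exp (σ * κ) / m ^ k, by positivity, fun s h1 h2 => ?_⟩
  have hb := h (-I * (s - 1 / 2) * κ)
  rw [(strip_re_im s κ).1, (strip_re_im s κ).2, abs_neg, abs_mul, abs_mul, abs_of_pos hκ] at hb
  have h3 : |s.re - 1 / 2| ≤ 1 := abs_le.2 ⟨by linarith, by linarith⟩
  have h4 : m * (1 + |s.im|) ≤ 1 + κ * |s.im| := by
    have := min_le_left 1 κ
    have := min_le_right 1 κ
    have := abs_nonneg s.im
    nlinarith
  have hσ := hg.nonneg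
  calc _ ≤ _ := hb
    _ ≤ C * Real.exp (σ * (κ * 1)) / (m * (1 + |s.im|)) ^ k := by gcongr
    _ = _ := by rw [mul_pow, mul_one, div_div]

lemma logDeriv_conj_conj (f : ℂ → ℂ) (z : ℂ) (hf : DifferentiableAt ℂ f (starRingEnd ℂ z)) :
    logDeriv (fun w => starRingEnd ℂ (f (starRingEnd ℂ w))) z
      = starRingEnd ℂ (logDeriv f (starRingEnd ℂ z)) := by
  have h := hf.hasDerivAt.conj_conj
  rw [conj_conj] at h
  have e : (⇑(starRingEnd ℂ) ∘ f ∘ ⇑(starRingEnd ℂ))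
      = fun w => starRingEnd ℂ (f (starRingEnd ℂ w)) := rfl
  rw [e] at h
  rw [logDeriv_apply, h.deriv, logDeriv_apply, map_div₀]

lemma conj_natCast_cpow (n : ℕ) (z : ℂ) :
    starRingEnd ℂ ((n : ℂ) ^ z) = (n : ℂ) ^ starRingEnd ℂ z := by
  have := conj_cpow (n : ℂ) (starRingEnd ℂ z) (by rw [natCast_arg]; exact Real.pi_pos.ne)
  rw [conj_conj, conj_natCast] at this
  exact this.symm

variable {N : ℕ} [NeZero N]

lemma LFunction_inv_eq_conj (χ : DirichletCharacter ℂ N) {s : ℂ} (hs : 1 < s.re) :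
    χ⁻¹.LFunction s = starRingEnd ℂ (χ.LFunction (starRingEnd ℂ s)) := by
  rw [χ⁻¹.LFunction_eq_LSeries hs, χ.LFunction_eq_LSeries (by simpa using hs), LSeries, LSeries,
    conj_tsum]
  refine tsum_congr fun n => ?_
  rcases eq_or_ne n 0 with rfl | hn
  · simp
  · rw [LSeries.term_of_ne_zero hn, LSeries.term_of_ne_zero hn, map_div₀, conj_natCast_cpow,
      conj_conj]
    congr 1
    rw [← MulChar.star_eq_inv]
    rfl

lemma logDeriv_LFunction_inv {χ : DirichletCharacter ℂ N} (hχ1 : χ ≠ 1) {s : ℂ}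
    (hs : 1 < s.re) :
    logDeriv χ⁻¹.LFunction s = starRingEnd ℂ (logDeriv χ.LFunction (starRingEnd ℂ s)) := by
  rw [← logDeriv_conj_conj _ _ (DirichletCharacter.differentiable_LFunction hχ1 _)]
  have : χ⁻¹.LFunction =ᶠ[𝓝 s] fun w => starRingEnd ℂ (χ.LFunction (starRingEnd ℂ w)) := by
    filter_upwards [(isOpen_lt continuous_const continuous_re).mem_nhds hs] with w hw
    exact LFunction_inv_eq_conj χ hw
  rw [logDeriv_apply, logDeriv_apply, this.deriv_eq, this.eq_of_nhds]

lemma differentiableAt_Gamma_of_re_pos {z : ℂ} (hz : 0 < z.re) : DifferentiableAt ℂ Gamma z :=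
  differentiableAt_Gamma z fun m h => by
    rw [h] at hz
    simp at hz
    have hm : (0 : ℝ) ≤ m := Nat.cast_nonneg m
    linarith

lemma differentiableAt_Gammaℝ {s : ℂ} (hs : 0 < s.re) : DifferentiableAt ℂ Gammaℝ s := by
  have h1 : DifferentiableAt ℂ (fun s : ℂ => (Real.pi : ℂ) ^ (-s / 2)) s :=
    (differentiableAt_id.neg.div_const 2).const_cpow (Or.inl (ofReal_ne_zero.2 Real.pi_ne_zero))
  have h2 : DifferentiableAt ℂ (fun s : ℂ => Gamma (s / 2)) s := by
    refine DifferentiableAt.comp s (g := Gamma) (differentiableAt_Gamma_of_re_pos ?_)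
      (differentiableAt_id.div_const 2)
    simpa using hs
  exact (h1.mul h2).congr_of_eventuallyEq (Eventually.of_forall fun z => Gammaℝ_def z)

lemma logDeriv_Gammaℝ {s : ℂ} (hs : 0 < s.re) :
    logDeriv Gammaℝ s = -(Real.log Real.pi : ℂ) / 2 + digamma (s / 2) / 2 := by
  have hpi : (Real.pi : ℂ) ≠ 0 := ofReal_ne_zero.2 Real.pi_ne_zero
  have hs2 : 0 < (s / 2).re := by simpa using hs
  have e : Gammaℝ = fun z => (Real.pi : ℂ) ^ (-z / 2) * Gamma (z / 2) := funext Gammaℝ_def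
  have h1 : HasDerivAt (fun s : ℂ => (Real.pi : ℂ) ^ (-s / 2))
      ((Real.pi : ℂ) ^ (-s / 2) * Complex.log Real.pi * (-1 / 2)) s :=
    ((hasDerivAt_id s).neg.div_const 2).const_cpow (Or.inl hpi)
  have hG : DifferentiableAt ℂ Gamma (s / 2) := differentiableAt_Gamma_of_re_pos hs2
  have hh : HasDerivAt (fun z : ℂ => z / 2) (1 / 2) s := (hasDerivAt_id s).div_const 2
  have h2 : HasDerivAt (fun z : ℂ => Gamma (z / 2)) (deriv Gamma (s / 2) * (1 / 2)) s :=
    HasDerivAt.comp s (h₂ := Gamma) hG.hasDerivAt hh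
  have hGn := Gamma_ne_zero_of_re_pos hs2
  have hpn : (Real.pi : ℂ) ^ (-s / 2) ≠ 0 := by simp [cpow_eq_zero_iff, hpi]
  rw [e, logDeriv_mul (f := fun z => (Real.pi : ℂ) ^ (-z / 2)) (g := fun z => Gamma (z / 2)) s
    hpn hGn h1.differentiableAt h2.differentiableAt, logDeriv_apply, logDeriv_apply, h1.deriv,
    h2.deriv, digamma_def, logDeriv_apply, ofReal_log Real.pi_pos.le]
  field_simp

lemma logDeriv_completedLFunction {χ : DirichletCharacter ℂ N} (hχ : χ.Even) (hχ1 : χ ≠ 1) {s : ℂ}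
    (hs : 1 ≤ s.re) : logDeriv χ.completedLFunction s
      = -(Real.log Real.pi : ℂ) / 2 + digamma (s / 2) / 2 + logDeriv χ.LFunction s := by
  have hs0 : 0 < s.re := by linarith
  have h : χ.completedLFunction =ᶠ[𝓝 s] fun w => Gammaℝ w * χ.LFunction w := by
    filter_upwards [(isOpen_lt continuous_const continuous_re).mem_nhds hs0] with w hw
    exact completedLFunction_eq_mul hχ hw
  rw [← logDeriv_Gammaℝ hs0, ← logDeriv_mul s (Gammaℝ_ne_zero_of_re_pos hs0)
    (χ.LFunction_ne_zero_of_one_le_re (Or.inl hχ1) hs) (differentiableAt_Gammaℝ hs0)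
    (DirichletCharacter.differentiable_LFunction hχ1 s), logDeriv_apply, logDeriv_apply,
    h.deriv_eq, h.eq_of_nhds]

/-- The logarithmic derivative of the functional equation. -/
lemma logDeriv_completedLFunction_one_sub {χ : DirichletCharacter ℂ N} (hχ : χ.Even) (hχ1 : χ ≠ 1)
    (hp : χ.IsPrimitive) {s : ℂ} (hs : 1 ≤ s.re) :
    logDeriv χ.completedLFunction (1 - s)
      = -(Real.log N : ℂ) - logDeriv χ⁻¹.completedLFunction s := by
  have hinv1 : χ⁻¹ ≠ 1 := inv_ne_one.2 hχ1
  have hN : (N : ℂ) ≠ 0 := NeZero.ne _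
  have hd := DirichletCharacter.differentiable_completedLFunction hχ1
  have hd' := DirichletCharacter.differentiable_completedLFunction hinv1
  have hW := rootNumber_ne_zero hχ hχ1 hp
  have hne : χ⁻¹.completedLFunction s ≠ 0 :=
    completedLFunction_ne_zero_of_one_le_re (inv_even hχ) hinv1 hs
  have e : (fun z => χ.completedLFunction (1 - z))
      = fun z => (N : ℂ) ^ (z - 1 / 2) * χ.rootNumber * χ⁻¹.completedLFunction z :=
    funext hp.completedLFunction_one_sub
  have h1 : HasDerivAt (fun z : ℂ => (N : ℂ) ^ (z - 1 / 2) * χ.rootNumber)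
      ((N : ℂ) ^ (s - 1 / 2) * Complex.log N * 1 * χ.rootNumber) s :=
    (((hasDerivAt_id s).sub_const (1 / 2)).const_cpow (Or.inl hN)).mul_const _
  have hpn : (N : ℂ) ^ (s - 1 / 2) ≠ 0 := by simp [cpow_eq_zero_iff, hN]
  have h2 : logDeriv (fun z => χ.completedLFunction (1 - z)) s
      = -logDeriv χ.completedLFunction (1 - s) := by
    have h3 : HasDerivAt (fun z : ℂ => 1 - z) (-1) s := by
      simpa using (hasDerivAt_id s).const_sub 1
    have h4 := HasDerivAt.comp s (h₂ := χ.completedLFunction) (hd (1 - s)).hasDerivAt h3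
    have h5 : deriv (fun z => χ.completedLFunction (1 - z)) s
        = deriv χ.completedLFunction (1 - s) * (-1) := h4.deriv
    rw [logDeriv_apply, logDeriv_apply, h5]
    ring
  have h3 : logDeriv (fun z => χ.completedLFunction (1 - z)) s
      = (Real.log N : ℂ) + logDeriv χ⁻¹.completedLFunction s := by
    rw [e, logDeriv_mul (f := fun z : ℂ => (N : ℂ) ^ (z - 1 / 2) * χ.rootNumber) s
      (mul_ne_zero hpn hW) hne h1.differentiableAt (hd' s), logDeriv_apply, h1.deriv,
      natCast_log]
    congr 1
    rw [div_eq_iff (mul_ne_zero hpn hW)]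
    ring
  linear_combination h2 - h3

/-- The explicit formula: the sum over zeros equals a conductor and gamma term on the central line
plus the contributions of `χ` and `χ⁻¹` on the line `Re s = 3/2`. -/
theorem hasSum_explicit_formula {χ : DirichletCharacter ℂ N} (hχ : χ.Even) (hχ1 : χ ≠ 1)
    (hp : χ.IsPrimitive) {g : ℂ → ℂ} {σ κ : ℝ} (hg : IsTestFunction g σ) (hκ : 0 < κ)
    (heven : ∀ z, g (-z) = g z) :
    HasSum (fun ρ : {s : ℂ // χ.completedLFunction s = 0} =>
        (analyticOrderNatAt χ.completedLFunction ρ.1 : ℂ) * g (-I * (ρ.1 - 1 / 2) * κ))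
      ((2 * Real.pi : ℂ)⁻¹ *
        ((∫ y : ℝ, ((Real.log N : ℂ) - (Real.log Real.pi : ℂ) + digamma (1 / 4 + y / 2 * I))
            * g ((κ * y : ℝ) : ℂ))
        + (∫ y : ℝ, logDeriv χ.LFunction ((3 / 2 : ℝ) + y * I) * g ((y - I) * κ))
        + ∫ y : ℝ, logDeriv χ⁻¹.LFunction ((3 / 2 : ℝ) + y * I) * g ((y - I) * κ))) := by
  obtain ⟨A, hA⟩ := stripFunction_completedLFunction hχ hχ1 hp
  have hinv1 : χ⁻¹ ≠ 1 := inv_ne_one.2 hχ1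
  have hpinv : χ⁻¹.IsPrimitive := by
    rwa [DirichletCharacter.isPrimitive_def, DirichletCharacter.conductor_inv]
  obtain ⟨A', hA'⟩ := stripFunction_completedLFunction (inv_even hχ) hinv1 hpinv
  set h : ℂ → ℂ := fun s => g (-I * (s - 1 / 2) * κ) with hh
  have hd : Differentiable ℂ h := hg.differentiable.comp (by fun_prop)
  obtain ⟨K, hK0, hK⟩ := hg.exists_strip_decay hκ 8
  have hsum := hA.hasSum_zeros hd hK
  have hi := hA.integrable_vertical hd hK (Or.inl rfl)
  have hi' := hA'.integrable_vertical hd hK (Or.inl rfl)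
  have hline : ∀ y : ℝ, h ((3 / 2 : ℝ) + y * I) = g ((y - I) * κ) := by
    intro y
    simp only [hh]
    congr 1
    push_cast
    linear_combination (-(y : ℂ) * κ) * I_sq
  have hsymm : ∀ s, h (1 - s) = h s := by
    intro s
    simp only [hh]
    rw [← heven]
    congr 1
    ring
  -- the constant and gamma terms
  set G : ℂ → ℂ := fun s => ((Real.log N : ℂ) - (Real.log Real.pi : ℂ) + digamma (s / 2)) * h s
    with hG
  obtain ⟨Cd, hCd0, hCd⟩ := exists_digamma_bound
  have hGd : DifferentiableOn ℂ G {s | (1 / 2 : ℝ) ≤ s.re ∧ s.re ≤ (3 / 2 : ℝ)} := by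
    intro s hs
    have hs0 : 0 < (s / 2).re := by
      have := hs.1
      simp; linarith
    have hdig : DifferentiableAt ℂ digamma (s / 2) := by
      have hopen : IsOpen {z : ℂ | 0 < z.re} := isOpen_lt continuous_const continuous_re
      have hGo : DifferentiableOn ℂ Gamma {z : ℂ | 0 < z.re} := fun z hz =>
        (differentiableAt_Gamma_of_re_pos hz).differentiableWithinAt
      have h1 : DifferentiableAt ℂ (deriv Gamma) (s / 2) :=
        (hGo.deriv hopen).differentiableAt (hopen.mem_nhds hs0)
      exact h1.div (differentiableAt_Gamma_of_re_pos hs0) (Gamma_ne_zero_of_re_pos hs0)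
    have h2 : DifferentiableAt ℂ (fun z : ℂ => digamma (z / 2)) s :=
      DifferentiableAt.comp s (g := digamma) hdig (differentiableAt_id.div_const 2)
    exact ((h2.const_add _).mul (hd s)).differentiableWithinAt
  set B := ‖(Real.log N : ℂ) - (Real.log Real.pi : ℂ)‖ with hB
  have hGb : ∀ s : ℂ, (1 / 2 : ℝ) ≤ s.re → s.re ≤ (3 / 2 : ℝ) →
      ‖G s‖ ≤ (B + Cd) * K / (1 + |s.im|) ^ 2 := by
    intro s h1 h2
    have h3 := hCd (s / 2) (by simp; linarith) (by simp; linarith)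
    have h4 := hK s (by linarith) h2
    have hu : 1 ≤ 1 + |s.im| := by linarith [abs_nonneg s.im]
    have him : |(s / 2).im| ≤ |s.im| := by
      have : (s / 2).im = s.im / 2 := by simp
      rw [this, abs_div, abs_two]
      linarith [abs_nonneg s.im]
    rw [hG, norm_mul]
    calc _ ≤ (B + Cd * (1 + |s.im|)) * (K / (1 + |s.im|) ^ 8) := by
          gcongr
          refine (norm_add_le _ _).trans ?_
          gcongr
          exact h3.trans (by gcongr)
      _ ≤ ((B + Cd) * (1 + |s.im|)) * (K / (1 + |s.im|) ^ 8) := by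
          gcongr
          have : 0 ≤ B := norm_nonneg _
          nlinarith
      _ = (B + Cd) * K * (1 + |s.im|) / (1 + |s.im|) ^ 8 := by ring
      _ ≤ _ := by
          have hBC : 0 ≤ (B + Cd) * K := by
            have : 0 ≤ B := norm_nonneg _
            positivity
          rw [div_le_div_iff₀ (by positivity) (by positivity), mul_assoc]
          gcongr
          rw [← pow_succ']
          exact pow_le_pow_right₀ hu (by norm_num)
  have hshift := integral_vertical_eq (by norm_num) hGd hGb
  have hGint : Integrable fun y : ℝ => G ((3 / 2 : ℝ) + y * I) := by
    refine integrable_of_norm_le_div (K := (B + Cd) * K) ?_ fun y => ?_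
    · refine Continuous.aestronglyMeasurable ?_
      exact hGd.continuousOn.comp_continuous (by fun_prop) (fun y => by norm_num)
    · have := hGb ((3 / 2 : ℝ) + y * I) (by norm_num) (by norm_num)
      simpa using this
  have hcentral : ∀ y : ℝ, G ((1 / 2 : ℝ) + y * I)
      = ((Real.log N : ℂ) - (Real.log Real.pi : ℂ) + digamma (1 / 4 + y / 2 * I))
            * g ((κ * y : ℝ) : ℂ) := by
    intro y
    simp only [hG, hh]
    congr 2
    · congr 1; push_cast; ring
    · push_cast
      linear_combination (-(y : ℂ) * κ) * I_sq
  have hdec : ∀ (ψ : DirichletCharacter ℂ N), ψ.Even → ψ ≠ 1 → ∀ y : ℝ,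
      logDeriv ψ.completedLFunction ((3 / 2 : ℝ) + y * I) = -(Real.log Real.pi : ℂ) / 2
        + digamma (((3 / 2 : ℝ) + y * I) / 2) / 2 + logDeriv ψ.LFunction ((3 / 2 : ℝ) + y * I) :=
    fun ψ h1 h2 y => logDeriv_completedLFunction h1 h2 (by norm_num)
  have hleft : ∫ y : ℝ, logDeriv χ.completedLFunction ((-1 / 2 : ℝ) + y * I)
        * h ((-1 / 2 : ℝ) + y * I)
      = -∫ y : ℝ, ((Real.log N : ℂ) + logDeriv χ⁻¹.completedLFunction ((3 / 2 : ℝ) + y * I))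
          * h ((3 / 2 : ℝ) + y * I) := by
    rw [← integral_neg, ← integral_neg_eq_self]
    congr 1
    ext y
    have e1 : ((-1 / 2 : ℝ) : ℂ) + ((-y : ℝ) : ℂ) * I = 1 - ((3 / 2 : ℝ) + y * I) := by
      push_cast; ring
    rw [e1, logDeriv_completedLFunction_one_sub hχ hχ1 hp (by norm_num), hsymm]
    ring
  have hhint : Integrable fun y : ℝ => h ((3 / 2 : ℝ) + y * I) := by
    refine integrable_of_norm_le_div (K := K) ?_ fun y => ?_
    · exact (hd.continuous.comp (by fun_prop : Continuous fun y : ℝ =>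
        ((3 / 2 : ℝ) + y * I : ℂ))).aestronglyMeasurable
    · have := hK ((3 / 2 : ℝ) + y * I) (by norm_num) (by norm_num)
      have him : (((3 / 2 : ℝ) : ℂ) + y * I).im = y := by simp
      rw [him] at this
      refine this.trans ?_
      have hu : 1 ≤ 1 + |y| := by linarith [abs_nonneg y]
      gcongr
      norm_num
  have hLint : ∀ ψ : DirichletCharacter ℂ N, ψ.Even → ψ ≠ 1 →
      Integrable (fun y : ℝ => logDeriv ψ.completedLFunction ((3 / 2 : ℝ) + y * I)
        * h ((3 / 2 : ℝ) + y * I)) →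
      Integrable fun y : ℝ => logDeriv ψ.LFunction ((3 / 2 : ℝ) + y * I)
        * h ((3 / 2 : ℝ) + y * I) := by
    intro ψ h1 h2 h3
    have h4 := (h3.sub (hGint.div_const 2)).add (hhint.const_mul ((Real.log N : ℂ) / 2))
    refine h4.congr (ae_of_all _ fun y => ?_)
    simp only [Pi.add_apply, Pi.sub_apply, hG]
    rw [hdec ψ h1 h2]
    ring
  have hi1 := hLint χ hχ hχ1 hi
  have hi2 := hLint χ⁻¹ (inv_even hχ) hinv1 hi'
  have hi12 : Integrable fun y : ℝ => G ((3 / 2 : ℝ) + y * I)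
      + logDeriv χ.LFunction ((3 / 2 : ℝ) + y * I) * h ((3 / 2 : ℝ) + y * I) := hGint.add hi1
  convert! hsum using 2
  rw [hleft, sub_neg_eq_add]
  simp_rw [← hcentral, ← hline]
  rw [hshift, ← integral_add hGint hi1, ← integral_add hi12 hi2, ← integral_add hi]
  · congr 1
    ext y
    rw [hdec χ hχ hχ1, hdec χ⁻¹ (inv_even hχ) hinv1]
    simp only [hG]
    ring
  · refine ((hhint.const_mul (Real.log N : ℂ)).add hi').congr (ae_of_all _ fun y => ?_)
    simp only [Pi.add_apply]
    ring

end

/-! ### The explicit formula for a member of the family -/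

section

open Complex Set Filter Topology MeasureTheory

lemma analyticOrderNatAt_completedLFunction {N : ℕ} [NeZero N] {χ : DirichletCharacter ℂ N}
    (hχ : χ.Even) (hχ1 : χ ≠ 1) {ρ : ℂ} (hρ : 0 < ρ.re) :
    analyticOrderNatAt χ.completedLFunction ρ = analyticOrderNatAt χ.LFunction ρ := by
  have hopen : IsOpen {z : ℂ | 0 < z.re} := isOpen_lt continuous_const continuous_re
  have hmem : {z : ℂ | 0 < z.re} ∈ 𝓝 ρ := hopen.mem_nhds hρ
  have h : χ.completedLFunction =ᶠ[𝓝 ρ] Gammaℝ * χ.LFunction := by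
    filter_upwards [hmem] with w hw
    exact completedLFunction_eq_mul hχ hw
  have hG : AnalyticAt ℂ Gammaℝ ρ :=
    (DifferentiableOn.analyticAt (fun z hz => (differentiableAt_Gammaℝ hz).differentiableWithinAt)
      hmem)
  have hL : AnalyticAt ℂ χ.LFunction ρ :=
    (DirichletCharacter.differentiable_LFunction hχ1).analyticAt ρ
  rw [analyticOrderNatAt, analyticOrderNatAt, analyticOrderAt_congr h, analyticOrderAt_mul hG hL,
    hG.analyticOrderAt_eq_zero.2 (Gammaℝ_ne_zero_of_re_pos hρ), zero_add]

/-- The contribution of `L'/L(s, χ_α)` on the line `Re s = 3/2`, tested against `g`. -/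
noncomputable def primeSide (g : ℂ → ℂ) (κ : ℝ) (α : family) : ℂ :=
  ∫ y : ℝ, logDeriv (cubicChar α).LFunction ((3 / 2 : ℝ) + y * I) * g ((y - I) * κ)

/-- The contribution of `χ⁻¹ = conj χ` is the conjugate of a contribution of `χ` itself, so that no
symmetry of the family under conjugation is needed. -/
lemma primeSide_inv {g : ℂ → ℂ} (heven : ∀ z, g (-z) = g z) (κ : ℝ) (α : family) :
    ∫ y : ℝ, logDeriv (cubicChar α)⁻¹.LFunction ((3 / 2 : ℝ) + y * I) * g ((y - I) * κ)
      = starRingEnd ℂ (primeSide (fun z => starRingEnd ℂ (g (starRingEnd ℂ z))) κ α) := by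
  rw [primeSide, ← integral_conj, ← integral_neg_eq_self]
  congr 1
  ext y
  rw [logDeriv_LFunction_inv (cubicChar_ne_one α) (by norm_num)]
  simp only [map_mul, conj_conj, map_sub, map_add, map_neg, conj_ofReal, conj_I, ofReal_neg]
  rw [← heven]
  congr 2
  · congr 1; ring
  · ring

/-- The conductor-free part of the central integral in the explicit formula. -/
noncomputable def gammaTerm (φ : 𝓢(ℝ, ℂ)) (X : ℝ) : ℂ :=
  -(𝓕 (φ : ℝ → ℂ) 0 * (Real.log Real.pi : ℂ) / (scaleL X : ℂ))
    + 1 / (2 * (scaleL X : ℂ)) * (∫ τ : ℝ, φ τ *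
        (Complex.digamma (1 / 4 - Real.pi * Complex.I * τ / (scaleL X : ℂ))
          + Complex.digamma (1 / 4 + Real.pi * Complex.I * τ / (scaleL X : ℂ))))

lemma integrable_mul_digamma (φ : 𝓢(ℝ, ℂ)) (u : ℝ) :
    Integrable fun τ : ℝ => φ τ * digamma (1 / 4 + Real.pi * I * τ / (u : ℂ)) := by
  obtain ⟨C, hC0, hC⟩ := exists_digamma_bound
  have hz : ∀ τ : ℝ, (1 / 4 + Real.pi * I * τ / (u : ℂ) : ℂ)
      = ((1 / 4 : ℝ) : ℂ) + ((Real.pi * τ / u : ℝ) : ℂ) * I := by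
    intro τ; push_cast; ring
  have hre : ∀ τ : ℝ, (1 / 4 + Real.pi * I * τ / (u : ℂ) : ℂ).re = 1 / 4 := by
    intro τ; rw [hz]; simp
  have him : ∀ τ : ℝ, (1 / 4 + Real.pi * I * τ / (u : ℂ) : ℂ).im = Real.pi * τ / u := by
    intro τ; rw [hz]; simp
  have hb : ∀ τ : ℝ, ‖digamma (1 / 4 + Real.pi * I * τ / (u : ℂ))‖
      ≤ C * (1 + Real.pi / |u| * |τ|) := by
    intro τ
    have := hC (1 / 4 + Real.pi * I * τ / (u : ℂ)) (hre τ).ge (by rw [hre]; norm_num)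
    rw [him, abs_div, abs_mul, abs_of_pos Real.pi_pos] at this
    rwa [div_mul_eq_mul_div]
  have hcont : Continuous fun τ : ℝ => digamma (1 / 4 + Real.pi * I * τ / (u : ℂ)) := by
    have hopen : IsOpen {z : ℂ | 0 < z.re} := isOpen_lt continuous_const continuous_re
    have hGo : DifferentiableOn ℂ Gamma {z : ℂ | 0 < z.re} := fun z hz =>
      (differentiableAt_Gamma_of_re_pos hz).differentiableWithinAt
    have h1 : ContinuousOn digamma {z : ℂ | 0 < z.re} :=
      (hGo.deriv hopen).continuousOn.div hGo.continuousOn fun z hz => Gamma_ne_zero_of_re_pos hz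
    exact h1.comp_continuous (by fun_prop) fun τ => by
      have h4 : 0 < (1 / 4 + Real.pi * I * τ / (u : ℂ) : ℂ).re := by rw [hre]; norm_num
      exact h4
  have h0 := φ.integrable (μ := volume)
  have h1 := φ.integrable_pow_mul volume 1
  refine Integrable.mono' ((h0.norm.mul_const C).add (h1.mul_const (C * (Real.pi / |u|))))
    (φ.continuous.mul hcont).aestronglyMeasurable (ae_of_all _ fun τ => ?_)
  rw [norm_mul]
  simp only [Pi.add_apply, pow_one, Real.norm_eq_abs]
  calc _ ≤ ‖φ τ‖ * (C * (1 + Real.pi / |u| * |τ|)) := by gcongr; exact hb τ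
    _ = _ := by ring

/-- The central integral of the explicit formula, rescaled by `y = 2 π τ / L`. -/
lemma central_integral_eq (φ : 𝓢(ℝ, ℂ)) (hφ : ∀ τ : ℝ, φ (-τ) = φ τ) {X : ℝ} (hX : 0 < scaleL X)
    (c : ℂ) :
    (2 * Real.pi : ℂ)⁻¹ * ∫ y : ℝ, (c - (Real.log Real.pi : ℂ) + digamma (1 / 4 + y / 2 * I))
        * entireExt φ ((scaleL X / (2 * Real.pi) * y : ℝ) : ℂ)
      = c * 𝓕 (φ : ℝ → ℂ) 0 / scaleL X + gammaTerm φ X := by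
  set u := scaleL X with hu
  have hpi := Real.pi_pos
  have hpi' : (Real.pi : ℂ) ≠ 0 := ofReal_ne_zero.2 hpi.ne'
  have hu' : (u : ℂ) ≠ 0 := ofReal_ne_zero.2 hX.ne'
  have hi := integrable_mul_digamma φ u
  have hsub := Measure.integral_comp_mul_left (fun y : ℝ =>
    (c - (Real.log Real.pi : ℂ) + digamma (1 / 4 + y / 2 * I))
        * entireExt φ ((u / (2 * Real.pi) * y : ℝ) : ℂ)) (2 * Real.pi / u)
  have habs : |(2 * Real.pi / u)⁻¹| = u / (2 * Real.pi) := by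
    rw [abs_of_pos (by positivity), inv_div]
  rw [habs] at hsub
  have hpt : ∀ τ : ℝ, (c - (Real.log Real.pi : ℂ)
      + digamma (1 / 4 + ((2 * Real.pi / u * τ : ℝ) : ℂ) / 2 * I))
        * entireExt φ ((u / (2 * Real.pi) * (2 * Real.pi / u * τ) : ℝ) : ℂ)
      = (c - (Real.log Real.pi : ℂ)) * φ τ + φ τ * digamma (1 / 4 + Real.pi * I * τ / (u : ℂ)) := by
    intro τ
    have e1 : u / (2 * Real.pi) * (2 * Real.pi / u * τ) = τ := by field_simp
    have e2 : (1 / 4 + ((2 * Real.pi / u * τ : ℝ) : ℂ) / 2 * I : ℂ)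
        = 1 / 4 + Real.pi * I * τ / (u : ℂ) := by push_cast; ring
    rw [e1, e2, entireExt_ofReal]
    ring
  simp_rw [hpt] at hsub
  rw [integral_add (φ.integrable.const_mul _) hi, integral_const_mul, ← fourier_zero_eq_integral]
    at hsub
  have hneg : ∫ τ : ℝ, φ τ * digamma (1 / 4 - Real.pi * I * τ / (u : ℂ))
      = ∫ τ : ℝ, φ τ * digamma (1 / 4 + Real.pi * I * τ / (u : ℂ)) := by
    rw [← integral_neg_eq_self]
    congr 1
    ext τ
    rw [hφ]
    congr 2
    push_cast
    ring
  have hin : Integrable fun τ : ℝ => φ τ * digamma (1 / 4 - Real.pi * I * τ / (u : ℂ)) := by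
    have := integrable_mul_digamma φ (-u)
    refine this.congr (ae_of_all _ fun τ => ?_)
    simp only [ofReal_neg, div_neg]
    rw [← sub_eq_add_neg]
  rw [real_smul] at hsub
  rw [gammaTerm, ← hu]
  simp_rw [mul_add (φ _)]
  rw [integral_add hin hi, hneg]
  push_cast at hsub ⊢
  have e3 : ∀ A B : ℂ, A = u / (2 * Real.pi) * B → (2 * Real.pi : ℂ)⁻¹ * B = A / u := by
    rintro A B rfl
    field_simp
  rw [e3 _ _ hsub]
  field_simp
  ring

/-- The explicit formula for a member of the family. -/
lemma zeroSum_eq (φ : 𝓢(ℝ, ℂ)) (hφ : ∀ τ : ℝ, φ (-τ) = φ τ)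
    (hs : HasCompactSupport (𝓕 (φ : ℝ → ℂ))) {X : ℝ} (hX : 0 < scaleL X) (α : family) :
    zeroSum φ X α = (Real.log (nrm α.1) : ℂ) * 𝓕 (φ : ℝ → ℂ) 0 / scaleL X + gammaTerm φ X
      + (2 * Real.pi : ℂ)⁻¹ * (primeSide (entireExt φ) (scaleL X / (2 * Real.pi)) α
        + starRingEnd ℂ (primeSide (fun z => starRingEnd ℂ (entireExt φ (starRingEnd ℂ z)))
          (scaleL X / (2 * Real.pi)) α)) := by
  obtain ⟨σ, hg⟩ := isTestFunction_entireExt φ hs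
  have hκ : 0 < scaleL X / (2 * Real.pi) := by have := Real.pi_pos; positivity
  have heven := entireExt_neg φ hφ
  have hev := cubicChar_even α
  have h1 := cubicChar_ne_one α
  have h := (hasSum_explicit_formula hev h1 (cubicChar_isPrimitive α) hg hκ heven).tsum_eq
  rw [primeSide_inv heven] at h
  rw [← central_integral_eq φ hφ hX, ← mul_add, ← add_assoc]
  refine Eq.trans ?_ h
  have hiff : ∀ s : ℂ, s ∈ nontrivialZeros α ↔ (cubicChar α).completedLFunction s = 0 := by
    intro s
    constructor
    · rintro ⟨h2, -, h3⟩
      rw [completedLFunction_eq_mul hev h2, h3, mul_zero]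
    · intro h2
      obtain ⟨h3, h4⟩ := completedLFunction_zeros hev h1 (cubicChar_isPrimitive α) h2
      refine ⟨h3, h4, ?_⟩
      rw [completedLFunction_eq_mul hev h3] at h2
      exact (mul_eq_zero.1 h2).resolve_left (Gammaℝ_ne_zero_of_re_pos h3)
  rw [zeroSum, ← (Equiv.subtypeEquivRight hiff).tsum_eq]
  refine tsum_congr fun ρ => ?_
  simp only [Equiv.subtypeEquivRight_apply_coe]
  rw [analyticOrderNatAt_completedLFunction hev h1 ρ.2.1]
  push_cast
  rfl

end

/-! ### Logarithmic derivatives over the family -/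

section

open Complex Set Filter Topology MeasureTheory Metric

lemma one_le_zetaThreeHalves : 1 ≤ zetaThreeHalves := by
  have h1 := one_le_mul_norm_LFunction (1 : DirichletCharacter ℂ 1) (s := 2) (by norm_num)
  have h2 := norm_LFunction_le (1 : DirichletCharacter ℂ 1) (s := 2) (by norm_num)
  have h3 := zetaThreeHalves_pos
  nlinarith

/-- `L'/L` is bounded on `Re s ≥ 3/2`, uniformly in the character. -/
lemma exists_logDeriv_bound : ∃ K : ℝ, 0 < K ∧ ∀ (N : ℕ) [NeZero N] (χ : DirichletCharacter ℂ N)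
    (s : ℂ), 3 / 2 ≤ s.re → ‖logDeriv χ.LFunction s‖ ≤ K := by
  have hsum := (ArithmeticFunction.LSeriesSummable_vonMangoldt
    (s := ((3 / 2 : ℝ) : ℂ)) (by norm_num)).norm
  refine ⟨(∑' n, ‖LSeries.term (fun n => (ArithmeticFunction.vonMangoldt n : ℂ))
    ((3 / 2 : ℝ) : ℂ) n‖) + 1, by positivity, fun N _ χ s hs => ?_⟩
  have hs1 : 1 < s.re := by linarith
  have h := DirichletCharacter.LSeries_twist_vonMangoldt_eq χ hs1
  have hL : χ.LFunction =ᶠ[𝓝 s] LSeries (fun n => χ n) := by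
    filter_upwards [(isOpen_lt continuous_const continuous_re).mem_nhds hs1] with w hw
    exact χ.LFunction_eq_LSeries hw
  have h2 : ‖logDeriv χ.LFunction s‖
      = ‖LSeries ((fun n : ℕ => χ n) * fun n => (ArithmeticFunction.vonMangoldt n : ℂ)) s‖ := by
    rw [logDeriv_apply, hL.deriv_eq, hL.eq_of_nhds, h, neg_div, norm_neg]
  rw [h2]
  refine le_trans (tsum_of_norm_bounded hsum.hasSum fun n => ?_) (le_add_of_nonneg_right zero_le_one)
  refine (LSeries.norm_term_le s (f := _) (g := fun n => (ArithmeticFunction.vonMangoldt n : ℂ))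
    ?_).trans ?_
  · rw [Pi.mul_apply, norm_mul]
    exact mul_le_of_le_one_left (norm_nonneg _) (χ.norm_le_one _)
  · exact LSeries.norm_term_le_of_re_le_re _ (by simpa using hs) n

/-- If `L(s, χ)` has no zeros to the right of `1/2 + δ` up to height `T + 2`, then `1/L` and `L'/L`
are polynomially bounded in the conductor to the right of `1/2 + 2δ` up to height `T`: apply
Borel–Carathéodory on a disc centred at real part `2` that stays in the zero-free region. -/
lemma exists_inv_logDeriv_bound {δ T : ℝ} (hδ : 0 < δ) (hδ1 : δ ≤ 1 / 4) (hT : 0 ≤ T) :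
    ∃ (A : ℝ) (m : ℕ), 0 < A ∧ ∀ (N : ℕ) [NeZero N] (χ : DirichletCharacter ℂ N), χ ≠ 1 →
      (∀ ν : ℂ, δ ≤ ν.re → |ν.im| ≤ T + 2 → χ.LFunction (1 / 2 + ν) ≠ 0) →
      ∀ ν : ℂ, 2 * δ ≤ ν.re → |ν.im| ≤ T →
        ‖(χ.LFunction (1 / 2 + ν))⁻¹‖ ≤ A * (N : ℝ) ^ m ∧
        ‖logDeriv χ.LFunction (1 / 2 + ν)‖ ≤ A * (N : ℝ) ^ m := by
  obtain ⟨K, hK0, hK⟩ := exists_logDeriv_bound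
  have hZ := one_le_zetaThreeHalves
  set Z := zetaThreeHalves with hZdef
  set E := 4 * (T + 4) * Z with hE
  have hE16 : 16 ≤ E := by nlinarith
  set m := ⌈3 / δ⌉₊ with hm
  have hm3 : 3 / δ ≤ m := Nat.le_ceil _
  have hm1 : 1 ≤ m := Nat.one_le_ceil_iff.2 (by positivity)
  refine ⟨Z * E ^ m + 12 * E / δ ^ 2 + K + Z, m, by positivity, fun N _ χ hχ h0 ν hν hνT => ?_⟩
  have hN1 : (1 : ℝ) ≤ N := by exact_mod_cast NeZero.one_le
  have hNm : (1 : ℝ) ≤ (N : ℝ) ^ m := one_le_pow₀ hN1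
  have hNNm : (N : ℝ) ≤ (N : ℝ) ^ m := le_self_pow₀ hN1 (by omega)
  have hp1 : 0 ≤ Z * E ^ m := by positivity
  have hp2 : 0 ≤ 12 * E / δ ^ 2 := by positivity
  have hinvZ : ∀ s : ℂ, 3 / 2 ≤ s.re → ‖(χ.LFunction s)⁻¹‖ ≤ Z := by
    intro s hs
    have h := one_le_mul_norm_LFunction χ hs
    rw [norm_inv]
    have hp : 0 < ‖χ.LFunction s‖ := by
      by_contra h1
      have h2 : ‖χ.LFunction s‖ = 0 := le_antisymm (not_lt.1 h1) (norm_nonneg _)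
      rw [h2, mul_zero] at h
      linarith
    rwa [inv_le_iff_one_le_mul₀ hp]
  rcases le_or_gt 1 ν.re with h1 | h1
  · have hre : 3 / 2 ≤ (1 / 2 + ν).re := by simp; linarith
    constructor
    · refine (hinvZ _ hre).trans ?_
      nlinarith
    · refine (hK N χ _ hre).trans ?_
      nlinarith
  · set c : ℂ := 2 + ν.im * I with hc
    have hcre : c.re = 2 := by simp [hc]
    have hcim : c.im = ν.im := by simp [hc]
    set R := 3 / 2 - δ with hR
    set B := Real.log (E * N) with hB
    have hEN : 1 < E * N := by nlinarith
    have hB0 : 0 < B := Real.log_pos hEN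
    have hexpB : Real.exp B = E * N := Real.exp_log (by linarith)
    have hzc : ∀ z ∈ ball c R, 1 / 2 + δ ≤ z.re ∧ |z.im| ≤ T + 2 ∧ ‖z‖ ≤ T + 4 := by
      intro z hz
      rw [mem_ball, dist_eq_norm] at hz
      have h2 := (abs_le.1 ((abs_re_le_norm (z - c)).trans hz.le)).1
      have h3 := (abs_im_le_norm (z - c)).trans hz.le
      rw [sub_re, hcre] at h2
      rw [sub_im, hcim] at h3
      have h4 := abs_sub_abs_le_abs_sub z.im ν.im
      have h5 : ‖z‖ ≤ ‖z - c‖ + ‖c‖ := by simpa using norm_add_le (z - c) c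
      have h6 : ‖c‖ ≤ 2 + |ν.im| := by
        rw [hc]
        refine (norm_add_le _ _).trans ?_
        simp
      exact ⟨by linarith, by linarith, by linarith⟩
    have hne : ∀ z ∈ ball c R, χ.LFunction z ≠ 0 := by
      intro z hz
      obtain ⟨h2, h3, -⟩ := hzc z hz
      have := h0 (z - 1 / 2) (by simp; linarith) (by simpa using h3)
      rwa [add_sub_cancel] at this
    have hLc := one_le_mul_norm_LFunction χ (s := c) (by rw [hcre]; norm_num)
    have hgrow : ∀ z ∈ ball c R, ‖χ.LFunction z‖ ≤ Real.exp B * ‖χ.LFunction c‖ := by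
      intro z hz
      obtain ⟨h2, h3, h4⟩ := hzc z hz
      rw [hexpB]
      calc ‖χ.LFunction z‖ ≤ 4 * N * ‖z‖ := norm_LFunction_le_of_half_le hχ (by linarith)
        _ ≤ 4 * N * (T + 4) * 1 := by rw [mul_one]; gcongr
        _ ≤ 4 * N * (T + 4) * (Z * ‖χ.LFunction c‖) := by gcongr
        _ = _ := by rw [hE]; ring
    have hLd : DifferentiableOn ℂ χ.LFunction (ball c R) :=
      (DirichletCharacter.differentiable_LFunction hχ).differentiableOn
    have hR0 : 0 < R := by rw [hR]; linarith
    have hsc : ‖1 / 2 + ν - c‖ = 3 / 2 - ν.re := by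
      have e : 1 / 2 + ν - c = ((ν.re - 3 / 2 : ℝ) : ℂ) := by
        apply Complex.ext
        · simp [hcre]; ring
        · simp [hcim]
      rw [e, norm_real, Real.norm_eq_abs, abs_of_neg (by linarith)]
      ring
    have hsR : 1 / 2 + ν ∈ ball c R := by
      rw [mem_ball, dist_eq_norm, hsc, hR]; linarith
    constructor
    · obtain ⟨f, -, hf, hfb⟩ := exists_log_of_ne_zero hB0 hR0 hLd hne hgrow
      have h2 := hfb _ hsR
      rw [hsc] at h2
      have h3 : ‖f (1 / 2 + ν)‖ ≤ m * B := by
        calc ‖f (1 / 2 + ν)‖ ≤ 2 * B * (3 / 2 - ν.re) / (R - (3 / 2 - ν.re)) := h2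
          _ ≤ 2 * B * (3 / 2) / δ := by
            gcongr
            · linarith
            · rw [hR]; linarith
          _ = 3 / δ * B := by ring
          _ ≤ m * B := by gcongr
      rw [hf _ hsR, mul_inv, norm_mul, ← Complex.exp_neg]
      calc ‖(χ.LFunction c)⁻¹‖ * ‖exp (-f (1 / 2 + ν))‖ ≤ Z * Real.exp (m * B) := by
            gcongr
            · exact hinvZ c (by rw [hcre]; norm_num)
            · rw [norm_exp, neg_re]
              gcongr
              exact (neg_le_abs _).trans ((abs_re_le_norm _).trans h3)
        _ = Z * E ^ m * (N : ℝ) ^ m := by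
            rw [Real.exp_nat_mul, hexpB, mul_pow, mul_assoc]
        _ ≤ _ := by gcongr; linarith
    · have h2 := norm_logDeriv_le_of_ne_zero hB0 (r := 3 / 2 - 2 * δ) (by linarith)
        (by rw [hR]; linarith) hLd hne hgrow (z := 1 / 2 + ν) (by
          rw [mem_closedBall, dist_eq_norm, hsc]; linarith)
      have e : R - (3 / 2 - 2 * δ) = δ := by rw [hR]; ring
      rw [e] at h2
      have hBE : B ≤ E * N := by
        have := Real.log_le_sub_one_of_pos (show 0 < E * N by linarith)
        linarith
      calc _ ≤ 8 * B * R / δ ^ 2 := h2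
        _ ≤ 8 * (E * N) * (3 / 2) / δ ^ 2 := by
          gcongr
          rw [hR]; linarith
        _ = 12 * E / δ ^ 2 * N := by ring
        _ ≤ 12 * E / δ ^ 2 * (N : ℝ) ^ m := by gcongr
        _ ≤ _ := by gcongr; linarith

/-- The weighted sum of `L'/L(1/2 + r, χ_α)` over the family. -/
noncomputable def logDerivSum (w : 𝓢(ℝ, ℝ)) (X : ℝ) (r : ℂ) : ℂ :=
  ∑' α : family, (w ((nrm α.1 : ℝ) / X) : ℂ) * logDeriv (cubicChar α).LFunction (1 / 2 + r)

/-- Nonvanishing to the right of `1/2 + δ` up to height `T` of all `L`-functions in the family that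
carry nonzero weight. -/
def NonvanishingUpTo (w : 𝓢(ℝ, ℝ)) (X δ T : ℝ) : Prop :=
  ∀ ν : ℂ, δ ≤ ν.re → |ν.im| ≤ T → ∀ α : family, w ((nrm α.1 : ℝ) / X) ≠ 0 →
    (cubicChar α).LFunction (1 / 2 + ν) ≠ 0

variable {w : 𝓢(ℝ, ℝ)} {X δ T : ℝ}

lemma differentiable_cubic (α : family) : Differentiable ℂ (cubicChar α).LFunction :=
  DirichletCharacter.differentiable_LFunction (cubicChar_ne_one α)

/-- The polynomial bound for `L'/L`, against the decay of the weight, makes the sum over the family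
locally uniformly convergent. -/
lemma differentiableOn_logDerivSum (hX : 0 < X) (hδ : 0 < δ) (hδ1 : δ ≤ 1 / 4) (hT : 0 ≤ T)
    (h : NonvanishingUpTo w X δ (T + 2)) :
    DifferentiableOn ℂ (logDerivSum w X) {r | 2 * δ < r.re ∧ |r.im| < T} := by
  obtain ⟨A, m, hA, hb⟩ := exists_inv_logDeriv_bound hδ hδ1 hT
  have hopen : IsOpen {r : ℂ | 2 * δ < r.re ∧ |r.im| < T} :=
    (isOpen_lt continuous_const continuous_re).inter
      (isOpen_lt (continuous_abs.comp continuous_im) continuous_const)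
  obtain ⟨C, hC0, hC⟩ := exists_weight_majorant w hX m
  refine differentiableOn_tsum_of_summable_norm
    ((summable_family_inv_sq.mul_left C).mul_left A) (fun α => ?_) hopen fun α r hr => ?_
  · by_cases hw : w ((nrm α.1 : ℝ) / X) = 0
    · simp only [hw, ofReal_zero, zero_mul]
      exact differentiableOn_const _
    · refine DifferentiableOn.const_mul ?_ _
      intro r hr
      have hL := differentiable_cubic α
      have hLd : Differentiable ℂ (deriv (cubicChar α).LFunction) := fun z =>
        (hL.differentiableOn.deriv isOpen_univ).differentiableAt univ_mem
      have hne := h r (by linarith [hr.1]) (by linarith [hr.2]) α hw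
      have h1 : DifferentiableAt ℂ (logDeriv (cubicChar α).LFunction) (1 / 2 + r) :=
        (hLd _).div (hL _) hne
      exact (DifferentiableAt.comp r (g := logDeriv (cubicChar α).LFunction) h1
        (differentiableAt_id.const_add _)).differentiableWithinAt
  · rw [norm_mul, norm_real, Real.norm_eq_abs]
    by_cases hw : w ((nrm α.1 : ℝ) / X) = 0
    · rw [hw, abs_zero, zero_mul]; positivity
    · have h1 := (hb _ (cubicChar α) (cubicChar_ne_one α) (fun ν h1 h2 => h ν h1 h2 α hw) r
        hr.1.le hr.2.le).2
      calc _ ≤ |w ((nrm α.1 : ℝ) / X)| * (A * (nrm α.1 : ℝ) ^ m) := by gcongr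
        _ = A * (|w ((nrm α.1 : ℝ) / X)| * (nrm α.1 : ℝ) ^ m) := by ring
        _ ≤ _ := mul_le_mul_of_nonneg_left (hC α) hA.le

/-- Differentiating the ratio at the diagonal gives the logarithmic derivative. -/
lemma ratioSum_deriv (hX : 0 < X) (hδ : 0 < δ) (hδ1 : δ ≤ 1 / 4) (hT : 0 ≤ T)
    (h : NonvanishingUpTo w X δ (T + 2)) {ν : ℂ} (hν : 2 * δ ≤ ν.re) (hνT : |ν.im| ≤ T) :
    DifferentiableOn ℂ (fun ν' => ratioSum w X ν' ν) (ball ν (2 * δ)) ∧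
      deriv (fun ν' => ratioSum w X ν' ν) ν = logDerivSum w X ν := by
  obtain ⟨A, m, hA, hb⟩ := exists_inv_logDeriv_bound hδ hδ1 hT
  obtain ⟨C, hC0, hC⟩ := exists_weight_majorant w hX (m + 1)
  set D := 4 * (1 / 2 + ‖ν‖ + 2 * δ) with hD
  have hdterm : ∀ α : family, Differentiable ℂ fun ν' : ℂ => (w ((nrm α.1 : ℝ) / X) : ℂ) *
      ((cubicChar α).LFunction (1 / 2 + ν') / (cubicChar α).LFunction (1 / 2 + ν)) := by
    intro α
    have := (differentiable_cubic α).comp (differentiable_id.const_add (1 / 2 : ℂ))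
    exact (this.div_const _).const_mul _
  have hu : Summable fun α : family => A * D * (C * ((nrm α.1 : ℝ) ^ 2)⁻¹) :=
    (summable_family_inv_sq.mul_left C).mul_left (A * D)
  have hbound : ∀ (α : family) (ν' : ℂ), ν' ∈ ball ν (2 * δ) → ‖(w ((nrm α.1 : ℝ) / X) : ℂ) *
      ((cubicChar α).LFunction (1 / 2 + ν') / (cubicChar α).LFunction (1 / 2 + ν))‖
        ≤ A * D * (C * ((nrm α.1 : ℝ) ^ 2)⁻¹) := by
    intro α ν' hν'
    rw [norm_mul, norm_real, Real.norm_eq_abs]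
    by_cases hw : w ((nrm α.1 : ℝ) / X) = 0
    · rw [hw, abs_zero, zero_mul]; positivity
    · have h1 := (hb _ (cubicChar α) (cubicChar_ne_one α) (fun ν h1 h2 => h ν h1 h2 α hw) ν
        hν hνT).1
      rw [mem_ball, dist_eq_norm] at hν'
      have hre := (abs_le.1 ((abs_re_le_norm (ν' - ν)).trans hν'.le)).1
      rw [sub_re] at hre
      have h2 := norm_LFunction_le_of_half_le (cubicChar_ne_one α) (s := 1 / 2 + ν')
        (by simp; linarith)
      have h3 : ‖(1 / 2 + ν' : ℂ)‖ ≤ 1 / 2 + ‖ν‖ + 2 * δ := by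
        have e : (1 / 2 + ν' : ℂ) = 1 / 2 + ν + (ν' - ν) := by ring
        rw [e]
        refine (norm_add_le _ _).trans (add_le_add ((norm_add_le _ _).trans ?_) hν'.le)
        simp
      have e : ∀ a b : ℂ, ‖a / b‖ = ‖a‖ * ‖b⁻¹‖ := fun a b => by rw [div_eq_mul_inv, norm_mul]
      rw [e]
      calc _ ≤ |w ((nrm α.1 : ℝ) / X)| * ((4 * nrm α.1 * (1 / 2 + ‖ν‖ + 2 * δ))
            * (A * (nrm α.1 : ℝ) ^ m)) := by
            gcongr
            exact h2.trans (by gcongr)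
        _ = A * D * (|w ((nrm α.1 : ℝ) / X)| * (nrm α.1 : ℝ) ^ (m + 1)) := by rw [hD]; ring
        _ ≤ _ := mul_le_mul_of_nonneg_left (hC α) (by positivity)
  refine ⟨differentiableOn_tsum_of_summable_norm hu (fun α => (hdterm α).differentiableOn)
    isOpen_ball hbound, ?_⟩
  have hs := hasSum_deriv_of_summable_norm hu (fun α => (hdterm α).differentiableOn)
    isOpen_ball hbound (mem_ball_self (by positivity))
  rw [logDerivSum]
  refine hs.tsum_eq.symm.trans (tsum_congr fun α => ?_)
  have h1 : HasDerivAt (fun ν' : ℂ => (cubicChar α).LFunction (1 / 2 + ν'))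
      (deriv (cubicChar α).LFunction (1 / 2 + ν)) ν :=
    ((differentiable_cubic α) (1 / 2 + ν)).hasDerivAt.comp_const_add (1 / 2) ν
  rw [((h1.div_const _).const_mul _).deriv, logDeriv_apply]

end

/-! ### The conjectural main term on the diagonal -/

section

open Complex Set Filter Topology MeasureTheory Metric

lemma aCoeff_nonneg (p : ℕ) : 0 ≤ aCoeff p := by
  unfold aCoeff; split_ifs <;> positivity

lemma aCoeff_le_one (p : ℕ) : aCoeff p ≤ 1 := by
  unfold aCoeff
  split_ifs
  · rw [div_le_one (by positivity)]; linarith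
  · exact le_rfl

lemma norm_aCoeff_le (p : ℕ) : ‖(aCoeff p : ℂ)‖ ≤ 1 := by
  rw [norm_real, Real.norm_eq_abs, abs_of_nonneg (aCoeff_nonneg p)]
  exact aCoeff_le_one p

lemma prime_two_le (p : Nat.Primes) : (2 : ℝ) ≤ (p : ℕ) := by exact_mod_cast p.2.two_le

lemma prime_ne_zero (p : Nat.Primes) : ((p : ℕ) : ℂ) ≠ 0 := Nat.cast_ne_zero.2 p.2.ne_zero

lemma norm_prime_cpow (p : Nat.Primes) (z : ℂ) : ‖((p : ℕ) : ℂ) ^ z‖ = ((p : ℕ) : ℝ) ^ z.re :=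
  norm_natCast_cpow_of_pos p.2.pos z

lemma two_le_prime_rpow (p : Nat.Primes) {x : ℝ} (hx : 1 ≤ x) : 2 ≤ ((p : ℕ) : ℝ) ^ x :=
  (prime_two_le p).trans (Real.self_le_rpow_of_one_le (by linarith [prime_two_le p]) hx)

lemma half_rpow_le_norm_sub_one (p : Nat.Primes) {z : ℂ} {x : ℝ} (hx : 1 ≤ x) (hz : x ≤ z.re) :
    ((p : ℕ) : ℝ) ^ x / 2 ≤ ‖((p : ℕ) : ℂ) ^ z - 1‖ := by
  have h1 := norm_sub_norm_le (((p : ℕ) : ℂ) ^ z) 1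
  rw [norm_prime_cpow, norm_one] at h1
  have h2 := two_le_prime_rpow p hx
  have h3 : ((p : ℕ) : ℝ) ^ x ≤ ((p : ℕ) : ℝ) ^ z.re :=
    Real.rpow_le_rpow_of_exponent_le (by linarith [prime_two_le p]) hz
  linarith

lemma prime_cpow_sub_one_ne_zero (p : Nat.Primes) {z : ℂ} (hz : 1 ≤ z.re) :
    ((p : ℕ) : ℂ) ^ z - 1 ≠ 0 := by
  rw [← norm_pos_iff]
  have h1 := half_rpow_le_norm_sub_one p hz le_rfl
  have h2 := two_le_prime_rpow p hz
  linarith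

lemma norm_inv_prime_cpow_sub_one_le (p : Nat.Primes) {z : ℂ} {x : ℝ} (hx : 1 ≤ x)
    (hz : x ≤ z.re) : ‖(((p : ℕ) : ℂ) ^ z - 1)⁻¹‖ ≤ 2 * ((p : ℕ) : ℝ) ^ (-x) := by
  have h1 := half_rpow_le_norm_sub_one p hx hz
  have h2 := two_le_prime_rpow p hx
  rw [norm_inv, Real.rpow_neg (Nat.cast_nonneg _), ← div_eq_mul_inv, ← inv_div]
  exact inv_anti₀ (by linarith) h1

lemma log_prime_le (p : Nat.Primes) : Real.log (p : ℕ) ≤ 8 * ((p : ℕ) : ℝ) ^ (1 / 8 : ℝ) := by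
  have := Real.log_le_rpow_div (Nat.cast_nonneg (p : ℕ)) (show (0 : ℝ) < 1 / 8 by norm_num)
  linarith

lemma log_prime_nonneg (p : Nat.Primes) : 0 ≤ Real.log (p : ℕ) := Real.log_natCast_nonneg _

lemma summable_prime_rpow : Summable fun p : Nat.Primes => ((p : ℕ) : ℝ) ^ (-(5 / 4) : ℝ) :=
  Nat.Primes.summable_rpow.2 (by norm_num)

/-- The logarithmic derivative of the conjectural main term on the diagonal,
`-∑ a(p) log p / (p ^ (3/2 + 3r) - 1)`. -/
noncomputable def primeSum (r : ℂ) : ℂ :=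
  ∑' p : Nat.Primes, -((aCoeff p * Real.log p : ℝ) : ℂ) * (((p : ℕ) : ℂ) ^ (3 / 2 + 3 * r) - 1)⁻¹

lemma norm_primeSum_term_le (p : Nat.Primes) {r : ℂ} (hr : -1 / 24 ≤ r.re) :
    ‖-((aCoeff p * Real.log p : ℝ) : ℂ) * (((p : ℕ) : ℂ) ^ (3 / 2 + 3 * r) - 1)⁻¹‖
      ≤ 16 * ((p : ℕ) : ℝ) ^ (-(5 / 4) : ℝ) := by
  have h1 := norm_inv_prime_cpow_sub_one_le p (z := 3 / 2 + 3 * r) (x := 11 / 8) (by norm_num)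
    (by simp; linarith)
  have h2 := log_prime_le p
  have h3 := log_prime_nonneg p
  have hp : (0 : ℝ) < (p : ℕ) := Nat.cast_pos.2 p.2.pos
  rw [norm_mul, norm_neg, norm_real, Real.norm_eq_abs, abs_mul, abs_of_nonneg (aCoeff_nonneg _),
    abs_of_nonneg h3]
  calc _ ≤ 1 * (8 * ((p : ℕ) : ℝ) ^ (1 / 8 : ℝ)) * (2 * ((p : ℕ) : ℝ) ^ (-(11 / 8) : ℝ)) := by
        gcongr
        exact aCoeff_le_one _
    _ = 16 * (((p : ℕ) : ℝ) ^ (1 / 8 : ℝ) * ((p : ℕ) : ℝ) ^ (-(11 / 8) : ℝ)) := by ring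
    _ = _ := by rw [← Real.rpow_add hp]; norm_num

lemma exists_norm_primeSum_le : ∃ K : ℝ, 0 < K ∧ ∀ r : ℂ, -1 / 24 ≤ r.re → ‖primeSum r‖ ≤ K := by
  refine ⟨(∑' p : Nat.Primes, 16 * ((p : ℕ) : ℝ) ^ (-(5 / 4) : ℝ)) + 1, ?_, fun r hr => ?_⟩
  · have : 0 ≤ ∑' p : Nat.Primes, 16 * ((p : ℕ) : ℝ) ^ (-(5 / 4) : ℝ) :=
      tsum_nonneg fun p => by positivity
    linarith
  · exact (tsum_of_norm_bounded (summable_prime_rpow.mul_left 16).hasSum fun p =>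
      norm_primeSum_term_le p hr).trans (by linarith)

lemma differentiableOn_primeSum : DifferentiableOn ℂ primeSum {r | -1 / 24 < r.re} := by
  refine differentiableOn_tsum_of_summable_norm (summable_prime_rpow.mul_left 16) (fun p => ?_)
    (isOpen_lt continuous_const continuous_re) fun p r hr => norm_primeSum_term_le p (le_of_lt hr)
  intro r hr
  have hr' : -1 / 24 < r.re := hr
  have h1 : DifferentiableAt ℂ (fun r : ℂ => ((p : ℕ) : ℂ) ^ (3 / 2 + 3 * r) - 1) r :=
    ((by fun_prop : DifferentiableAt ℂ (fun r : ℂ => 3 / 2 + 3 * r) r).const_cpow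
      (Or.inl (prime_ne_zero p))).sub_const _
  exact ((h1.inv (prime_cpow_sub_one_ne_zero p (by simp; linarith))).const_mul
    _).differentiableWithinAt

lemma conj_primeSum (r : ℂ) : starRingEnd ℂ (primeSum r) = primeSum (starRingEnd ℂ r) := by
  rw [primeSum, conj_tsum]
  refine tsum_congr fun p => ?_
  rw [map_mul, map_neg, conj_ofReal, map_inv₀, map_sub, map_one, conj_natCast_cpow]
  simp [map_ofNat]

/-- The double series of the main term, with its inner geometric series summed. -/
lemma tsum_tsum_eq_neg_primeSum {r : ℂ} (hr : r.re = 0) :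
    ∑' (ℓ : ℕ+) (p : Nat.Primes), ((aCoeff p * Real.log p : ℝ) : ℂ) /
      ((p : ℕ) : ℂ) ^ ((ℓ : ℕ) * (3 / 2 + 3 * r)) = -primeSum r := by
  set P : Nat.Primes → ℂ := fun p => ((p : ℕ) : ℂ) ^ (3 / 2 + 3 * r) with hP
  have hPn : ∀ p, ‖P p‖ = ((p : ℕ) : ℝ) ^ (3 / 2 : ℝ) := by
    intro p
    simp only [hP]
    rw [norm_prime_cpow]
    congr 1
    simp [hr]
  have hP2 : ∀ p, 2 ≤ ‖P p‖ := fun p => by rw [hPn]; exact two_le_prime_rpow p (by norm_num)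
  have hPow : ∀ (ℓ : ℕ) (p : Nat.Primes), ((p : ℕ) : ℂ) ^ (ℓ * (3 / 2 + 3 * r)) = P p ^ ℓ := by
    intro ℓ p
    rw [cpow_nat_mul]
  simp_rw [hPow]
  have hsum : Summable (Function.uncurry fun (ℓ : ℕ) (p : Nat.Primes) =>
      ((aCoeff p * Real.log p : ℝ) : ℂ) / P p ^ (ℓ + 1)) := by
    have h1 : Summable fun k : ℕ × Nat.Primes =>
        (1 / 2 : ℝ) ^ k.1 * (8 * ((k.2 : ℕ) : ℝ) ^ (-(5 / 4) : ℝ) : ℝ) :=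
      (summable_geometric_of_lt_one (by norm_num) (by norm_num)).mul_of_nonneg
        (summable_prime_rpow.mul_left 8) (fun _ => by positivity) (fun _ => by positivity)
    refine Summable.of_norm_bounded h1 fun ⟨ℓ, p⟩ => ?_
    have hp : (0 : ℝ) < (p : ℕ) := Nat.cast_pos.2 p.2.pos
    have h3 := log_prime_nonneg p
    simp only [Function.uncurry]
    rw [norm_div, norm_pow, norm_real, Real.norm_eq_abs, abs_mul, abs_of_nonneg (aCoeff_nonneg _),
      abs_of_nonneg h3, pow_succ]
    have h4 : ((p : ℕ) : ℝ) ^ (1 / 8 : ℝ) ≤ ((p : ℕ) : ℝ) ^ (-(5 / 4) : ℝ) * ‖P p‖ := by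
      rw [hPn, ← Real.rpow_add hp]
      exact Real.rpow_le_rpow_of_exponent_le (by linarith [prime_two_le p]) (by norm_num)
    have h5 : (1 : ℝ) ≤ (1 / 2) ^ ℓ * ‖P p‖ ^ ℓ := by
      rw [← mul_pow]
      exact one_le_pow₀ (by linarith [hP2 p])
    have h6 : 0 < ‖P p‖ := by linarith [hP2 p]
    rw [div_le_iff₀ (by positivity)]
    calc aCoeff p * Real.log (p : ℕ) ≤ 1 * (8 * ((p : ℕ) : ℝ) ^ (1 / 8 : ℝ)) := by
          gcongr
          · exact aCoeff_le_one _
          · exact log_prime_le p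
      _ ≤ 1 * (8 * (((p : ℕ) : ℝ) ^ (-(5 / 4) : ℝ) * ‖P p‖)) := by gcongr
      _ ≤ ((1 / 2) ^ ℓ * ‖P p‖ ^ ℓ) * (8 * (((p : ℕ) : ℝ) ^ (-(5 / 4) : ℝ) * ‖P p‖)) := by gcongr
      _ = _ := by ring
  rw [tsum_pnat_eq_tsum_succ (f := fun ℓ : ℕ => ∑' p : Nat.Primes,
    ((aCoeff p * Real.log p : ℝ) : ℂ) / P p ^ ℓ), ← hsum.tsum_comm, primeSum, ← tsum_neg]
  refine tsum_congr fun p => ?_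
  have hp0 : P p ≠ 0 := by
    rw [← norm_pos_iff]; linarith [hP2 p]
  have hlt : ‖(P p)⁻¹‖ < 1 := by
    rw [norm_inv]
    exact inv_lt_one_of_one_lt₀ (by linarith [hP2 p])
  have h1 : ∀ ℓ : ℕ, ((aCoeff p * Real.log p : ℝ) : ℂ) / P p ^ (ℓ + 1)
      = ((aCoeff p * Real.log p : ℝ) : ℂ) * (P p)⁻¹ * (P p)⁻¹ ^ ℓ := by
    intro ℓ
    rw [pow_succ', inv_pow]
    field_simp
  simp_rw [h1]
  rw [tsum_mul_left, tsum_geometric_of_norm_lt_one hlt, neg_mul, neg_neg, mul_assoc, ← mul_inv,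
    mul_sub, mul_one, mul_inv_cancel₀ hp0]

/-- The Euler product appearing in the Ratios Conjecture after cancelling the zeta factors. -/
noncomputable def eulerProd (ν' ν : ℂ) : ℂ :=
  ∏' p : Nat.Primes, (1 + (aCoeff p : ℂ) *
      ((1 - ((p : ℕ) : ℂ) ^ (ν' - ν)) / (((p : ℕ) : ℂ) ^ (3 / 2 + 3 * ν') - 1)))

lemma prediction_eq_eulerProd {ν' ν : ℂ} (h1 : 0 ≤ ν'.re) (h2 : 0 ≤ ν.re) :
    riemannZeta (3 / 2 + 3 * ν') / riemannZeta (3 / 2 + 2 * ν' + ν) * eulerA ν' ν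
      = eulerProd ν' ν := by
  have z1 : riemannZeta (3 / 2 + 3 * ν') ≠ 0 :=
    riemannZeta_ne_zero_of_one_le_re (by simp; linarith)
  have z2 : riemannZeta (3 / 2 + 2 * ν' + ν) ≠ 0 :=
    riemannZeta_ne_zero_of_one_le_re (by simp; linarith)
  rw [eulerA, ← mul_assoc, div_mul_div_cancel₀ z2, div_self z1, one_mul, eulerProd]

/-- On the diagonal `ν' = ν` every Euler factor equals `1`, so the derivative of the product is the sum of
the derivatives of its factors. -/
lemma eulerProd_deriv {δ : ℝ} (hδ : 0 < δ) (hδ1 : δ ≤ 1 / 16) {ν : ℂ} (hν : 2 * δ ≤ ν.re) :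
    DifferentiableOn ℂ (fun ν' => eulerProd ν' ν) (ball ν (2 * δ)) ∧
      deriv (fun ν' => eulerProd ν' ν) ν = primeSum ν := by
  set u : Nat.Primes → ℂ → ℂ := fun p ν' => (aCoeff p : ℂ) *
      ((1 - ((p : ℕ) : ℂ) ^ (ν' - ν)) / (((p : ℕ) : ℂ) ^ (3 / 2 + 3 * ν') - 1)) with hu
  have hre : ∀ ν' ∈ ball ν (2 * δ), 0 ≤ ν'.re ∧ (ν' - ν).re ≤ 1 / 8 := by
    intro ν' h
    rw [mem_ball, dist_eq_norm] at h
    have h3 := abs_le.1 ((abs_re_le_norm (ν' - ν)).trans h.le)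
    have h4 := h3.1
    rw [sub_re] at h4
    exact ⟨by linarith, by linarith [h3.2]⟩
  have hd : ∀ p, ∀ ν' : ℂ, 0 ≤ ν'.re → DifferentiableAt ℂ (u p) ν' := by
    intro p ν' h
    have e1 : DifferentiableAt ℂ (fun r : ℂ => ((p : ℕ) : ℂ) ^ (3 / 2 + 3 * r) - 1) ν' :=
      ((by fun_prop : DifferentiableAt ℂ (fun r : ℂ => 3 / 2 + 3 * r) ν').const_cpow
        (Or.inl (prime_ne_zero p))).sub_const _
    have e2 : DifferentiableAt ℂ (fun r : ℂ => 1 - ((p : ℕ) : ℂ) ^ (r - ν)) ν' :=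
      ((by fun_prop : DifferentiableAt ℂ (fun r : ℂ => r - ν) ν').const_cpow
        (Or.inl (prime_ne_zero p))).const_sub _
    exact (e2.div e1 (prime_cpow_sub_one_ne_zero p (by simp; linarith))).const_mul _
  have hdo : ∀ p, DifferentiableOn ℂ (u p) (ball ν (2 * δ)) := fun p ν' h =>
    (hd p ν' (hre ν' h).1).differentiableWithinAt
  have hb : ∀ p, ∀ ν' ∈ ball ν (2 * δ), ‖u p ν'‖ ≤ 4 * ((p : ℕ) : ℝ) ^ (-(5 / 4) : ℝ) := by
    intro p ν' h
    obtain ⟨h1, h2⟩ := hre ν' h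
    have hp := prime_two_le p
    have h3 := norm_inv_prime_cpow_sub_one_le p (z := 3 / 2 + 3 * ν') (x := 11 / 8) (by norm_num)
      (by simp; linarith)
    have h4 : ‖1 - ((p : ℕ) : ℂ) ^ (ν' - ν)‖ ≤ 2 * ((p : ℕ) : ℝ) ^ (1 / 8 : ℝ) := by
      refine (norm_sub_le _ _).trans ?_
      rw [norm_one, norm_prime_cpow]
      have h5 : ((p : ℕ) : ℝ) ^ (ν' - ν).re ≤ ((p : ℕ) : ℝ) ^ (1 / 8 : ℝ) :=
        Real.rpow_le_rpow_of_exponent_le (by linarith) h2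
      have h6 : (1 : ℝ) ≤ ((p : ℕ) : ℝ) ^ (1 / 8 : ℝ) :=
        Real.one_le_rpow (by linarith) (by norm_num)
      linarith
    have e : ‖u p ν'‖ = ‖(aCoeff p : ℂ)‖ * (‖1 - ((p : ℕ) : ℂ) ^ (ν' - ν)‖
        * ‖(((p : ℕ) : ℂ) ^ (3 / 2 + 3 * ν') - 1)⁻¹‖) := by
      simp only [hu]
      rw [norm_mul, div_eq_mul_inv, norm_mul]
    rw [e]
    calc _ ≤ 1 * (2 * ((p : ℕ) : ℝ) ^ (1 / 8 : ℝ) * (2 * ((p : ℕ) : ℝ) ^ (-(11 / 8) : ℝ))) := by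
          gcongr
          exact norm_aCoeff_le _
      _ = 4 * (((p : ℕ) : ℝ) ^ (1 / 8 : ℝ) * ((p : ℕ) : ℝ) ^ (-(11 / 8) : ℝ)) := by ring
      _ = _ := by rw [← Real.rpow_add (by linarith)]; norm_num
  have hsum := summable_prime_rpow.mul_left 4
  have hmul := Summable.hasProdLocallyUniformlyOn_one_add (f := u) isOpen_ball hsum
    (Eventually.of_forall hb) fun p => (hdo p).continuousOn
  have hνm : ν ∈ ball ν (2 * δ) := mem_ball_self (by positivity)
  have hu0 : ∀ p, u p ν = 0 := fun p => by simp [hu]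
  have hderiv : ∀ p, deriv (u p) ν
      = -((aCoeff p * Real.log p : ℝ) : ℂ) * (((p : ℕ) : ℂ) ^ (3 / 2 + 3 * ν) - 1)⁻¹ := by
    intro p
    have e1 : DifferentiableAt ℂ (fun r : ℂ => (((p : ℕ) : ℂ) ^ (3 / 2 + 3 * r) - 1)⁻¹) ν :=
      (((by fun_prop : DifferentiableAt ℂ (fun r : ℂ => 3 / 2 + 3 * r) ν).const_cpow
        (Or.inl (prime_ne_zero p))).sub_const _).inv
          (prime_cpow_sub_one_ne_zero p (by simp; linarith))
    have e2 : HasDerivAt (fun r : ℂ => 1 - ((p : ℕ) : ℂ) ^ (r - ν))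
        (-(((p : ℕ) : ℂ) ^ (ν - ν) * Complex.log (p : ℕ) * 1)) ν :=
      (((hasDerivAt_id ν).sub_const ν).const_cpow (Or.inl (prime_ne_zero p))).const_sub 1
    have e3 := (e2.mul e1.hasDerivAt).const_mul (aCoeff p : ℂ)
    have e4 : u p = fun y => (aCoeff p : ℂ) * (((fun r : ℂ => 1 - ((p : ℕ) : ℂ) ^ (r - ν)) *
        fun r : ℂ => (((p : ℕ) : ℂ) ^ (3 / 2 + 3 * r) - 1)⁻¹) y) := by
      ext y
      simp only [hu, Pi.mul_apply, div_eq_mul_inv]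
    rw [e4, e3.deriv]
    simp only [sub_self, cpow_zero, zero_mul, add_zero, mul_one, one_mul]
    push_cast
    ring
  refine ⟨?_, ?_⟩
  · refine TendstoLocallyUniformlyOn.differentiableOn hmul (Eventually.of_forall fun s => ?_)
      isOpen_ball
    exact DifferentiableOn.fun_finsetProd fun p _ => (hdo p).const_add 1
  · have hlog := logDeriv_tprod_eq_tsum (f := fun p ν' => 1 + u p ν') isOpen_ball hνm
      (fun p => by simp [hu0]) (fun p => (hdo p).const_add 1) (by
        refine Summable.of_norm_bounded (summable_prime_rpow.mul_left 16) fun p => ?_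
        rw [logDeriv_apply, deriv_const_add, hu0, add_zero, div_one, hderiv]
        exact norm_primeSum_term_le p (by linarith)) ⟨_, hmul⟩ (by simp [hu0])
    rw [logDeriv_apply] at hlog
    have e : ∏' p, (1 + u p ν) = 1 := by simp [hu0]
    rw [e, div_one] at hlog
    refine hlog.trans (tsum_congr fun p => ?_)
    rw [logDeriv_apply, deriv_const_add, hu0, add_zero, div_one, hderiv]

end

/-! ### Consequences of the Ratios Conjecture -/

section

open Complex Set Filter Topology MeasureTheory Metric

/-- The Ratios Conjecture, differentiated on the diagonal by Cauchy's estimate. -/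
lemma RatiosConjecture.logDerivSum_approx {w : 𝓢(ℝ, ℝ)} (hR : RatiosConjecture w) {δ ε : ℝ}
    (hδ : 0 < δ) (hδ1 : δ ≤ 1 / 16) (hε : 0 < ε) (hε1 : ε ≤ 1 / 4) :
    ∃ C : ℝ, 0 < C ∧ ∀ᶠ X : ℝ in atTop, NonvanishingUpTo w X δ (X ^ (1 - 2 * ε) + 2) ∧
      ∀ ν : ℂ, 2 * δ ≤ ν.re → |ν.im| ≤ X ^ (1 - 2 * ε) →
        ‖logDerivSum w X ν - (totalWeight w X : ℂ) * primeSum ν‖ ≤ C * X ^ (1 / 2 + ε) := by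
  obtain ⟨C, hC⟩ := hR δ hδ ε hε
  refine ⟨|C| / δ + 1, by positivity, ?_⟩
  have hgrow : ∀ᶠ X : ℝ in atTop, (2 : ℝ) + 1 ≤ X ^ ε :=
    (tendsto_rpow_atTop hε).eventually_ge_atTop _
  filter_upwards [hC, hgrow, eventually_ge_atTop 1] with X hX hX1 hX2
  have hX0 : 0 < X := by linarith
  set T := X ^ (1 - 2 * ε) with hT
  have hT1 : 1 ≤ T := Real.one_le_rpow hX2 (by linarith)
  have hTX : T + 2 ≤ X ^ (1 - ε) := by
    have e : X ^ (1 - ε) = T * X ^ ε := by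
      rw [hT, ← Real.rpow_add hX0]; ring_nf
    rw [e]
    nlinarith
  have hnv : NonvanishingUpTo w X δ (T + 2) := fun ν h1 h2 α hw =>
    (hX 1 ν (by simp; linarith) h1 (by simp; positivity) (h2.trans hTX)).1 α hw
  refine ⟨hnv, fun ν hν hνT => ?_⟩
  obtain ⟨h1, h2⟩ := ratioSum_deriv hX0 hδ (by linarith) (by linarith) hnv hν hνT
  obtain ⟨h3, h4⟩ := eulerProd_deriv hδ hδ1 hν
  have hsub : closedBall ν δ ⊆ ball ν (2 * δ) := closedBall_subset_ball (by linarith)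
  have hd : DifferentiableOn ℂ (fun ν' => ratioSum w X ν' ν
      - (totalWeight w X : ℂ) * eulerProd ν' ν) (ball ν (2 * δ)) := h1.sub (h3.const_mul _)
  have hdc : DiffContOnCl ℂ (fun ν' => ratioSum w X ν' ν
      - (totalWeight w X : ℂ) * eulerProd ν' ν) (ball ν δ) := by
    refine DifferentiableOn.diffContOnCl (hd.mono ?_)
    exact closure_ball_subset_closedBall.trans hsub
  have hcau := norm_deriv_le_of_forall_mem_sphere_norm_le hδ hdc (C := |C| * X ^ (1 / 2 + ε))
    fun ν' hν' => by
      rw [mem_sphere, dist_eq_norm] at hν'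
      have e1 := (abs_le.1 ((abs_re_le_norm (ν' - ν)).trans hν'.le)).1
      have e2 := (abs_im_le_norm (ν' - ν)).trans hν'.le
      rw [sub_re] at e1
      rw [sub_im] at e2
      have e3 := abs_sub_abs_le_abs_sub ν'.im ν.im
      have h := (hX ν' ν (by linarith) (by linarith) (by linarith) (by linarith)).2
      rw [prediction_eq_eulerProd (by linarith) (by linarith)] at h
      refine h.trans ?_
      gcongr
      exact le_abs_self C
  have hmem : ball ν (2 * δ) ∈ 𝓝 ν := ball_mem_nhds _ (by positivity)
  have hderiv := ((h1.differentiableAt hmem).hasDerivAt.sub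
    ((h3.differentiableAt hmem).hasDerivAt.const_mul (totalWeight w X : ℂ))).deriv
  have e : ((fun ν' => ratioSum w X ν' ν) - fun ν' => (totalWeight w X : ℂ) * eulerProd ν' ν)
      = fun ν' => ratioSum w X ν' ν - (totalWeight w X : ℂ) * eulerProd ν' ν := rfl
  rw [e, h2, h4] at hderiv
  rw [hderiv] at hcau
  refine hcau.trans ?_
  have hp : 0 ≤ X ^ (1 / 2 + ε) := by positivity
  rw [div_eq_mul_inv, mul_right_comm, ← div_eq_mul_inv]
  nlinarith

/-- Moving the part `|Im| ≤ T` of a vertical line of integration to the left. The three terms bound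
the shifted segment, the two horizontal segments and the tails left in place. -/
lemma norm_integral_shift_le {F : ℂ → ℂ} {a b T U V W : ℝ} (hab : a ≤ b) (hT : 0 ≤ T)
    (hF : DifferentiableOn ℂ F (Icc a b ×ℂ Icc (-T) T))
    (hint : Integrable fun y : ℝ => F (b + y * I)) (hU : 0 ≤ U) (hW : 0 ≤ W)
    (h1 : ∀ y : ℝ, |y| ≤ T → ‖F (a + y * I)‖ ≤ U * (1 + y ^ 2)⁻¹)
    (h2 : ∀ x ∈ Icc a b, ∀ y : ℝ, |y| = T → ‖F (x + y * I)‖ ≤ V)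
    (h3 : ∀ y : ℝ, T ≤ |y| → ‖F (b + y * I)‖ ≤ W * (1 + y ^ 2)⁻¹) :
    ‖∫ y : ℝ, F (b + y * I)‖ ≤ Real.pi * U + 2 * ((b - a) * V) + Real.pi * W := by
  have hTT : -T ≤ T := by linarith
  have hsplit := integral_add_compl (measurableSet_Ioc (a := -T) (b := T)) hint
  rw [← intervalIntegral.integral_of_le hTT] at hsplit
  have hset : ∀ (S : Set ℝ) (f : ℝ → ℂ) (c : ℝ), MeasurableSet S → 0 ≤ c →
      (∀ y ∈ S, ‖f y‖ ≤ c * (1 + y ^ 2)⁻¹) → ‖∫ y in S, f y‖ ≤ Real.pi * c := by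
    intro S f c hS hc h
    have hi : Integrable fun y : ℝ => c * (1 + y ^ 2)⁻¹ := integrable_inv_one_add_sq.const_mul c
    calc ‖∫ y in S, f y‖ ≤ ∫ y in S, c * (1 + y ^ 2)⁻¹ :=
          norm_integral_le_of_norm_le hi.integrableOn
            ((ae_restrict_iff' hS).2 (ae_of_all _ fun y hy => h y hy))
      _ ≤ ∫ y, c * (1 + y ^ 2)⁻¹ :=
          setIntegral_le_integral hi (ae_of_all _ fun y => by positivity)
      _ = Real.pi * c := by
          rw [integral_const_mul, integral_univ_inv_one_add_sq, mul_comm]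
  have hleft : ‖∫ y in (-T)..T, F (a + y * I)‖ ≤ Real.pi * U := by
    rw [intervalIntegral.integral_of_le hTT]
    exact hset _ _ _ measurableSet_Ioc hU fun y hy => h1 y (abs_le.2 ⟨hy.1.le, hy.2⟩)
  have htail : ‖∫ y in (Ioc (-T) T)ᶜ, F (b + y * I)‖ ≤ Real.pi * W := by
    refine hset _ _ _ measurableSet_Ioc.compl hW fun y hy => h3 y ?_
    by_contra hlt
    have := abs_lt.1 (not_le.1 hlt)
    exact hy ⟨this.1, this.2.le⟩
  have hhor : ∀ y : ℝ, |y| = T → ‖∫ x in a..b, F (x + y * I)‖ ≤ (b - a) * V := by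
    intro y hy
    have := intervalIntegral.norm_integral_le_of_norm_le_const (a := a) (b := b) (C := V)
      (f := fun x : ℝ => F (x + y * I)) fun x hx => by
        rw [uIoc_of_le hab] at hx
        exact h2 x ⟨hx.1.le, hx.2⟩ y hy
    rwa [abs_of_nonneg (by linarith), mul_comm V] at this
  have hz := rectIntegral_eq_zero hab hTT hF
  rw [rectIntegral] at hz
  have hd := hhor (-T) (by rw [abs_neg, abs_of_nonneg hT])
  have hu := hhor T (abs_of_nonneg hT)
  set p := ∫ x in a..b, F (x + ((-T : ℝ) : ℂ) * I)
  set q := ∫ x in a..b, F (x + (T : ℂ) * I)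
  set l := ∫ y in (-T)..T, F (a + y * I)
  set r := ∫ y in (-T)..T, F (b + y * I)
  have hr : r = l + I * (p - q) := by
    linear_combination (-I) * hz + (r - l) * I_sq
  rw [← hsplit, hr]
  have hn : ‖I * (p - q)‖ ≤ 2 * ((b - a) * V) := by
    rw [norm_mul, norm_I, one_mul]
    exact (norm_sub_le _ _).trans (by linarith)
  calc _ ≤ ‖l‖ + ‖I * (p - q)‖ + _ := (norm_add_le _ _).trans (by gcongr; exact norm_add_le _ _)
    _ ≤ _ := by gcongr

instance : Countable EisInt := by
  have h : Function.Surjective fun k : ℤ × ℤ => eis k.1 k.2 := fun α => by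
    obtain ⟨x, y, rfl⟩ := eis_surjective α
    exact ⟨(x, y), rfl⟩
  exact h.countable

lemma norm_weight_logDeriv_le {w : 𝓢(ℝ, ℝ)} (hw : ∀ t : ℝ, 0 ≤ w t) {X K : ℝ}
    (hK : ∀ (N : ℕ) [NeZero N] (χ : DirichletCharacter ℂ N) (s : ℂ), 3 / 2 ≤ s.re →
      ‖logDeriv χ.LFunction s‖ ≤ K)
    (α : family) {s : ℂ} (hs : 3 / 2 ≤ s.re) :
    ‖(w ((nrm α.1 : ℝ) / X) : ℂ) * logDeriv (cubicChar α).LFunction s‖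
      ≤ w ((nrm α.1 : ℝ) / X) * K := by
  rw [norm_mul, norm_real, Real.norm_eq_abs, abs_of_nonneg (hw _)]
  exact mul_le_mul_of_nonneg_left (hK _ _ s hs) (hw _)

lemma norm_logDerivSum_le {w : 𝓢(ℝ, ℝ)} (hw : ∀ t : ℝ, 0 ≤ w t) {X K : ℝ}
    (hX : 0 < X) (hK : ∀ (N : ℕ) [NeZero N] (χ : DirichletCharacter ℂ N) (s : ℂ), 3 / 2 ≤ s.re →
      ‖logDeriv χ.LFunction s‖ ≤ K)
    {r : ℂ} (hr : 1 ≤ r.re) :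
    ‖logDerivSum w X r‖ ≤ totalWeight w X * K := by
  have h := ((summable_weight w hX).mul_right K).hasSum
  rw [tsum_mul_right] at h
  exact tsum_of_norm_bounded h fun α =>
    norm_weight_logDeriv_le hw hK α (by simp; linarith)

lemma continuous_logDeriv_line (α : family) :
    Continuous fun y : ℝ => logDeriv (cubicChar α).LFunction ((3 / 2 : ℝ) + y * I) := by
  have hL := differentiable_cubic α
  have hLd : Differentiable ℂ (deriv (cubicChar α).LFunction) := fun z =>
    (hL.differentiableOn.deriv isOpen_univ).differentiableAt univ_mem
  have h1 : Continuous fun y : ℝ => ((3 / 2 : ℝ) + y * I : ℂ) := by fun_prop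
  exact (hLd.continuous.comp h1).div (hL.continuous.comp h1) fun y =>
    (cubicChar α).LFunction_ne_zero_of_one_le_re (Or.inl (cubicChar_ne_one α)) (by norm_num)

lemma line_eq (y : ℝ) : (1 / 2 + (((1 : ℝ) : ℂ) + y * I) : ℂ) = (3 / 2 : ℝ) + y * I := by
  push_cast; ring

lemma continuous_logDerivSum_line {w : 𝓢(ℝ, ℝ)} (hw : ∀ t : ℝ, 0 ≤ w t) {X K : ℝ}
    (hX : 0 < X)
    (hK : ∀ (N : ℕ) [NeZero N] (χ : DirichletCharacter ℂ N) (s : ℂ), 3 / 2 ≤ s.re →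
      ‖logDeriv χ.LFunction s‖ ≤ K) :
    Continuous fun y : ℝ => logDerivSum w X ((1 : ℝ) + y * I) := by
  simp only [logDerivSum, line_eq]
  refine continuous_tsum (fun α => (continuous_logDeriv_line α).const_mul _)
    ((summable_weight w hX).mul_right K) fun α y => ?_
  exact norm_weight_logDeriv_le hw hK α (by norm_num)

/-- The prime sides of the family sum to an integral of the weighted logarithmic derivative. -/
lemma hasSum_weight_primeSide {w : 𝓢(ℝ, ℝ)} (hw : ∀ t : ℝ, 0 ≤ w t) {X K : ℝ}
    (hX : 0 < X) (hK : ∀ (N : ℕ) [NeZero N] (χ : DirichletCharacter ℂ N) (s : ℂ), 3 / 2 ≤ s.re →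
      ‖logDeriv χ.LFunction s‖ ≤ K)
    {g : ℂ → ℂ} {κ P : ℝ} (hg : Continuous g)
    (hgP : ∀ y : ℝ, ‖g ((y - I) * κ)‖ ≤ P * (1 + y ^ 2)⁻¹) :
    HasSum (fun α : family => (w ((nrm α.1 : ℝ) / X) : ℂ) * primeSide g κ α)
      (∫ y : ℝ, logDerivSum w X ((1 : ℝ) + y * I) * g ((y - I) * κ)) := by
  have hP : 0 ≤ P := by simpa using (norm_nonneg _).trans (hgP 0)
  have hK0 : 0 ≤ K := (norm_nonneg _).trans (hK 1 1 2 (by norm_num))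
  have hgc : Continuous fun y : ℝ => g ((y - I) * κ) := hg.comp (by fun_prop)
  have hpt : ∀ (α : family) (y : ℝ), ‖(w ((nrm α.1 : ℝ) / X) : ℂ) *
      logDeriv (cubicChar α).LFunction ((3 / 2 : ℝ) + y * I) * g ((y - I) * κ)‖
        ≤ w ((nrm α.1 : ℝ) / X) * K * P * (1 + y ^ 2)⁻¹ := by
    intro α y
    rw [norm_mul, mul_assoc _ P]
    exact mul_le_mul (norm_weight_logDeriv_le hw hK α (by norm_num)) (hgP y) (norm_nonneg _)
      (mul_nonneg (hw _) hK0)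
  have hi : ∀ c : ℝ, Integrable fun y : ℝ => c * (1 + y ^ 2)⁻¹ := fun c =>
    integrable_inv_one_add_sq.const_mul c
  have h := hasSum_integral_of_summable_integral_norm
    (F := fun (α : family) (y : ℝ) => (w ((nrm α.1 : ℝ) / X) : ℂ) *
      logDeriv (cubicChar α).LFunction ((3 / 2 : ℝ) + y * I) * g ((y - I) * κ))
    (μ := volume) (fun α => (hi _).mono'
      (((continuous_logDeriv_line α).const_mul _).mul hgc).aestronglyMeasurable
      (ae_of_all _ (hpt α))) (by
        refine Summable.of_nonneg_of_le (fun α => integral_nonneg fun _ => norm_nonneg _)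
          (fun α => integral_mono_of_nonneg (ae_of_all _ fun _ => norm_nonneg _) (hi _)
            (ae_of_all _ (hpt α))) ?_
        simp_rw [integral_const_mul]
        exact (((summable_weight w hX).mul_right K).mul_right P).mul_right _)
  convert! h using 1
  · ext α
    rw [primeSide, ← integral_const_mul]
    simp only [mul_assoc]
  · congr 1
    ext y
    rw [tsum_mul_right, logDerivSum]
    simp only [line_eq]

end

/-! ### The prime side on average -/

section

open Complex Set Filter Topology MeasureTheory Metric

lemma tendsto_scaleL : Tendsto scaleL atTop atTop := by
  refine Real.tendsto_log_atTop.comp (tendsto_id.atTop_div_const ?_)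
  have := Real.pi_pos
  positivity

lemma scaleL_div_le_log {X : ℝ} (hX : 1 ≤ X) : scaleL X / (2 * Real.pi) ≤ Real.log X := by
  have hpi := Real.pi_gt_three
  have he : 1 ≤ Real.exp 1 := Real.one_le_exp (by norm_num)
  have hX0 : 0 < X := by linarith
  have h1 : scaleL X ≤ Real.log X := by
    refine Real.log_le_log (by positivity) (div_le_self hX0.le ?_)
    nlinarith
  rw [div_le_iff₀ (by positivity)]
  have := Real.log_nonneg hX
  nlinarith

lemma inv_one_add_abs_sq_le (y : ℝ) : 1 / (1 + |y|) ^ 2 ≤ (1 + y ^ 2)⁻¹ := by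
  rw [one_div]
  exact inv_anti₀ (by positivity) (one_add_sq_le y)

/-- Bounds for the rescaled test function `r ↦ g(-i r κ)`. -/
lemma IsTestFunction.norm_scaled_le {g : ℂ → ℂ} {σ C : ℝ} {k : ℕ} (hg : IsTestFunction g σ)
    (hC0 : 0 < C)
    (hC : ∀ z : ℂ, ‖g z‖ ≤ C * Real.exp (σ * |z.im|) / (1 + |z.re|) ^ k) {X κ : ℝ} (hX : 1 ≤ X)
    (hκ1 : 1 ≤ κ) (hκ : κ ≤ Real.log X) {r : ℂ} (hr : 0 ≤ r.re) :
    ‖g (-I * r * κ)‖ ≤ C * X ^ (σ * r.re) / (1 + |r.im|) ^ k := by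
  have hX0 : 0 < X := by linarith
  have hre : (-I * r * κ).re = κ * r.im := by
    rw [mul_comm _ (κ : ℂ), re_ofReal_mul]; simp
  have him : (-I * r * κ).im = -(κ * r.re) := by
    rw [mul_comm _ (κ : ℂ), im_ofReal_mul]; simp
  have h := hC (-I * r * κ)
  have hσ := hg.nonneg
  rw [hre, him, abs_neg, abs_mul, abs_mul, abs_of_nonneg (by linarith : 0 ≤ κ),
    abs_of_nonneg hr] at h
  have h1 : |r.im| ≤ κ * |r.im| := le_mul_of_one_le_left (abs_nonneg _) hκ1
  have h2 : σ * (κ * r.re) ≤ Real.log X * (σ * r.re) := by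
    calc σ * (κ * r.re) ≤ σ * (Real.log X * r.re) := by gcongr
      _ = _ := by ring
  rw [Real.rpow_def_of_pos hX0]
  refine h.trans ?_
  gcongr

set_option maxHeartbeats 1000000 in
/-- Under the Ratios Conjecture the weighted prime side is given by its diagonal prediction, with an
error that saves almost a square root of the family size. The difference is an integral over
`Re r = 1`, whose part up to a height `T` just below `X` is moved to `Re r = 3 δ`, where the
conjecture applies and the test function has size only `X ^ (3 σ δ)`. -/
theorem exists_primeSide_approx {w : 𝓢(ℝ, ℝ)} (hw_even : ∀ t : ℝ, w (-t) = w t)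
    (hw : ∀ t : ℝ, 0 ≤ w t) (hw_ne : w ≠ 0) (hR : RatiosConjecture w) {g : ℂ → ℂ} {σ : ℝ}
    (hg : IsTestFunction g σ) {ε : ℝ} (hε : 0 < ε) :
    ∃ C : ℝ, ∀ᶠ X : ℝ in atTop,
      (Summable fun α : family => (w ((nrm α.1 : ℝ) / X) : ℂ) *
        primeSide g (scaleL X / (2 * Real.pi)) α) ∧
      ‖(∑' α : family, (w ((nrm α.1 : ℝ) / X) : ℂ) * primeSide g (scaleL X / (2 * Real.pi)) α)
        - (totalWeight w X : ℂ) *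
          ∫ y : ℝ, primeSum (y * I) * g ((scaleL X / (2 * Real.pi) * y : ℝ) : ℂ)‖
      ≤ C * (totalWeight w X * X ^ (-1 / 2 + ε)) := by
  have hpi := Real.pi_pos
  have hσ := hg.nonneg
  -- the conjecture costs `X ^ ε₁`, and the test function on the line `Re r = 3 δ` costs `X ^ (ε / 2)`
  set ε₁ := min (ε / 2) (1 / 8) with hε₁
  have hε₁0 : 0 < ε₁ := by positivity
  have hε₁1 : ε₁ ≤ ε / 2 := min_le_left _ _
  have hε₁2 : ε₁ ≤ 1 / 8 := min_le_right _ _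
  set δ := min (1 / 16) (ε / (6 * (σ + 1))) with hδ
  have hδ0 : 0 < δ := by positivity
  have hδ1 : δ ≤ 1 / 16 := min_le_left _ _
  have hδ2 : σ * (3 * δ) ≤ ε / 2 := by
    have h1 : δ ≤ ε / (6 * (σ + 1)) := min_le_right _ _
    rw [le_div_iff₀ (by positivity)] at h1
    nlinarith
  -- on `Re r ≤ 1` the test function has size `X ^ σ`; as `1 + T ≥ X ^ (1 / 2)`, a decay of order
  -- `k ≥ 2 σ + 1` outweighs this and gains `X ^ (-1 / 2)` besides
  set k := ⌈2 * σ + 1⌉₊ with hk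
  have hk1 : 2 * σ + 1 ≤ k := Nat.le_ceil _
  obtain ⟨C₀, hC₀, hev⟩ := hR.logDerivSum_approx hδ0 hδ1 hε₁0 (by linarith)
  obtain ⟨C₂, hC₂0, hC₂⟩ := hg.decay 2
  obtain ⟨C₃, hC₃0, hC₃⟩ := hg.decay (k + 2)
  obtain ⟨K, hK0, hK⟩ := exists_logDeriv_bound
  obtain ⟨K', hK'0, hK'⟩ := exists_norm_primeSum_le
  obtain ⟨c, hc0, hcW⟩ := exists_mul_le_totalWeight hw_even hw hw_ne
  refine ⟨(Real.pi * C₀ * C₂ + 2 * C₀ * C₃) / c + Real.pi * (K + K') * C₃, ?_⟩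
  have hκev : ∀ᶠ X : ℝ in atTop, 2 * Real.pi ≤ scaleL X := tendsto_scaleL.eventually_ge_atTop _
  have hTev : ∀ᶠ X : ℝ in atTop, (2 : ℝ) ≤ X ^ (1 / 4 : ℝ) :=
    (tendsto_rpow_atTop (by norm_num)).eventually_ge_atTop _
  filter_upwards [hev, hcW, hκev, hTev, eventually_ge_atTop 1] with X hX hWX hκX hTX hX1
  obtain ⟨hnv, happ⟩ := hX
  have hX0 : 0 < X := by linarith
  set κ := scaleL X / (2 * Real.pi) with hκ
  have hκ1 : 1 ≤ κ := by rwa [hκ, le_div_iff₀ (by positivity), one_mul]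
  have hκlog : κ ≤ Real.log X := scaleL_div_le_log hX1
  set W := totalWeight w X with hW
  have hW0 : 0 < W := lt_of_lt_of_le (by positivity) hWX
  set T := X ^ (1 - 2 * ε₁) / 2 with hT
  have hT0 : 0 ≤ T := by positivity
  have hT2 : T < X ^ (1 - 2 * ε₁) := half_lt_self (by positivity)
  have hTsqrt : X ^ (1 / 2 : ℝ) ≤ 1 + T := by
    have h1 : X ^ (3 / 4 : ℝ) ≤ X ^ (1 - 2 * ε₁) :=
      Real.rpow_le_rpow_of_exponent_le hX1 (by linarith)
    have h2 : X ^ (3 / 4 : ℝ) = X ^ (1 / 2 : ℝ) * X ^ (1 / 4 : ℝ) := by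
      rw [← Real.rpow_add hX0]; norm_num
    have h3 : 0 < X ^ (1 / 2 : ℝ) := by positivity
    rw [hT]
    nlinarith
  have hdecay : X ^ σ / (1 + T) ^ k ≤ X ^ (-1 / 2 : ℝ) := by
    rw [div_le_iff₀ (by positivity)]
    calc X ^ σ ≤ X ^ ((-1 / 2 : ℝ) + 1 / 2 * k) :=
          Real.rpow_le_rpow_of_exponent_le hX1 (by linarith)
      _ = X ^ (-1 / 2 : ℝ) * (X ^ (1 / 2 : ℝ)) ^ k := by
          rw [Real.rpow_add hX0, Real.rpow_mul hX0.le, Real.rpow_natCast]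
      _ ≤ _ := by gcongr
  set G : ℂ → ℂ := fun r => g (-I * r * κ) with hG
  have hGd : Differentiable ℂ G := hg.differentiable.comp (by fun_prop)
  have hG2 : ∀ r : ℂ, 0 ≤ r.re → ‖G r‖ ≤ C₂ * X ^ (σ * r.re) / (1 + |r.im|) ^ 2 := fun r hr =>
    hg.norm_scaled_le hC₂0 hC₂ hX1 hκ1 hκlog hr
  have hG3 : ∀ r : ℂ, 0 ≤ r.re → ‖G r‖ ≤ C₃ * X ^ (σ * r.re) / (1 + |r.im|) ^ (k + 2) :=
    fun r hr => hg.norm_scaled_le hC₃0 hC₃ hX1 hκ1 hκlog hr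
  have hG2' : ∀ r : ℂ, 0 ≤ r.re → r.re ≤ 1 → ‖G r‖ ≤ C₂ * X ^ σ / (1 + |r.im|) ^ 2 := by
    intro r h0 h1
    refine (hG2 r h0).trans ?_
    gcongr
    nlinarith
  -- beyond height `T` the test function is negligible
  have hG3' : ∀ r : ℂ, 0 ≤ r.re → r.re ≤ 1 → T ≤ |r.im| →
      ‖G r‖ ≤ C₃ * X ^ (-1 / 2 : ℝ) * (1 / (1 + |r.im|) ^ 2) := by
    intro r h0 h1 h2
    refine (hG3 r h0).trans ?_
    rw [pow_add]
    calc C₃ * X ^ (σ * r.re) / ((1 + |r.im|) ^ k * (1 + |r.im|) ^ 2)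
        ≤ C₃ * X ^ σ / ((1 + T) ^ k * (1 + |r.im|) ^ 2) := by
          gcongr
          nlinarith
      _ = C₃ * (X ^ σ / (1 + T) ^ k) * (1 / (1 + |r.im|) ^ 2) := by
          field_simp
      _ ≤ _ := by gcongr
  have hre1 : ∀ y : ℝ, (((1 : ℝ) : ℂ) + y * I).re = 1 := fun y => by simp
  have him1 : ∀ y : ℝ, (((1 : ℝ) : ℂ) + y * I).im = y := fun y => by simp
  have hGline : ∀ y : ℝ, G ((1 : ℝ) + y * I) = g ((y - I) * κ) := by
    intro y
    simp only [hG]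
    congr 1
    push_cast
    linear_combination (-(y : ℂ) * κ) * I_sq
  have hGP : ∀ y : ℝ, ‖G ((1 : ℝ) + y * I)‖ ≤ C₂ * X ^ σ * (1 + y ^ 2)⁻¹ := by
    intro y
    have h := hG2' ((1 : ℝ) + y * I) (by rw [hre1]; norm_num) (hre1 y).le
    rw [him1, div_eq_mul_one_div] at h
    exact h.trans (by gcongr; exact inv_one_add_abs_sq_le y)
  have hsum := hasSum_weight_primeSide hw hX0 hK hg.differentiable.continuous
    (fun y => by rw [← hGline]; exact hGP y)
  simp_rw [← hGline] at hsum
  -- shift the predicted term to the line `Re r = 1`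
  have hpred : ∫ y : ℝ, primeSum (y * I) * g ((κ * y : ℝ) : ℂ)
      = ∫ y : ℝ, primeSum ((1 : ℝ) + y * I) * G ((1 : ℝ) + y * I) := by
    have h := integral_vertical_eq (f := fun r => primeSum r * G r) (a := 0) (b := 1)
      (K := K' * (C₂ * X ^ σ)) zero_le_one
      (((differentiableOn_primeSum.mono fun r hr => by
        have : 0 ≤ r.re := hr.1
        show -1 / 24 < r.re
        linarith)).mul hGd.differentiableOn) (fun s h0 h1 => by
        rw [norm_mul, mul_div_assoc]
        exact mul_le_mul (hK' s (by linarith)) (hG2' s h0 h1) (norm_nonneg _) hK'0.le)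
    rw [← h]
    congr 1
    ext y
    simp only [hG, ofReal_zero, zero_add]
    congr 2
    push_cast
    linear_combination (y : ℂ) * κ * I_sq
  refine ⟨hsum.summable, ?_⟩
  rw [hsum.tsum_eq, hpred]
  set D : ℂ → ℂ := fun r => logDerivSum w X r - (W : ℂ) * primeSum r with hD
  have hi : ∀ (f : ℝ → ℂ) (M : ℝ), Continuous f → (∀ y, ‖f y‖ ≤ M) →
      Integrable fun y : ℝ => f y * G ((1 : ℝ) + y * I) := by
    intro f M hf hM
    have hM0 : 0 ≤ M := (norm_nonneg _).trans (hM 0)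
    have hGc : Continuous fun y : ℝ => G ((1 : ℝ) + y * I) := hGd.continuous.comp (by fun_prop)
    refine Integrable.mono' (integrable_inv_one_add_sq.const_mul (M * (C₂ * X ^ σ)))
      (hf.mul hGc).aestronglyMeasurable (ae_of_all _ fun y => ?_)
    rw [norm_mul, mul_assoc]
    exact mul_le_mul (hM y) (hGP y) (norm_nonneg _) hM0
  have hSb : ∀ y : ℝ, ‖logDerivSum w X ((1 : ℝ) + y * I)‖ ≤ W * K := fun y =>
    norm_logDerivSum_le hw hX0 hK (hre1 y).ge
  have hMb : ∀ y : ℝ, ‖primeSum ((1 : ℝ) + y * I)‖ ≤ K' := fun y =>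
    hK' _ (by rw [hre1]; norm_num)
  have hi1 := hi _ _ (continuous_logDerivSum_line hw hX0 hK) hSb
  have hpc : Continuous fun y : ℝ => primeSum ((1 : ℝ) + y * I) :=
    differentiableOn_primeSum.continuousOn.comp_continuous (by fun_prop) fun y => by
      have h4 : -1 / 24 < (((1 : ℝ) : ℂ) + y * I).re := by rw [hre1]; norm_num
      exact h4
  have hi2 := hi _ _ hpc hMb
  have hdiff : (∫ y : ℝ, logDerivSum w X ((1 : ℝ) + y * I) * G ((1 : ℝ) + y * I))
      - (W : ℂ) * ∫ y : ℝ, primeSum ((1 : ℝ) + y * I) * G ((1 : ℝ) + y * I)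
      = ∫ y : ℝ, D ((1 : ℝ) + y * I) * G ((1 : ℝ) + y * I) := by
    rw [← integral_const_mul, ← integral_sub hi1 (hi2.const_mul _)]
    congr 1
    ext y
    simp only [hD]
    ring
  have hDint : Integrable fun y : ℝ => D ((1 : ℝ) + y * I) * G ((1 : ℝ) + y * I) := by
    refine (hi1.sub (hi2.const_mul (W : ℂ))).congr (ae_of_all _ fun y => ?_)
    simp only [hD, Pi.sub_apply]
    ring
  rw [hdiff]
  set B := C₀ * X ^ (1 / 2 + ε₁) with hB
  have hB0 : 0 ≤ B := by positivity
  have hXhalf : X ^ (-1 / 2 : ℝ) ≤ 1 := Real.rpow_le_one_of_one_le_of_nonpos hX1 (by norm_num)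
  have hrect := norm_integral_shift_le (F := fun r => D r * G r) (a := 3 * δ) (b := 1) (T := T)
    (U := B * (C₂ * X ^ (σ * (3 * δ)))) (V := B * C₃)
    (W := W * (K + K') * (C₃ * X ^ (-1 / 2 : ℝ))) (by linarith) hT0 ?_ hDint (by positivity)
    (by positivity) ?_ ?_ ?_
  · have hP1 : X ^ (1 / 2 + ε₁) * X ^ (σ * (3 * δ)) ≤ X * X ^ (-1 / 2 + ε) := by
      rw [← Real.rpow_add hX0, ← Real.rpow_one_add' hX0.le (by linarith)]
      exact Real.rpow_le_rpow_of_exponent_le hX1 (by linarith)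
    have hP2 : X ^ (1 / 2 + ε₁) ≤ X * X ^ (-1 / 2 + ε) := by
      rw [← Real.rpow_one_add' hX0.le (by linarith)]
      exact Real.rpow_le_rpow_of_exponent_le hX1 (by linarith)
    have hP3 : X ^ (-1 / 2 : ℝ) ≤ X ^ (-1 / 2 + ε) :=
      Real.rpow_le_rpow_of_exponent_le hX1 (by linarith)
    have hP4 : X * X ^ (-1 / 2 + ε) ≤ W * X ^ (-1 / 2 + ε) / c := by
      rw [le_div_iff₀ hc0]
      calc _ = c * X * X ^ (-1 / 2 + ε) := by ring
        _ ≤ _ := by gcongr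
    have hδle : (1 - 3 * δ) * (B * C₃) ≤ B * C₃ :=
      mul_le_of_le_one_left (by positivity) (by linarith)
    calc _ ≤ Real.pi * (B * (C₂ * X ^ (σ * (3 * δ)))) + 2 * (B * C₃)
          + Real.pi * (W * (K + K') * (C₃ * X ^ (-1 / 2 : ℝ))) := by
          refine hrect.trans ?_
          gcongr
      _ = Real.pi * C₀ * C₂ * (X ^ (1 / 2 + ε₁) * X ^ (σ * (3 * δ)))
          + 2 * C₀ * C₃ * X ^ (1 / 2 + ε₁)
          + Real.pi * (K + K') * C₃ * (W * X ^ (-1 / 2 : ℝ)) := by rw [hB]; ring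
      _ ≤ Real.pi * C₀ * C₂ * (W * X ^ (-1 / 2 + ε) / c)
          + 2 * C₀ * C₃ * (W * X ^ (-1 / 2 + ε) / c)
          + Real.pi * (K + K') * C₃ * (W * X ^ (-1 / 2 + ε)) := by
          gcongr
          · exact hP1.trans hP4
          · exact hP2.trans hP4
      _ = _ := by ring
  · have hd1 := differentiableOn_logDerivSum hX0 hδ0 (by linarith) (by positivity) hnv
    intro r hr
    obtain ⟨⟨h1, h2⟩, h3⟩ := hr
    have hrim := abs_le.2 h3
    have hr1 : 3 * δ ≤ r.re := h1
    have hmem : {r : ℂ | 2 * δ < r.re ∧ |r.im| < X ^ (1 - 2 * ε₁)} ∈ 𝓝 r :=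
      ((isOpen_lt continuous_const continuous_re).inter
        (isOpen_lt (continuous_abs.comp continuous_im) continuous_const)).mem_nhds
        ⟨by show 2 * δ < r.re; linarith, by show |r.im| < _; linarith⟩
    have hmem' : {r : ℂ | -1 / 24 < r.re} ∈ 𝓝 r :=
      (isOpen_lt continuous_const continuous_re).mem_nhds (by show -1 / 24 < r.re; linarith)
    exact (((hd1.differentiableAt hmem).sub
      ((differentiableOn_primeSum.differentiableAt hmem').const_mul _)).mul
        (hGd r)).differentiableWithinAt
  · intro y hy
    have hre : (((3 * δ : ℝ) : ℂ) + y * I).re = 3 * δ := by simp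
    have him : (((3 * δ : ℝ) : ℂ) + y * I).im = y := by simp
    have h1 := happ ((3 * δ : ℝ) + y * I) (by rw [hre]; linarith) (by rw [him]; linarith)
    have h2 := hG2 ((3 * δ : ℝ) + y * I) (by rw [hre]; linarith)
    rw [hre, him, div_eq_mul_one_div] at h2
    rw [norm_mul, mul_assoc]
    refine mul_le_mul h1 (h2.trans ?_) (norm_nonneg _) hB0
    gcongr
    exact inv_one_add_abs_sq_le y
  · intro x hx y hy
    have hre : ((x : ℂ) + y * I).re = x := by simp
    have him : ((x : ℂ) + y * I).im = y := by simp
    have hx0 : 3 * δ ≤ x := hx.1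
    have h1 := happ (x + y * I) (by rw [hre]; linarith) (by rw [him]; linarith)
    have h2 := hG3' (x + y * I) (by rw [hre]; linarith) (by rw [hre]; exact hx.2)
      (by rw [him]; exact hy.ge)
    rw [norm_mul]
    refine mul_le_mul h1 (h2.trans ?_) (norm_nonneg _) hB0
    have h3 : 1 / (1 + |((x : ℂ) + y * I).im|) ^ 2 ≤ 1 := by
      rw [div_le_one (by positivity)]
      exact one_le_pow₀ (by linarith [abs_nonneg ((x : ℂ) + y * I).im])
    calc _ ≤ C₃ * 1 * 1 := by gcongr
      _ = C₃ := by ring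
  · intro y hy
    have h2 := hG3' ((1 : ℝ) + y * I) (by rw [hre1]; norm_num) (hre1 y).le
      (by rw [him1]; exact hy)
    rw [him1] at h2
    rw [norm_mul, mul_assoc]
    refine mul_le_mul ?_ (h2.trans ?_) (norm_nonneg _) (by positivity)
    · refine (norm_sub_le _ _).trans ?_
      rw [norm_mul, norm_real, Real.norm_eq_abs, abs_of_pos hW0, mul_add]
      gcongr
      · exact hSb y
      · exact hMb y
    · gcongr
      exact inv_one_add_abs_sq_le y

end

/-! ### The one-level density -/

section

open Complex Set Filter Topology MeasureTheory

lemma conj_integral_primeSum {g : ℂ → ℂ} (heven : ∀ z, g (-z) = g z) (κ : ℝ) :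
    starRingEnd ℂ (∫ y : ℝ, primeSum (y * I) *
        starRingEnd ℂ (g (starRingEnd ℂ ((κ * y : ℝ) : ℂ))))
      = ∫ y : ℝ, primeSum (y * I) * g ((κ * y : ℝ) : ℂ) := by
  rw [← integral_conj, ← integral_neg_eq_self]
  congr 1
  ext y
  rw [map_mul, conj_conj, conj_ofReal, conj_primeSum, ← heven]
  congr 2
  · simp
  · push_cast; ring

/-- The diagonal prediction for the prime side, in the form in which it enters the main term. -/
lemma integral_primeSum_eq (φ : 𝓢(ℝ, ℂ)) {X : ℝ} (hX : 0 < scaleL X) :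
    (2 * Real.pi : ℂ)⁻¹ * (2 * ∫ y : ℝ, primeSum (y * I) *
        entireExt φ ((scaleL X / (2 * Real.pi) * y : ℝ) : ℂ))
      = -(2 / (scaleL X : ℂ) * (∫ τ : ℝ, φ τ * ∑' (ℓ : ℕ+) (p : Nat.Primes),
        ((aCoeff p * Real.log p : ℝ) : ℂ) /
          ((p : ℕ) : ℂ) ^ (3 * ((ℓ : ℕ) : ℂ) / 2
            + 6 * Real.pi * Complex.I * τ * ((ℓ : ℕ) : ℂ) / (scaleL X : ℂ)))) := by
  set u := scaleL X with hu
  have hpi := Real.pi_pos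
  have hpi' : (Real.pi : ℂ) ≠ 0 := ofReal_ne_zero.2 hpi.ne'
  have hu' : (u : ℂ) ≠ 0 := ofReal_ne_zero.2 hX.ne'
  have hsub := Measure.integral_comp_mul_left (fun y : ℝ =>
    primeSum (y * I) * entireExt φ ((u / (2 * Real.pi) * y : ℝ) : ℂ)) (2 * Real.pi / u)
  have habs : |(2 * Real.pi / u)⁻¹| = u / (2 * Real.pi) := by
    rw [abs_of_pos (by positivity), inv_div]
  rw [habs, real_smul] at hsub
  have hpt : ∀ τ : ℝ, primeSum (((2 * Real.pi / u * τ : ℝ) : ℂ) * I)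
        * entireExt φ ((u / (2 * Real.pi) * (2 * Real.pi / u * τ) : ℝ) : ℂ)
      = -(φ τ * ∑' (ℓ : ℕ+) (p : Nat.Primes), ((aCoeff p * Real.log p : ℝ) : ℂ) /
          ((p : ℕ) : ℂ) ^ (3 * ((ℓ : ℕ) : ℂ) / 2
            + 6 * Real.pi * Complex.I * τ * ((ℓ : ℕ) : ℂ) / (u : ℂ))) := by
    intro τ
    have e1 : u / (2 * Real.pi) * (2 * Real.pi / u * τ) = τ := by field_simp
    have hr : (((2 * Real.pi / u * τ : ℝ) : ℂ) * I).re = 0 := by simp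
    have e2 : ∀ ℓ : ℕ+, (3 * ((ℓ : ℕ) : ℂ) / 2
        + 6 * Real.pi * Complex.I * τ * ((ℓ : ℕ) : ℂ) / (u : ℂ))
          = (ℓ : ℕ) * (3 / 2 + 3 * (((2 * Real.pi / u * τ : ℝ) : ℂ) * I)) := by
      intro ℓ; push_cast; ring
    simp_rw [e2]
    rw [tsum_tsum_eq_neg_primeSum hr, e1, entireExt_ofReal]
    ring
  simp_rw [hpt] at hsub
  rw [integral_neg] at hsub
  push_cast at hsub ⊢
  have e3 : ∀ A B : ℂ, -A = u / (2 * Real.pi) * B → (2 * Real.pi : ℂ)⁻¹ * (2 * B) = -(2 / u * A) := by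
    intro A B h
    rw [← mul_neg, h]
    field_simp
  exact e3 _ _ hsub

/-- The deviation of the one-level density from its predicted main term comes entirely from the
prime sides of the explicit formula. -/
lemma oneLevelDensity_sub_mainTerm (w : 𝓢(ℝ, ℝ)) {φ : 𝓢(ℝ, ℂ)} (hφ : ∀ τ : ℝ, φ (-τ) = φ τ)
    (hs : HasCompactSupport (𝓕 (φ : ℝ → ℂ))) {X : ℝ} (hX0 : 0 < X) (hX : 0 < scaleL X)
    (hW : 0 < totalWeight w X)
    (h1 : Summable fun α : family => (w ((nrm α.1 : ℝ) / X) : ℂ) *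
      primeSide (entireExt φ) (scaleL X / (2 * Real.pi)) α)
    (h2 : Summable fun α : family => (w ((nrm α.1 : ℝ) / X) : ℂ) *
      primeSide (fun z => starRingEnd ℂ (entireExt φ (starRingEnd ℂ z)))
        (scaleL X / (2 * Real.pi)) α) :
    oneLevelDensity w φ X - mainTerm w φ X = (2 * Real.pi * totalWeight w X : ℂ)⁻¹ *
      (((∑' α : family, (w ((nrm α.1 : ℝ) / X) : ℂ) *
          primeSide (entireExt φ) (scaleL X / (2 * Real.pi)) α) - (totalWeight w X : ℂ) *
          ∫ y : ℝ, primeSum (y * I) * entireExt φ ((scaleL X / (2 * Real.pi) * y : ℝ) : ℂ))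
      + starRingEnd ℂ ((∑' α : family, (w ((nrm α.1 : ℝ) / X) : ℂ) *
          primeSide (fun z => starRingEnd ℂ (entireExt φ (starRingEnd ℂ z)))
            (scaleL X / (2 * Real.pi)) α) - (totalWeight w X : ℂ) *
          ∫ y : ℝ, primeSum (y * I) *
            starRingEnd ℂ (entireExt φ (starRingEnd ℂ ((scaleL X / (2 * Real.pi) * y : ℝ) : ℂ)))))
    := by
  have hWC : (totalWeight w X : ℂ) ≠ 0 := ofReal_ne_zero.2 hW.ne'
  have hpi' : (Real.pi : ℂ) ≠ 0 := ofReal_ne_zero.2 Real.pi_pos.ne'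
  have hu' : (scaleL X : ℂ) ≠ 0 := ofReal_ne_zero.2 hX.ne'
  have hlog : Summable fun α : family =>
      (w ((nrm α.1 : ℝ) / X) : ℂ) * (Real.log (nrm α.1) : ℂ) :=
    summable_weight_mul w hX0 (A := 1) (m := 1) fun α _ => by
      have h3 := one_le_nrm α
      rw [norm_real, Real.norm_eq_abs, abs_of_nonneg (Real.log_nonneg h3), pow_one, one_mul]
      exact Real.log_le_self (by linarith)
  have hw0 : HasSum (fun α : family => (w ((nrm α.1 : ℝ) / X) : ℂ)) (totalWeight w X : ℂ) := by
    have h := (summable_weight w hX0).hasSum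
    rw [← totalWeight] at h
    exact_mod_cast h
  have hlogsum : ((∑' α : family, w ((nrm α.1 : ℝ) / X) * Real.log (nrm α.1) : ℝ) : ℂ)
      = ∑' α : family, (w ((nrm α.1 : ℝ) / X) : ℂ) * (Real.log (nrm α.1) : ℂ) := by
    push_cast
    rfl
  have h2' := h2.hasSum.map (starRingEnd ℂ) continuous_conj
  have htot := ((hlog.hasSum.mul_right (𝓕 (φ : ℝ → ℂ) 0 / scaleL X)).add
    (hw0.mul_right (gammaTerm φ X))).add ((h1.hasSum.add h2').mul_left (2 * Real.pi : ℂ)⁻¹)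
  have htrans : ∀ {f : family → ℂ} {c : ℂ}, HasSum f c →
      (∀ α : family, (w ((nrm α.1 : ℝ) / X) : ℂ) * zeroSum φ X α = f α) →
      ∑' α : family, (w ((nrm α.1 : ℝ) / X) : ℂ) * zeroSum φ X α = c :=
    fun h e => (tsum_congr e).trans h.tsum_eq
  have hzero := htrans htot fun α => by
    rw [zeroSum_eq φ hφ hs hX]
    simp only [Function.comp_apply, map_mul, conj_ofReal]
    ring
  have hpred := integral_primeSum_eq φ hX
  rw [oneLevelDensity, hzero, mainTerm, hlogsum, map_sub, map_mul, conj_ofReal,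
    conj_integral_primeSum (entireExt_neg φ hφ), gammaTerm]
  rw [eq_comm, ← sub_eq_zero] at hpred
  set S := ∑' α : family, (w ((nrm α.1 : ℝ) / X) : ℂ) * (Real.log (nrm α.1) : ℂ)
  set P := ∫ y : ℝ, primeSum (y * I) * entireExt φ ((scaleL X / (2 * Real.pi) * y : ℝ) : ℂ)
  set Q := ∫ τ : ℝ, φ τ * ∑' (ℓ : ℕ+) (p : Nat.Primes),
        ((aCoeff p * Real.log p : ℝ) : ℂ) /
          ((p : ℕ) : ℂ) ^ (3 * ((ℓ : ℕ) : ℂ) / 2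
            + 6 * Real.pi * Complex.I * τ * ((ℓ : ℕ) : ℂ) / (scaleL X : ℂ))
  set D := ∫ τ : ℝ, φ τ *
        (Complex.digamma (1 / 4 - Real.pi * Complex.I * τ / (scaleL X : ℂ))
          + Complex.digamma (1 / 4 + Real.pi * Complex.I * τ / (scaleL X : ℂ)))
  have hP : P = -(2 * Real.pi / scaleL X * Q) := by
    field_simp at hpred ⊢
    linear_combination -hpred
  rw [hP]
  field_simp
  ring

end

end CubicRatios

open CubicRatios in
theorem theorem1p4 (w : 𝓢(ℝ, ℝ)) (hw_even : ∀ t : ℝ, w (-t) = w t) (hw_nonneg : ∀ t : ℝ, 0 ≤ w t)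
    (hw_ne : w ≠ 0) (hR : RatiosConjecture w)
    (φ : 𝓢(ℝ, ℂ)) (hφ_even : ∀ τ : ℝ, φ (-τ) = φ τ)
    (hφ_supp : HasCompactSupport (𝓕 (φ : ℝ → ℂ))) :
    ∀ ε : ℝ, 0 < ε →
      (fun X : ℝ => oneLevelDensity w φ X - mainTerm w φ X) =O[Filter.atTop]
        fun X : ℝ => X ^ (-1 / 2 + ε) := by
  intro ε hε
  obtain ⟨σ, hg⟩ := isTestFunction_entireExt φ hφ_supp
  obtain ⟨C₁, h1⟩ := exists_primeSide_approx hw_even hw_nonneg hw_ne hR hg hε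
  obtain ⟨C₂, h2⟩ := exists_primeSide_approx hw_even hw_nonneg hw_ne hR hg.conj hε
  obtain ⟨c, hc0, hcW⟩ := exists_mul_le_totalWeight hw_even hw_nonneg hw_ne
  refine Asymptotics.IsBigO.of_bound ((2 * Real.pi)⁻¹ * (C₁ + C₂)) ?_
  filter_upwards [h1, h2, hcW, tendsto_scaleL.eventually_gt_atTop 0,
    Filter.eventually_gt_atTop 0] with X hX1 hX2 hXW hXL hX0
  have hW : 0 < totalWeight w X := lt_of_lt_of_le (by positivity) hXW
  have hpi := Real.pi_pos
  rw [oneLevelDensity_sub_mainTerm w hφ_even hφ_supp hX0 hXL hW hX1.1 hX2.1, norm_mul, norm_inv]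
  have hn : ‖(2 * Real.pi * totalWeight w X : ℂ)‖ = 2 * Real.pi * totalWeight w X := by
    rw [norm_mul, norm_mul, Complex.norm_real, Complex.norm_real, Complex.norm_ofNat,
      Real.norm_of_nonneg hpi.le, Real.norm_of_nonneg hW.le]
  rw [hn, Real.norm_of_nonneg (by positivity : (0 : ℝ) ≤ X ^ (-1 / 2 + ε))]
  calc _ ≤ (2 * Real.pi * totalWeight w X)⁻¹ * (C₁ * (totalWeight w X * X ^ (-1 / 2 + ε))
        + C₂ * (totalWeight w X * X ^ (-1 / 2 + ε))) := by
        gcongr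
        refine (norm_add_le _ _).trans ?_
        rw [Complex.norm_conj]
        exact add_le_add hX1.2 hX2.2
    _ = _ := by field_simp
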